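/- **Setting.** All random variables live on one probability space and are identified when almost surely equal; a process is indexed by $t\in\mathbb Z$. Let $\Sigma$ be a finite alphabet, $\Sigma^*$ (resp. $\Sigma^+$) the set of words (resp. non-empty words), $p_\sigma>0$ $(\sigma\in\Sigma)$ fixed reals, and $p_w=p_{\sigma_1}\cdots p_{\sigma_k}$ for $w=\sigma_1\cdots\sigma_k$. The inputs $\mathbf u_\sigma(t)$ are real processes; put $\mathbf u_w(t)=\mathbf u_{\sigma_1}(t-k+1)\,\mathbf u_{\sigma_2}(t-k+2)\cdots\mathbf u_{\sigma_k}(t)$ and $\mathbf u_\epsilon=1$. Assume that $\sum_\sigma\alpha_\sigma\mathbf u_\sigma(t)=1$ for some constants $\alpha_\sigma$ and that all $\mathbf u_w(t)$ have finite second moments. Let $L\subseteq\Sigma^+$ be a set of admissible words: $\Sigma\subseteq L$, $\mathbf u_w(t)=0$ a.s. for $w\in\Sigma^+\setminus L$, and for some $S\subseteq\Sigma\times\Sigma$ a word of length $>1$ is in $L$ iff all pairs of consecutive letters are in $S$. For an $\mathbb R^k$-valued process $\mathbf r$ and $w\in\Sigma^+$ let $\mathbf z^{\mathbf r}_w(t)=\mathbf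 r(t-|w|)\mathbf u_w(t-1)/\sqrt{p_w}$, $T^{\mathbf r}_{w,v}=E[\mathbf z^{\mathbf r}_w(t)\mathbf z^{\mathbf r}_v(t)^T]$, $\Lambda^{\mathbf r}_w=E[\mathbf r(t)\mathbf z^{\mathbf r}_w(t)^T]$. The process $\mathbf r$ is *RC* if $\mathbf r(t)$ and all $\mathbf z^{\mathbf r}_w(t)$ are square integrable with mean zero, $\Lambda^{\mathbf r}_w$ and $T^{\mathbf r}_{w,v}$ do not depend on $t$, and for all $w,v\in\Sigma^+$, $\sigma,\sigma'\in\Sigma$: (a) $T^{\mathbf r}_{\sigma,\sigma'}=0$, $T^{\mathbf r}_{w\sigma,v\sigma'}=0$ and $T^{\mathbf r}_{w\sigma,\sigma'}=0$ if $\sigma\ne\sigma'$; (b) $T^{\mathbf r}_{w\sigma,v\sigma}=T^{\mathbf r}_{w,v}$ if $w\sigma\in L$ or $v\sigma\in L$; (c) $T^{\mathbf r}_{w\sigma,\sigma}=(\Lambda^{\mathbf r}_w)^T$ if $w\sigma\in L$; (d) $T^{\mathbf r}_{w,v}=0$ if $w\notin L$ or $v\notin L$, or if exactly one of $w\sigma,v\sigma$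 is in $L$. For a set $Z$ of square integrable random vectors, $E_l[\mathbf z\mid Z]$ is the random vector whose entries lie in the closed $L^2$-span of the entries of the elements of $Z$ and which satisfies $E[(\mathbf z-E_l[\mathbf z\mid Z])\zeta^T]=0$ for all $\zeta\in Z$. It is unique when it exists; for square integrable $\mathbf z$ it is the orthogonal projection. Let $\mathbf y$ be an $\mathbb R^p$-valued process, $\mathbf z_w=\mathbf z^{\mathbf y}_w$, $T_{w,v}=T^{\mathbf y}_{w,v}$. Let $\Psi_{\mathbf y}$ be the family of formal power series $S_{(j,\sigma)}:\Sigma^*\to\mathbb R^p$, $S_{(j,\sigma)}(w)=$ the $j$-th column of $\Lambda^{\mathbf y}_{\sigma w}$ $(1\le j\le p,\ \sigma\in\Sigma)$. A representation $R=(\mathbb R^n,\{A_\sigma\},B,C)$ of $\Psi_{\mathbf y}$ consists of $A_\sigma\in\mathbb R^{n\times n}$, $B_{(j,\sigma)}\in\mathbb R^n$, $C\in\mathbb R^{p\times n}$ with $S_{(j,\sigma)}(w)=CA_wB_{(j,\sigma)}$ for all $w$, where $A_{\sigma_1\cdots\sigma_k}=A_{\sigma_k}\cdots A_{\sigma_1}$,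 $A_\epsilon=I$; it is minimal if $n$ is smallest possible. $\Psi_{\mathbf y}$ is rational if it has a representation, and square summable if $\sum_{w}\|S_{(j,\sigma)}(w)\|^2<\infty$ for all $(j,\sigma)$. Put $\mathbf e(t)=\mathbf y(t)-E_l[\mathbf y(t)\mid\{\mathbf z_w(t)\}_{w\in\Sigma^+}]$ (forward innovation); $\mathbf y$ is full rank if $E[\mathbf e(t)\mathbf e(t)^T\mathbf u_\sigma(t)^2]$ has rank $p$ for every $\sigma$. A *GBS* realization of $\mathbf y$ is a system $\mathbf x(t+1)=\sum_\sigma(F_\sigma\mathbf x(t)+K_\sigma\mathbf v(t))\mathbf u_\sigma(t)$, $\mathbf y(t)=C\mathbf x(t)+D\mathbf v(t)$ with state process $\mathbf x$ and noise process $\mathbf v$. It is *regular* if: (1) $\mathbf v$ is RC; (2) $E[\mathbf z^{\mathbf v}_w(t)\mathbf z^{\mathbf v}_v(t)^T]=0$ for $w\ne v$ in $\Sigma^+$; (3) the entries of $\mathbf x(t)$ lie in the closed $L^2$-span of the entries of $\{\mathbf z^{\mathbf v}_w(t)\}_{w\in\Sigma^+}$; (4) all eigenvalues of $\sum_\sigma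 p_\sigma F_\sigma^T\otimes F_\sigma^T$ have modulus $<1$; (5) if $\sigma_1\sigma_2\notin L$ then $F_{\sigma_2}F_{\sigma_1}=0$ and $F_{\sigma_2}K_{\sigma_1}T^{\mathbf v}_{\sigma_1,\sigma_1}=0$. It is *in forward innovation form* if it is regular, $D=I_p$ and $\mathbf v=\mathbf e$. **Theorem.** Assume that $\mathbf y$ is RC and that $\Psi_{\mathbf y}$ is square summable and rational. Then $\mathbf y$ has a GBS realization in forward innovation form, obtained as follows. The process $\mathbf e$ and a minimal representation of $\Psi_{\mathbf y}$ exist. Let $R=(\mathbb R^n,\{A_\sigma\},B,C)$ be any minimal representation of $\Psi_{\mathbf y}$ and let $B_\sigma=[B_{(1,\sigma)},\dots,B_{(p,\sigma)}]$. The observability matrix $O_R$, whose block rows are $CA_w$, $|w|\le n-1$, has a left inverse; let $O_R^{-1}$ be any left inverse. Let $Y_n(t)$ be the vector with blocks $\mathbf y(t+|w|)\,\mathbf u_w(t+|w|-1)/\sqrt{p_w}$, $|w|\le n-1$ (in the same order). Then: 1. The process $\mathbf x(t)=E_l\big[O_R^{-1}Y_n(t)\mid\{\mathbf z_w(t)\}_{w\in\Sigma^+}\big]$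 exists, and $P_\sigma=E[\mathbf x(t)\mathbf x(t)^T\mathbf u_\sigma(t)^2]$ is finite and does not depend on $t$. 2. There are matrices $K_\sigma\in\mathbb R^{n\times p}$ $(\sigma\in\Sigma)$ with $$K_\sigma\,(p_\sigma T_{\sigma,\sigma}-CP_\sigma C^T)=\sqrt{p_\sigma}\,B_\sigma-\tfrac1{\sqrt{p_\sigma}}A_\sigma P_\sigma C^T .$$ 3. For all such $K_\sigma$, $$\mathbf x(t+1)=\sum_{\sigma\in\Sigma}\Big(\tfrac1{\sqrt{p_\sigma}}A_\sigma\mathbf x(t)+K_\sigma\mathbf e(t)\Big)\mathbf u_\sigma(t),\qquad \mathbf y(t)=C\mathbf x(t)+\mathbf e(t)$$ is a GBS realization of $\mathbf y$ in forward innovation form; in particular it is regular. 4. If $\mathbf y$ is full rank, then each $p_\sigma T_{\sigma,\sigma}-CP_\sigma C^T$ is invertible and $$K_\sigma=\Big(\sqrt{p_\sigma}\,B_\sigma-\tfrac1{\sqrt{p_\sigma}}A_\sigma P_\sigma C^T\Big)\,(p_\sigma T_{\sigma,\sigma}-CP_\sigma C^T)^{-1}.$$ -/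

import Mathlib

open MeasureTheory Matrix
open scoped Kronecker

noncomputable section

namespace StochReal

/-! ### Words and formal power series

A word over the alphabet `α` is a list of letters, read from left to right; the non-empty words are
the lists `w ≠ []`, and `w ++ [σ]` is the word `w` followed by the letter `σ`. -/

/-- Words of length at most `n - 1`. -/
abbrev ShortWord (α : Type*) (n : ℕ) : Type _ := {w : List α // w.length < n}

instance instFintypeShortWord (α : Type*) [Finite α] (n : ℕ) : Fintype (ShortWord α n) :=
  (List.finite_length_lt α n).fintype

/-- `A_w = A_{σ_k} ⋯ A_{σ_1}` for the word `w = σ_1 ⋯ σ_k`, and `A_ε = 1`. -/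
def wordProd {α : Type*} {n : ℕ} (A : α → Matrix (Fin n) (Fin n) ℝ) :
    List α → Matrix (Fin n) (Fin n) ℝ
  | [] => 1
  | σ :: w => wordProd A w * A σ

/-- The data `(ℝⁿ, (A_σ), (B_j), C)` of a representation of a `J`-indexed family of formal power
series with coefficients in `ℝᵖ`. -/
structure SeriesRep (α J : Type*) (p n : ℕ) where
  A : α → Matrix (Fin n) (Fin n) ℝ
  B : J → Fin n → ℝ
  C : Matrix (Fin p) (Fin n) ℝ

namespace SeriesRep

variable {α J : Type*} {p n : ℕ}

/-- `R` is a representation of the family `Ψ`. -/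
def Represents (R : SeriesRep α J p n) (Ψ : J → List α → Fin p → ℝ) : Prop :=
  ∀ j w, Ψ j w = (R.C * wordProd R.A w) *ᵥ R.B j

/-- `R` is a representation of `Ψ` of smallest possible dimension. -/
def IsMinimal (R : SeriesRep α J p n) (Ψ : J → List α → Fin p → ℝ) : Prop :=
  R.Represents Ψ ∧ ∀ (m : ℕ) (R' : SeriesRep α J p m), R'.Represents Ψ → n ≤ m

/-- The observability matrix: its block of rows indexed by the word `w`, `|w| ≤ n - 1`, is
`C A_w`. -/
def obsMatrix (R : SeriesRep α J p n) : Matrix (ShortWord α n × Fin p) (Fin n) ℝ :=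
  Matrix.of fun a j => (R.C * wordProd R.A a.1.1) a.2 j

end SeriesRep

/-- Rationality of a family of formal power series. -/
def IsRationalFamily {α J : Type*} {p : ℕ} (Ψ : J → List α → Fin p → ℝ) : Prop :=
  ∃ (n : ℕ) (R : SeriesRep α J p n), R.Represents Ψ

/-- Square summability: the sum of `‖Ψ_j(w)‖₂²` over all words is finite, for every `j`. -/
def IsSquareSummableFamily {α J : Type*} {p : ℕ} (Ψ : J → List α → Fin p → ℝ) : Prop :=
  ∀ j, Summable fun w : List α => ∑ i, (Ψ j w i) ^ 2

/-- All complex eigenvalues lie in the open unit disc. -/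
def IsStableMatrix {ι : Type*} [Fintype ι] [DecidableEq ι] (M : Matrix ι ι ℝ) : Prop :=
  ∀ μ ∈ spectrum ℂ (M.map (algebraMap ℝ ℂ)), ‖μ‖ < 1

/-! ### Random variables

An `ℝᵏ`-valued process is a function `ℤ → Ω → Fin k → ℝ`. -/

variable {Ω α : Type*} [MeasurableSpace Ω]

/-- The matrix `E[f gᵀ]`. -/
def crossCov (P : Measure Ω) {k l : ℕ} (f : Ω → Fin k → ℝ) (g : Ω → Fin l → ℝ) :
    Matrix (Fin k) (Fin l) ℝ :=
  Matrix.of fun i j => ∫ ω, f ω i * g ω j ∂P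

/-- The Hilbert space generated by the entries of a family of square integrable random vectors. -/
def hilbertSpan (P : Measure Ω) {ι : Type*} {k : ℕ} (X : ι → Ω → Fin k → ℝ) :
    Submodule ℝ (Lp ℝ 2 P) :=
  (Submodule.span ℝ
    {f : Lp ℝ 2 P | ∃ a i, (f : Ω → ℝ) =ᵐ[P] fun ω => X a ω i}).topologicalClosure

/-- The entries of the random vector `z` belong to the Hilbert space generated by the `X a`. -/
def InHilbertSpan (P : Measure Ω) {ι : Type*} {k l : ℕ} (X : ι → Ω → Fin k → ℝ)
    (z : Ω → Fin l → ℝ) : Prop :=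
  ∀ i, ∃ f ∈ hilbertSpan P X, (fun ω => z ω i) =ᵐ[P] (f : Ω → ℝ)

/-- `zhat = E_l[z | X]`: the entries of `zhat` belong to the Hilbert space generated by the
entries of the `X a`, and `E[(z - zhat) (X a)ᵀ] = 0` for all `a` (with integrable integrands).
For square integrable `z` and `X a` this says that `zhat` is (a version of) the orthogonal
projection of `z`; the two conditions determine `zhat` almost surely, and they make sense as soon
as the products of the entries of `z` with those of the `X a` are integrable. -/
def IsLinProj (P : Measure Ω) {ι : Type*} {k l : ℕ} (X : ι → Ω → Fin k → ℝ)
    (z zhat : Ω → Fin l → ℝ) : Prop :=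
  InHilbertSpan P X zhat ∧
    ∀ a i j, Integrable (fun ω => (z ω i - zhat ω i) * X a ω j) P ∧
      ∫ ω, (z ω i - zhat ω i) * X a ω j ∂P = 0

/-! ### Inputs -/

/-- `u_w(t) = u_{σ_1}(t-k+1) u_{σ_2}(t-k+2) ⋯ u_{σ_k}(t)` for `w = σ_1 ⋯ σ_k`. -/
def uWord (u : α → ℤ → Ω → ℝ) : List α → ℤ → Ω → ℝ
  | [], _, _ => 1
  | σ :: w, t, ω => u σ (t - w.length) ω * uWord u w t ω

/-- `ρ_w = ρ_{σ_1} ⋯ ρ_{σ_k}` for `w = σ_1 ⋯ σ_k`. -/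
def weight (ρ : α → ℝ) (w : List α) : ℝ := (w.map ρ).prod

/-- Some fixed linear combination of the inputs is `1`, and the products `u_w(t)` have finite first
and second moments. -/
structure InputAssumption [Fintype α] (P : Measure Ω) (u : α → ℤ → Ω → ℝ) : Prop where
  exists_coeff : ∃ c : α → ℝ, ∀ t, ∀ᵐ ω ∂P, ∑ σ, c σ * u σ t ω = 1
  memLp : ∀ w : List α, w ≠ [] → ∀ t, MemLp (uWord u w t) 2 P

/-- `L` is a set of admissible words. -/
structure IsAdmissible (P : Measure Ω) (u : α → ℤ → Ω → ℝ) (L : Set (List α)) : Prop where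
  ne_nil : [] ∉ L
  letter_mem : ∀ σ, [σ] ∈ L
  ae_zero : ∀ w, w ≠ [] → w ∉ L → ∀ t, ∀ᵐ ω ∂P, uWord u w t ω = 0
  exists_step : ∃ S : α → α → Prop, ∀ w : List α, 1 < w.length → (w ∈ L ↔ w.IsChain S)

/-! ### Products of a process with inputs -/

/-- `z^r_w(t) = r(t-|w|) u_w(t-1) / √ρ_w`. -/
def zPast (ρ : α → ℝ) (u : α → ℤ → Ω → ℝ) {k : ℕ} (r : ℤ → Ω → Fin k → ℝ) (w : List α) (t : ℤ) :
    Ω → Fin k → ℝ :=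
  fun ω i => r (t - w.length) ω i * uWord u w (t - 1) ω * (1 / √(weight ρ w))

/-- The family `z^r_w(t)`, `w` ranging over the non-empty words. -/
def pastFamily (ρ : α → ℝ) (u : α → ℤ → Ω → ℝ) {k : ℕ} (r : ℤ → Ω → Fin k → ℝ) (t : ℤ) :
    {w : List α // w ≠ []} → Ω → Fin k → ℝ :=
  fun w => zPast ρ u r w.1 t

/-- `z^f_w(t) = y(t+|w|) u_w(t+|w|-1) / √ρ_w`; for the empty word this is `y(t)`. -/
def zFuture (ρ : α → ℝ) (u : α → ℤ → Ω → ℝ) {k : ℕ} (y : ℤ → Ω → Fin k → ℝ) (w : List α) (t : ℤ) :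
    Ω → Fin k → ℝ :=
  fun ω i => y (t + w.length) ω i * uWord u w (t + w.length - 1) ω * (1 / √(weight ρ w))

/-- `T^r_{w,v} = E[z^r_w(t) z^r_v(t)ᵀ]`; it is used for processes for which this does not depend on
`t`, and is evaluated at `t = 0`. -/
def covT (P : Measure Ω) (ρ : α → ℝ) (u : α → ℤ → Ω → ℝ) {k : ℕ} (r : ℤ → Ω → Fin k → ℝ)
    (w v : List α) : Matrix (Fin k) (Fin k) ℝ :=
  crossCov P (zPast ρ u r w 0) (zPast ρ u r v 0)

/-- `Λ^r_w = E[r(t) z^r_w(t)ᵀ]`, with the same convention. -/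
def covΛ (P : Measure Ω) (ρ : α → ℝ) (u : α → ℤ → Ω → ℝ) {k : ℕ} (r : ℤ → Ω → Fin k → ℝ)
    (w : List α) : Matrix (Fin k) (Fin k) ℝ :=
  crossCov P (r 0) (zPast ρ u r w 0)

/-- `E[r(t) r(t)ᵀ u_σ(t)²]`. -/
def inputCov (P : Measure Ω) (u : α → ℤ → Ω → ℝ) {k : ℕ} (r : ℤ → Ω → Fin k → ℝ) (σ : α) (t : ℤ) :
    Matrix (Fin k) (Fin k) ℝ :=
  Matrix.of fun i j => ∫ ω, r t ω i * r t ω j * (u σ t ω * u σ t ω) ∂P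

/-- The recursive covariance property. -/
structure IsRC (P : Measure Ω) (ρ : α → ℝ) (u : α → ℤ → Ω → ℝ) (L : Set (List α)) {k : ℕ}
    (r : ℤ → Ω → Fin k → ℝ) : Prop where
  memLp : ∀ t i, MemLp (fun ω => r t ω i) 2 P
  memLp_z : ∀ w : List α, w ≠ [] → ∀ t i, MemLp (fun ω => zPast ρ u r w t ω i) 2 P
  mean_zero : ∀ t i, ∫ ω, r t ω i ∂P = 0
  mean_zero_z : ∀ w : List α, w ≠ [] → ∀ t i, ∫ ω, zPast ρ u r w t ω i ∂P = 0
  stationary : ∀ w : List α, w ≠ [] → ∀ t s : ℤ,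
    crossCov P (r (t + s)) (zPast ρ u r w (t + s)) = crossCov P (r t) (zPast ρ u r w t)
  stationary_z : ∀ w v : List α, w ≠ [] → v ≠ [] → ∀ t s : ℤ,
    crossCov P (zPast ρ u r w (t + s)) (zPast ρ u r v (t + s))
      = crossCov P (zPast ρ u r w t) (zPast ρ u r v t)
  letter_ne : ∀ σ σ' : α, σ ≠ σ' → covT P ρ u r [σ] [σ'] = 0
  snoc_eq : ∀ w v : List α, w ≠ [] → v ≠ [] → ∀ σ : α, (w ++ [σ] ∈ L ∨ v ++ [σ] ∈ L) →
    covT P ρ u r (w ++ [σ]) (v ++ [σ]) = covT P ρ u r w v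
  snoc_ne : ∀ w v : List α, w ≠ [] → v ≠ [] → ∀ σ σ' : α, σ ≠ σ' →
    covT P ρ u r (w ++ [σ]) (v ++ [σ']) = 0
  snoc_letter_eq : ∀ w : List α, w ≠ [] → ∀ σ : α, w ++ [σ] ∈ L →
    covT P ρ u r (w ++ [σ]) [σ] = (covΛ P ρ u r w)ᵀ
  snoc_letter_ne : ∀ w : List α, w ≠ [] → ∀ σ σ' : α, σ ≠ σ' →
    covT P ρ u r (w ++ [σ]) [σ'] = 0
  not_mem : ∀ w v : List α, w ≠ [] → v ≠ [] → (w ∉ L ∨ v ∉ L) → covT P ρ u r w v = 0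
  mixed_left : ∀ w v : List α, w ≠ [] → v ≠ [] → ∀ σ : α, w ++ [σ] ∈ L → v ++ [σ] ∉ L →
    covT P ρ u r v w = 0
  mixed_right : ∀ w v : List α, w ≠ [] → v ≠ [] → ∀ σ : α, v ++ [σ] ∈ L → w ++ [σ] ∉ L →
    covT P ρ u r v w = 0

/-! ### The output process -/

/-- The family `Ψ_y`: `S_{(j,σ)}(w)` is the `j`-th column of `Λ^y_{σw}`. -/
def outputFamily (P : Measure Ω) (ρ : α → ℝ) (u : α → ℤ → Ω → ℝ) {p : ℕ}
    (y : ℤ → Ω → Fin p → ℝ) : Fin p × α → List α → Fin p → ℝ :=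
  fun a w i => covΛ P ρ u y (a.2 :: w) i a.1

/-- `y` has the recursive covariance property, and `Ψ_y` is square summable and rational. -/
structure OutputAssumption (P : Measure Ω) (ρ : α → ℝ) (u : α → ℤ → Ω → ℝ) (L : Set (List α))
    {p : ℕ} (y : ℤ → Ω → Fin p → ℝ) : Prop where
  rc : IsRC P ρ u L y
  squareSummable : IsSquareSummableFamily (outputFamily P ρ u y)
  rational : IsRationalFamily (outputFamily P ρ u y)

/-- `e` is (a version of) the forward innovation process of `y`:
`e(t) = y(t) - E_l[y(t) | {z_w(t)}]`. -/
def IsForwardInnovation (P : Measure Ω) (ρ : α → ℝ) (u : α → ℤ → Ω → ℝ) {p : ℕ}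
    (y e : ℤ → Ω → Fin p → ℝ) : Prop :=
  ∀ t, IsLinProj P (pastFamily ρ u y t) (y t) (fun ω i => y t ω i - e t ω i)

/-- `y` is a full rank process: its forward innovation process satisfies
`rank E[e(t) e(t)ᵀ u_σ(t)²] = p` for all letters. -/
def IsFullRank (P : Measure Ω) (ρ : α → ℝ) (u : α → ℤ → Ω → ℝ) {p : ℕ}
    (y : ℤ → Ω → Fin p → ℝ) : Prop :=
  ∀ e, IsForwardInnovation P ρ u y e → ∀ σ t, (inputCov P u e σ t).rank = p

/-! ### Generalized bilinear systems -/

/-- The matrices, the state process `x` and the noise process `v` of a generalized bilinear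
system. -/
structure GBS (Ω α : Type*) (n m p : ℕ) where
  A : α → Matrix (Fin n) (Fin n) ℝ
  K : α → Matrix (Fin n) (Fin m) ℝ
  C : Matrix (Fin p) (Fin n) ℝ
  D : Matrix (Fin p) (Fin m) ℝ
  x : ℤ → Ω → Fin n → ℝ
  v : ℤ → Ω → Fin m → ℝ

namespace GBS

variable {n m p : ℕ}

/-- `B` is a realization of `y`: the state equation holds and the output is `y`. -/
structure IsRealization [Fintype α] (B : GBS Ω α n m p) (P : Measure Ω) (u : α → ℤ → Ω → ℝ)
    (y : ℤ → Ω → Fin p → ℝ) : Prop where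
  state : ∀ t, ∀ᵐ ω ∂P,
    B.x (t + 1) ω = ∑ σ, u σ t ω • (B.A σ *ᵥ B.x t ω + B.K σ *ᵥ B.v t ω)
  output : ∀ t, ∀ᵐ ω ∂P, y t ω = B.C *ᵥ B.x t ω + B.D *ᵥ B.v t ω

/-- The standing assumption on generalized bilinear systems. -/
structure IsRegular [Fintype α] (B : GBS Ω α n m p) (P : Measure Ω) (ρ : α → ℝ)
    (u : α → ℤ → Ω → ℝ) (L : Set (List α)) : Prop where
  noise_rc : IsRC P ρ u L B.v
  noise_orthogonal : ∀ w w' : List α, w ≠ [] → w' ≠ [] → w ≠ w' → ∀ t,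
    crossCov P (zPast ρ u B.v w t) (zPast ρ u B.v w' t) = 0
  state_mem : ∀ t, InHilbertSpan P (pastFamily ρ u B.v t) (B.x t)
  stable : IsStableMatrix (∑ σ, ρ σ • ((B.A σ)ᵀ ⊗ₖ (B.A σ)ᵀ))
  admissible : ∀ σ₁ σ₂ : α, [σ₁, σ₂] ∉ L →
    B.A σ₂ * B.A σ₁ = 0 ∧ B.A σ₂ * B.K σ₁ * covT P ρ u B.v [σ₁] [σ₁] = 0

/-- `B` is in forward innovation form with respect to `y`. -/
structure IsForwardInnovationForm [Fintype α] (B : GBS Ω α n p p) (P : Measure Ω) (ρ : α → ℝ)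
    (u : α → ℤ → Ω → ℝ) (L : Set (List α)) (y : ℤ → Ω → Fin p → ℝ) : Prop where
  D_eq_one : B.D = 1
  innovation : IsForwardInnovation P ρ u y B.v
  regular : B.IsRegular P ρ u L

end GBS

/-! ### The construction from a representation of `Ψ_y` -/

variable {n p : ℕ}

/-- The stacked vector `Y_n(t)`, whose block with index `w`, `|w| ≤ n - 1`, is `z^f_w(t)`. -/
def futureVector (ρ : α → ℝ) (u : α → ℤ → Ω → ℝ) (y : ℤ → Ω → Fin p → ℝ) (n : ℕ) (t : ℤ) :
    Ω → ShortWord α n × Fin p → ℝ :=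
  fun ω a => zFuture ρ u y a.1.1 t ω a.2

/-- `x` is (a version of) the state process `x(t) = E_l[O⁻¹ Y_n(t) | {z_w(t)}]`. -/
def IsProjectedState [Finite α] (P : Measure Ω) (ρ : α → ℝ) (u : α → ℤ → Ω → ℝ)
    (y : ℤ → Ω → Fin p → ℝ) (Oinv : Matrix (Fin n) (ShortWord α n × Fin p) ℝ)
    (x : ℤ → Ω → Fin n → ℝ) : Prop :=
  ∀ t, IsLinProj P (pastFamily ρ u y t) (fun ω => Oinv *ᵥ futureVector ρ u y n t ω) (x t)

/-- The matrix `B_σ` with columns `B_{(1,σ)}, …, B_{(p,σ)}`. -/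
def SeriesRep.BMat (R : SeriesRep α (Fin p × α) p n) (σ : α) :
    Matrix (Fin n) (Fin p) ℝ :=
  Matrix.of fun i j => R.B (j, σ) i

/-- `ρ_σ T_{σ,σ} - C P_σ Cᵀ`. -/
def gainCov (P : Measure Ω) (ρ : α → ℝ) (u : α → ℤ → Ω → ℝ) (y : ℤ → Ω → Fin p → ℝ)
    (R : SeriesRep α (Fin p × α) p n) (Pst : α → Matrix (Fin n) (Fin n) ℝ) (σ : α) :
    Matrix (Fin p) (Fin p) ℝ :=
  ρ σ • covT P ρ u y [σ] [σ] - R.C * Pst σ * R.Cᵀ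

/-- `√ρ_σ B_σ - (1/√ρ_σ) A_σ P_σ Cᵀ`. -/
def gainRhs (ρ : α → ℝ) (R : SeriesRep α (Fin p × α) p n)
    (Pst : α → Matrix (Fin n) (Fin n) ℝ) (σ : α) : Matrix (Fin n) (Fin p) ℝ :=
  √(ρ σ) • R.BMat σ - (1 / √(ρ σ)) • (R.A σ * Pst σ * R.Cᵀ)

/-- The system `x(t+1) = ∑_σ ((1/√ρ_σ) A_σ x(t) + K_σ e(t)) u_σ(t)`, `y(t) = C x(t) + e(t)`. -/
def innovationGBS (ρ : α → ℝ) (R : SeriesRep α (Fin p × α) p n)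
    (K : α → Matrix (Fin n) (Fin p) ℝ) (x : ℤ → Ω → Fin n → ℝ) (e : ℤ → Ω → Fin p → ℝ) :
    GBS Ω α n p p where
  A := fun σ => (1 / √(ρ σ)) • R.A σ
  K := K
  C := R.C
  D := 1
  x := x
  v := e

end StochReal

end

open StochReal

namespace StochReal

/-! ### Minimal representations: reachability, observability, square summability, stability. -/

section Algebra

open Filter Topology

variable {α J : Type*} {p n : ℕ}

/-! Everything takes place in `L²`. Multiplication by `u_σ(t)/√ρ_σ` is an unbounded operator with
closed graph. On the past space at time `t` (the closed span of the `z_w(t)`, `w ≠ []`), however,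
the RC property makes it an everywhere defined contraction, the σ-shift: the Gram matrix of the
`z_{wσ}(t+1)` has the same rows as that of the `z_w(t)` when `wσ ∈ L`, and `z_{wσ} = 0` otherwise
(`exists_contraction`, `PastProducts.exists_shift`). Shifts by different letters have orthogonal
ranges. On vectors whose words end in `τ`, the σ-shift is isometric if `τσ ∈ L` and zero if not.

The covariance of `Y_n(t)` with `z_{σv}(t)` is `O_R A_v B_σ`, so `x(t)` is the element of the past
space whose covariances with the `z_{σv}(t)` are `A_v B_σ`. It exists even if `Y_n(t)` is not square
integrable, since adjoints of the shifts produce it (`exists_inner_append`). As `C A_v B_σ` is the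
covariance of `y(t)` with `z_{σv}(t)`, uniqueness of projections gives `e = y - C x`.

The state equation compares two elements of the past space at time `t+1` through their covariances
with every `z_{wσ}(t+1)`. For `w ≠ []` they agree because `A_{wσ} = A_σ A_w`; for `w = []` the
agreement is exactly the gain equation (`IsState.state_eq`). That equation is solvable because its
right-hand side is, up to scaling, the covariance of `x(t+1)` with `e(t) u_σ(t)`, and so it kills
the kernel of the covariance of `e(t) u_σ(t)` (`gain_ker`).

For regularity, the products of `e` with inputs are iterated shifts, so they inherit the RC property
and are mutually orthogonal for different words. Minimality transfers square summability from the
series to the entries of `A_w`. This gives the eigenvalue bound, because the powers of `∑ A_σᵀ ⊗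
A_σᵀ` are sums over the words of a given length. It also shows that `x(t)` lies in the past of the
noise: the residual of its projection there, pushed back `k` steps, is bounded by a sum over words
of length `k` that tends to zero (`IsNoise.state_mem`). -/

theorem wordProd_append (A : α → Matrix (Fin n) (Fin n) ℝ) (v w : List α) :
    wordProd A (v ++ w) = wordProd A w * wordProd A v := by
  induction v with
  | nil => simp [wordProd]
  | cons σ v ih => simp [wordProd, ih, Matrix.mul_assoc]

theorem wordProd_snoc (A : α → Matrix (Fin n) (Fin n) ℝ) (v : List α) (σ : α) :
    wordProd A (v ++ [σ]) = A σ * wordProd A v := by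
  simp [wordProd_append, wordProd]

/-- A matrix whose kernel contains the kernel of `G` is a left multiple of `G`. -/
theorem exists_mul_eq_of_ker_le {a b c : Type*} [Fintype a] [Fintype b] [Fintype c]
    (G : Matrix b a ℝ) (H : Matrix c a ℝ) (h : ∀ q, G *ᵥ q = 0 → H *ᵥ q = 0) :
    ∃ K : Matrix c b ℝ, K * G = H := by
  classical
  have hk : LinearMap.ker G.mulVecLin ≤ LinearMap.ker H.mulVecLin := fun q hq => by
    simpa using h q (by simpa using hq)
  -- `H` factors through the quotient by `ker G`, so `G q ↦ H q` is a well-defined map on the range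
  -- of `G`; its extension beyond the range is arbitrary.
  obtain ⟨φ, hφ⟩ := LinearMap.exists_extend
    (((LinearMap.ker G.mulVecLin).liftQ H.mulVecLin hk).comp
      G.mulVecLin.quotKerEquivRange.symm.toLinearMap)
  refine ⟨LinearMap.toMatrix' φ, ?_⟩
  apply Matrix.toLin'.injective
  rw [Matrix.toLin'_mul, Matrix.toLin'_toMatrix']
  ext1 i
  ext1
  have := LinearMap.congr_fun hφ ⟨G.mulVecLin (Pi.single i 1), _, rfl⟩
  simp only [LinearMap.comp_apply, Submodule.subtype_apply, LinearEquiv.coe_coe] at this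
  simp only [LinearMap.comp_apply, LinearMap.coe_single, Matrix.toLin'_apply]
  rw [← Matrix.mulVecLin_apply, this]
  have h2 : G.mulVecLin.quotKerEquivRange.symm ⟨G.mulVecLin (Pi.single i 1), _, rfl⟩ =
      (LinearMap.ker G.mulVecLin).mkQ (Pi.single i 1) :=
    LinearMap.quotKerEquivRange_symm_apply_image _ _ _
  rw [h2]
  simp

theorem exists_mul_eq_one_of_injective {a b : Type*} [Fintype a] [Fintype b] [DecidableEq a]
    (G : Matrix b a ℝ) (h : ∀ q, G *ᵥ q = 0 → q = 0) :
    ∃ K : Matrix a b ℝ, K * G = 1 :=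
  exists_mul_eq_of_ker_le G 1 (by simpa using h)

namespace SeriesRep

/-- The compression of a representation along a pair of matrices. -/
def compress {m : ℕ} (R : SeriesRep α J p n) (I : Matrix (Fin n) (Fin m) ℝ)
    (Q : Matrix (Fin m) (Fin n) ℝ) : SeriesRep α J p m where
  A := fun σ => Q * R.A σ * I
  B := fun j => Q *ᵥ R.B j
  C := R.C * I

/-- The reachable subspace. -/
def reachable (R : SeriesRep α J p n) : Submodule ℝ (Fin n → ℝ) :=
  Submodule.span ℝ {v | ∃ w j, wordProd R.A w *ᵥ R.B j = v}

/-- The vectors which are not detected by words of length less than `k`. -/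
def unobservableBelow (R : SeriesRep α J p n) (k : ℕ) : Submodule ℝ (Fin n → ℝ) :=
  ⨅ w : {w : List α // w.length < k}, LinearMap.ker (R.C * wordProd R.A w.1).mulVecLin

/-- The unobservable subspace. -/
def unobservable (R : SeriesRep α J p n) : Submodule ℝ (Fin n → ℝ) :=
  ⨅ w : List α, LinearMap.ker (R.C * wordProd R.A w).mulVecLin

theorem mem_unobservableBelow {R : SeriesRep α J p n} {k : ℕ} {v : Fin n → ℝ} :
    v ∈ R.unobservableBelow k ↔
      ∀ w : List α, w.length < k → (R.C * wordProd R.A w) *ᵥ v = 0 := by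
  simp [unobservableBelow]

theorem mem_unobservable {R : SeriesRep α J p n} {v : Fin n → ℝ} :
    v ∈ R.unobservable ↔ ∀ w : List α, (R.C * wordProd R.A w) *ᵥ v = 0 := by
  simp [unobservable]

/-- The reachable subspace contains all `B_j` and is invariant under all `A_σ`, so restricting to it
would give a smaller representation if it were proper. -/
theorem reachable_eq_top {R : SeriesRep α J p n} {Ψ : J → List α → Fin p → ℝ}
    (h : R.IsMinimal Ψ) : R.reachable = ⊤ := by
  by_contra hne
  have hlt : Module.finrank ℝ R.reachable < n := by
    simpa using Submodule.finrank_lt hne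
  obtain ⟨φ, hφ⟩ := LinearMap.exists_leftInverse_of_injective R.reachable.subtype
    R.reachable.ker_subtype
  let e := (Module.finBasis ℝ R.reachable).equivFun
  let I := LinearMap.toMatrix' (R.reachable.subtype.comp e.symm.toLinearMap)
  let Q := LinearMap.toMatrix' (e.toLinearMap.comp φ)
  have hIQ : ∀ v ∈ R.reachable, I *ᵥ (Q *ᵥ v) = v := by
    intro v hv
    have h1 : φ v = ⟨v, hv⟩ := LinearMap.congr_fun hφ ⟨v, hv⟩
    rw [← Matrix.toLin'_apply, ← Matrix.toLin'_apply]
    simp [I, Q, h1]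
  have key : ∀ (w : List α) j, I *ᵥ (wordProd (R.compress I Q).A w *ᵥ (R.compress I Q).B j) =
      wordProd R.A w *ᵥ R.B j := by
    intro w j
    induction w using List.reverseRecOn with
    | nil =>
      simp only [wordProd, Matrix.one_mulVec]
      exact hIQ _ (Submodule.subset_span ⟨[], j, by simp [wordProd]⟩)
    | append_singleton w σ ih =>
      have h1 := hIQ _ (Submodule.subset_span ⟨w ++ [σ], j, rfl⟩)
      rw [wordProd_snoc, ← Matrix.mulVec_mulVec] at h1
      rw [wordProd_snoc, wordProd_snoc, ← Matrix.mulVec_mulVec, ← Matrix.mulVec_mulVec]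
      conv_lhs => enter [2, 1]; simp only [compress]
      rw [← Matrix.mulVec_mulVec, ih, ← Matrix.mulVec_mulVec, h1]
  refine absurd (h.2 _ (R.compress I Q) fun j w => ?_) (not_le.2 hlt)
  rw [h.1 j w, ← Matrix.mulVec_mulVec, ← key, ← Matrix.mulVec_mulVec]
  conv_rhs => enter [1]; simp only [compress]
  rw [Matrix.mulVec_mulVec]

/-- The representation descends to the quotient by the unobservable subspace, which would be smaller
if that subspace were nonzero. -/
theorem unobservable_eq_bot {R : SeriesRep α J p n} {Ψ : J → List α → Fin p → ℝ}
    (h : R.IsMinimal Ψ) : R.unobservable = ⊥ := by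
  by_contra hne
  have hlt : Module.finrank ℝ ((Fin n → ℝ) ⧸ R.unobservable) < n := by
    have h1 := R.unobservable.finrank_quotient_add_finrank
    have h2 : 0 < Module.finrank ℝ R.unobservable := by
      have := Submodule.nontrivial_iff_ne_bot.2 hne
      exact Module.finrank_pos
    simp only [Module.finrank_fin_fun] at h1
    omega
  obtain ⟨φ, hφ⟩ := LinearMap.exists_rightInverse_of_surjective R.unobservable.mkQ
    R.unobservable.range_mkQ
  let e := (Module.finBasis ℝ ((Fin n → ℝ) ⧸ R.unobservable)).equivFun
  let I := LinearMap.toMatrix' (φ.comp e.symm.toLinearMap)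
  let Q := LinearMap.toMatrix' (e.toLinearMap.comp R.unobservable.mkQ)
  -- `I` comes from an arbitrary linear section of the quotient map, so `I Q` is the identity only
  -- up to unobservable vectors, which no `C A_w` detects.
  have hIQ : ∀ v, I *ᵥ (Q *ᵥ v) - v ∈ R.unobservable := by
    intro v
    have h1 := LinearMap.congr_fun hφ (R.unobservable.mkQ v)
    refine (Submodule.Quotient.mk_eq_zero _).1 ?_
    rw [Submodule.Quotient.mk_sub, sub_eq_zero, ← Matrix.toLin'_apply, ← Matrix.toLin'_apply]
    simpa [I, Q] using h1
  have hIQ' : ∀ (w : List α) v, (R.C * wordProd R.A w) *ᵥ (I *ᵥ (Q *ᵥ v)) =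
      (R.C * wordProd R.A w) *ᵥ v := fun w v => by
    have := mem_unobservable.1 (hIQ v) w
    rwa [Matrix.mulVec_sub, sub_eq_zero] at this
  have key : ∀ (w : List α) v,
      ((R.compress I Q).C * wordProd (R.compress I Q).A w) *ᵥ (Q *ᵥ v) =
      (R.C * wordProd R.A w) *ᵥ v := by
    intro w
    induction w with
    | nil =>
      intro v
      have := hIQ' [] v
      simp only [wordProd, Matrix.mul_one] at this ⊢
      conv_lhs => enter [1]; simp only [compress]
      rw [← Matrix.mulVec_mulVec, this]
    | cons σ w ih =>
      intro v
      have h1 := ih (R.A σ *ᵥ (I *ᵥ (Q *ᵥ v)))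
      have h2 : (R.compress I Q).A σ *ᵥ (Q *ᵥ v) = Q *ᵥ (R.A σ *ᵥ (I *ᵥ (Q *ᵥ v))) := by
        simp only [compress, Matrix.mulVec_mulVec, Matrix.mul_assoc]
      rw [wordProd, ← Matrix.mul_assoc, ← Matrix.mulVec_mulVec, h2, h1, Matrix.mulVec_mulVec,
        Matrix.mul_assoc]
      exact hIQ' (σ :: w) v
  refine absurd (h.2 _ (R.compress I Q) fun j w => ?_) (not_le.2 hlt)
  rw [h.1 j w, ← key]
  rfl

theorem unobservableBelow_succ_le (R : SeriesRep α J p n) (k : ℕ) :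
    R.unobservableBelow (k + 1) ≤ R.unobservableBelow k := fun _ hv =>
  mem_unobservableBelow.2 fun w hw => mem_unobservableBelow.1 hv w (by omega)

/-- Undetectability of `v` by nonempty words of length at most `k` is undetectability of every `A_σ
v` by words of length below `k`; a chain that stalls once therefore stalls for good. -/
theorem unobservableBelow_stable (R : SeriesRep α J p n) {k : ℕ}
    (h : R.unobservableBelow k = R.unobservableBelow (k + 1)) :
    R.unobservableBelow (k + 1) = R.unobservableBelow (k + 2) := by
  refine le_antisymm (fun v hv => mem_unobservableBelow.2 fun w hw => ?_)
    (R.unobservableBelow_succ_le _)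
  cases w with
  | nil => exact mem_unobservableBelow.1 hv [] (by simp)
  | cons σ w =>
    have h1 : R.A σ *ᵥ v ∈ R.unobservableBelow k := mem_unobservableBelow.2 fun w' hw' => by
      have := mem_unobservableBelow.1 hv (σ :: w') (by simpa using hw')
      rwa [wordProd, ← Matrix.mul_assoc, ← Matrix.mulVec_mulVec] at this
    rw [h] at h1
    have := mem_unobservableBelow.1 h1 w (by simpa using hw)
    rwa [wordProd, ← Matrix.mul_assoc, ← Matrix.mulVec_mulVec]

theorem unobservableBelow_eq_succ (R : SeriesRep α J p n) :
    R.unobservableBelow n = R.unobservableBelow (n + 1) := by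
  -- Until the chain stalls, each step loses at least one of the `n` dimensions.
  have key : ∀ k, R.unobservableBelow k = R.unobservableBelow (k + 1) ∨
      Module.finrank ℝ (R.unobservableBelow k) + k ≤ n := by
    intro k
    induction k with
    | zero => right; simpa using Submodule.finrank_le (R.unobservableBelow 0)
    | succ k ih =>
      rcases ih with h | h
      · exact Or.inl (R.unobservableBelow_stable h)
      · by_cases he : R.unobservableBelow k = R.unobservableBelow (k + 1)
        · exact Or.inl (R.unobservableBelow_stable he)
        · right
          have := Submodule.finrank_lt_finrank_of_lt
            (lt_of_le_of_ne (R.unobservableBelow_succ_le k) (Ne.symm he))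
          omega
  rcases key n with h | h
  · exact h
  · have h0 : R.unobservableBelow n = ⊥ := Submodule.finrank_eq_zero.1 (by omega)
    have := R.unobservableBelow_succ_le n
    rw [h0, le_bot_iff] at this
    rw [h0, this]

theorem unobservableBelow_eq_unobservable (R : SeriesRep α J p n) :
    R.unobservableBelow n = R.unobservable := by
  have h1 : ∀ k, R.unobservableBelow (n + k) = R.unobservableBelow (n + k + 1) := by
    intro k
    induction k with
    | zero => exact R.unobservableBelow_eq_succ
    | succ k ih => exact R.unobservableBelow_stable ih
  have h2 : ∀ k, R.unobservableBelow n = R.unobservableBelow (n + k) := by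
    intro k
    induction k with
    | zero => rfl
    | succ k ih => rw [ih, h1]; rfl
  ext v
  rw [mem_unobservable]
  refine ⟨fun h w => ?_, fun h => mem_unobservableBelow.2 fun w _ => h w⟩
  rw [h2 (w.length + 1)] at h
  exact mem_unobservableBelow.1 h w (by omega)

theorem obsMatrix_mulVec [Finite α] (R : SeriesRep α J p n) (v : Fin n → ℝ)
    (a : ShortWord α n × Fin p) :
    (R.obsMatrix *ᵥ v) a = ((R.C * wordProd R.A a.1.1) *ᵥ v) a.2 := rfl

theorem exists_obsMatrix_leftInverse [Finite α] {R : SeriesRep α J p n}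
    {Ψ : J → List α → Fin p → ℝ} (h : R.IsMinimal Ψ) :
    ∃ Oinv : Matrix (Fin n) (ShortWord α n × Fin p) ℝ, Oinv * R.obsMatrix = 1 := by
  refine exists_mul_eq_one_of_injective _ fun q hq => ?_
  have : q ∈ R.unobservableBelow n := mem_unobservableBelow.2 fun w hw => by
    ext i
    exact congrFun hq (⟨w, hw⟩, i)
  rw [unobservableBelow_eq_unobservable, unobservable_eq_bot h] at this
  simpa using this

theorem exists_isMinimal {Ψ : J → List α → Fin p → ℝ} (h : IsRationalFamily Ψ) :
    ∃ (n : ℕ) (R : SeriesRep α J p n), R.IsMinimal Ψ := by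
  classical
  have h' : ∃ n, ∃ R : SeriesRep α J p n, R.Represents Ψ := h
  obtain ⟨R, hR⟩ := Nat.find_spec h'
  exact ⟨_, R, hR, fun m R' hR' => Nat.find_min' h' ⟨R', hR'⟩⟩

/-- A matrix annihilating all reachable vectors vanishes. -/
theorem mulVec_eq_zero_of_reach {R : SeriesRep α J p n} {Ψ : J → List α → Fin p → ℝ}
    (h : R.IsMinimal Ψ) {m : ℕ} {M : Matrix (Fin m) (Fin n) ℝ}
    (hM : ∀ w j, M *ᵥ (wordProd R.A w *ᵥ R.B j) = 0) : M = 0 := by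
  have h1 : R.reachable ≤ LinearMap.ker M.mulVecLin :=
    Submodule.span_le.2 (by rintro _ ⟨w, j, rfl⟩; exact hM w j)
  rw [reachable_eq_top h] at h1
  refine Matrix.ext fun i j => ?_
  have := congrFun (LinearMap.mem_ker.1 (h1 (Submodule.mem_top (x := Pi.single j 1)))) i
  simpa using this

end SeriesRep

theorem summable_sq_add {ι : Type*} {f g : ι → ℝ} (hf : Summable fun w => f w ^ 2)
    (hg : Summable fun w => g w ^ 2) : Summable fun w => (f w + g w) ^ 2 := by
  refine Summable.of_nonneg_of_le (fun _ => sq_nonneg _) (fun w => ?_)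
    ((hf.mul_left 2).add (hg.mul_left 2))
  nlinarith [sq_nonneg (f w - g w)]

theorem summable_sq_sum {ι κ : Type*} (s : Finset κ) {f : κ → ι → ℝ}
    (hf : ∀ a ∈ s, Summable fun w => f a w ^ 2) : Summable fun w => (∑ a ∈ s, f a w) ^ 2 := by
  classical
  induction s using Finset.induction_on with
  | empty => simp
  | insert a s ha ih =>
    simp only [Finset.sum_insert ha]
    exact summable_sq_add (hf a (by simp)) (ih fun b hb => hf b (by simp [hb]))

theorem summable_sq_const_mul {ι : Type*} (c : ℝ) {f : ι → ℝ} (hf : Summable fun w => f w ^ 2) :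
    Summable fun w => (c * f w) ^ 2 := by
  simpa only [mul_pow] using hf.mul_left (c ^ 2)

/-- For a reachable vector `A_v B_l`, the left inverse of the observability matrix expresses `A_w
A_v B_l` through finitely many coefficients `Ψ_l(v w a)`. Each is square summable in `w` because `w
↦ v w a` is injective. Reachable vectors span the space, so the unit vectors are covered. -/
theorem SeriesRep.summable_wordProd_sq [Finite α] {R : SeriesRep α J p n}
    {Ψ : J → List α → Fin p → ℝ} (h : R.IsMinimal Ψ) (hs : IsSquareSummableFamily Ψ)
    (i j : Fin n) : Summable fun w : List α => wordProd R.A w i j ^ 2 := by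
  obtain ⟨O, hO⟩ := exists_obsMatrix_leftInverse h
  have hs' : ∀ l i, Summable fun w : List α => Ψ l w i ^ 2 := fun l i =>
    (hs l).of_nonneg_of_le (fun _ => sq_nonneg _) fun w =>
      Finset.single_le_sum (f := fun i => Ψ l w i ^ 2) (fun _ _ => sq_nonneg _)
        (Finset.mem_univ i)
  have key : ∀ b ∈ R.reachable, ∀ i, Summable fun w : List α => (wordProd R.A w *ᵥ b) i ^ 2 := by
    intro b hb
    induction hb using Submodule.span_induction with
    | mem b hb =>
      obtain ⟨v, l, rfl⟩ := hb
      intro i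
      have h1 : ∀ w, (wordProd R.A w *ᵥ (wordProd R.A v *ᵥ R.B l)) i =
          ∑ a, O i a * Ψ l (v ++ w ++ a.1.1) a.2 := by
        intro w
        have h2 : wordProd R.A w *ᵥ (wordProd R.A v *ᵥ R.B l) =
          O *ᵥ (R.obsMatrix *ᵥ (wordProd R.A w *ᵥ (wordProd R.A v *ᵥ R.B l))) := by
          rw [Matrix.mulVec_mulVec _ O, hO, Matrix.one_mulVec]
        rw [h2]
        refine Finset.sum_congr rfl fun a _ => ?_
        rw [obsMatrix_mulVec, h.1, wordProd_append, wordProd_append]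
        simp only [Matrix.mulVec_mulVec, Matrix.mul_assoc]
      simp only [h1]
      refine summable_sq_sum _ fun a _ => summable_sq_const_mul _ ?_
      exact (hs' l a.2).comp_injective (i := fun w => v ++ w ++ a.1.1) fun w w' hw => by
        simpa using hw
    | zero => simp
    | add x y _ _ hx hy =>
      intro i
      simpa only [Matrix.mulVec_add, Pi.add_apply] using summable_sq_add (hx i) (hy i)
    | smul c x _ hx =>
      intro i
      simpa only [Matrix.mulVec_smul, Pi.smul_apply, smul_eq_mul] using
        summable_sq_const_mul c (hx i)
  have := key (Pi.single j 1) (by rw [reachable_eq_top h]; trivial) i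
  simpa using this

/-- The map `(σ, w) ↦ σw`. -/
def consEmbedding (α : Type*) : α × List α ↪ List α where
  toFun q := q.1 :: q.2
  inj' q q' h := by simpa [Prod.ext_iff] using h

theorem consEmbedding_apply (q : α × List α) : consEmbedding α q = q.1 :: q.2 := rfl

/-- The words of length `k`. -/
def wordsOfLength (α : Type*) [Fintype α] : ℕ → Finset (List α)
  | 0 => {[]}
  | k + 1 => ((Finset.univ : Finset α) ×ˢ wordsOfLength α k).map (consEmbedding α)

theorem sum_wordsOfLength_zero [Fintype α] {M : Type*} [AddCommMonoid M] (f : List α → M) :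
    ∑ w ∈ wordsOfLength α 0, f w = f [] := by
  simp [wordsOfLength]

theorem sum_wordsOfLength_succ [Fintype α] {M : Type*} [AddCommMonoid M] (k : ℕ)
    (f : List α → M) :
    ∑ w ∈ wordsOfLength α (k + 1), f w = ∑ σ, ∑ w ∈ wordsOfLength α k, f (σ :: w) := by
  simp [wordsOfLength, Finset.sum_product, consEmbedding_apply]

theorem length_of_mem_wordsOfLength [Fintype α] {k : ℕ} {w : List α}
    (h : w ∈ wordsOfLength α k) : w.length = k := by
  induction k generalizing w with
  | zero => simp_all [wordsOfLength]
  | succ k ih =>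
    simp only [wordsOfLength, Finset.mem_map, Finset.mem_product, Finset.mem_univ, true_and] at h
    obtain ⟨q, hq, rfl⟩ := h
    simp [ih hq, consEmbedding_apply]

/-- Words of length `k` eventually avoid any given finite set, so the Cauchy criterion applies. -/
theorem tendsto_sum_wordsOfLength [Fintype α] {f : List α → ℝ} (hf : Summable f) :
    Tendsto (fun k => ∑ w ∈ wordsOfLength α k, f w) atTop (𝓝 0) := by
  rw [Metric.tendsto_atTop]
  intro ε hε
  obtain ⟨s, hs⟩ := summable_iff_vanishing_norm.1 hf ε hε
  refine ⟨s.sup List.length + 1, fun k hk => ?_⟩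
  rw [dist_zero_right]
  refine hs _ (Finset.disjoint_left.2 fun w hw hw' => ?_)
  have := Finset.le_sup (f := List.length) hw'
  rw [length_of_mem_wordsOfLength hw] at this
  omega

theorem kronecker_sum_pow [Fintype α] (A : α → Matrix (Fin n) (Fin n) ℝ) (k : ℕ) :
    (∑ σ, (A σ)ᵀ ⊗ₖ (A σ)ᵀ) ^ k =
      ∑ w ∈ wordsOfLength α k, (wordProd A w)ᵀ ⊗ₖ (wordProd A w)ᵀ := by
  induction k with
  | zero => simp [sum_wordsOfLength_zero, wordProd]
  | succ k ih =>
    rw [pow_succ', ih, sum_wordsOfLength_succ, Finset.sum_mul]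
    refine Finset.sum_congr rfl fun σ _ => ?_
    rw [Finset.mul_sum]
    refine Finset.sum_congr rfl fun w _ => ?_
    rw [← Matrix.mul_kronecker_mul, ← Matrix.transpose_mul]
    rfl

section Stability

attribute [local instance] Matrix.linftyOpNormedRing Matrix.linftyOpNormedAlgebra

/-- If `μ` is an eigenvalue, then `μ ^ k` is in the spectrum of the `k`-th power, so `‖μ‖ ^ k` is
bounded by a constant times the norm of that power. The submultiplicative norm is only an auxiliary
choice. -/
theorem isStableMatrix_of_tendsto_pow {ι : Type*} [Fintype ι] [DecidableEq ι]
    (M : Matrix ι ι ℝ) (h : Tendsto (fun k => M ^ k) atTop (𝓝 0)) : IsStableMatrix M := by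
  intro μ hμ
  have h1 : Tendsto (fun k => (M.map (algebraMap ℝ ℂ)) ^ k) atTop (𝓝 0) := by
    have h2 : Tendsto (fun k => (M ^ k).map (algebraMap ℝ ℂ)) atTop
        (𝓝 ((0 : Matrix ι ι ℝ).map (algebraMap ℝ ℂ))) :=
      ((continuous_id.matrix_map Complex.continuous_ofReal).tendsto _).comp h
    rw [Matrix.map_zero _ (map_zero _)] at h2
    refine h2.congr fun k => ?_
    exact map_pow (algebraMap ℝ ℂ).mapMatrix M k
  have h3 : Tendsto (fun k => ‖μ‖ ^ k) atTop (𝓝 0) := by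
    have h4 := h1.norm.mul_const ‖(1 : Matrix ι ι ℂ)‖
    rw [norm_zero, zero_mul] at h4
    refine squeeze_zero (fun k => by positivity) (fun k => ?_) h4
    rw [← norm_pow]
    exact spectrum.norm_le_norm_mul_of_mem (spectrum.pow_mem_pow _ k hμ)
  by_contra hge
  rw [not_lt] at hge
  exact absurd (ge_of_tendsto' h3 fun k => one_le_pow₀ hge) (by norm_num)

end Stability

theorem isStableMatrix_kronecker_sum [Fintype α] (A : α → Matrix (Fin n) (Fin n) ℝ)
    (hA : ∀ i j, Summable fun w : List α => wordProd A w i j ^ 2) :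
    IsStableMatrix (∑ σ, (A σ)ᵀ ⊗ₖ (A σ)ᵀ) := by
  refine isStableMatrix_of_tendsto_pow _ ?_
  refine tendsto_pi_nhds.2 fun ⟨a, b⟩ => tendsto_pi_nhds.2 fun ⟨c, d⟩ => ?_
  simp only [kronecker_sum_pow, Matrix.sum_apply, Matrix.kroneckerMap_apply,
    Matrix.transpose_apply, Matrix.zero_apply]
  refine tendsto_sum_wordsOfLength ?_
  refine Summable.of_norm_bounded ((hA c a).add (hA d b)) fun w => ?_
  rw [Real.norm_eq_abs, abs_le]
  constructor <;> nlinarith [sq_nonneg (wordProd A w c a + wordProd A w d b),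
    sq_nonneg (wordProd A w c a - wordProd A w d b), sq_nonneg (wordProd A w c a),
    sq_nonneg (wordProd A w d b)]

end Algebra

/-! ### Closed spans, contractions determined by Gram matrices, and their adjoints. -/

section HilbertSpace

variable {E : Type*} [NormedAddCommGroup E] [InnerProductSpace ℝ E] {ι : Type*}

/-- The closed linear span of a family of vectors. -/
def cspan (a : ι → E) : Submodule ℝ E :=
  (Submodule.span ℝ (Set.range a)).topologicalClosure

theorem mem_cspan (a : ι → E) (i : ι) : a i ∈ cspan a :=
  Submodule.le_topologicalClosure _ (Submodule.subset_span ⟨i, rfl⟩)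

theorem isClosed_cspan (a : ι → E) : IsClosed (cspan a : Set E) :=
  Submodule.isClosed_topologicalClosure _

theorem cspan_le {a : ι → E} {S : Submodule ℝ E} (hS : IsClosed (S : Set E))
    (h : ∀ i, a i ∈ S) : cspan a ≤ S :=
  Submodule.topologicalClosure_minimal _
    (Submodule.span_le.2 (by rintro _ ⟨i, rfl⟩; exact h i)) hS

theorem inner_eq_zero_of_mem_cspan {a : ι → E} {f h : E} (hf : ∀ i, inner ℝ (a i) f = 0)
    (hh : h ∈ cspan a) : inner ℝ h f = 0 := by
  have := cspan_le (S := (ℝ ∙ f)ᗮ) (Submodule.isClosed_orthogonal _)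
    (fun i => Submodule.mem_orthogonal_singleton_iff_inner_left.2 (hf i)) hh
  exact Submodule.mem_orthogonal_singleton_iff_inner_left.1 this

theorem eq_of_mem_cspan_of_inner_eq {a : ι → E} {h h' : E} (hh : h ∈ cspan a)
    (hh' : h' ∈ cspan a) (hi : ∀ i, inner ℝ h (a i) = inner ℝ h' (a i)) : h = h' := by
  have := inner_eq_zero_of_mem_cspan (f := h - h') (h := h - h') (a := a)
    (fun i => by rw [real_inner_comm, inner_sub_left, hi, sub_self]) (Submodule.sub_mem _ hh hh')
  exact sub_eq_zero.1 (inner_self_eq_zero.1 this)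

theorem exists_mem_cspan_inner_eq [CompleteSpace E] (a : ι → E) (f : E) :
    ∃ h ∈ cspan a, ∀ i, inner ℝ h (a i) = inner ℝ f (a i) := by
  have : CompleteSpace (cspan a) := (isClosed_cspan a).completeSpace_coe
  refine ⟨(cspan a).starProjection f, Submodule.starProjection_apply_mem _ _, fun i => ?_⟩
  have := Submodule.starProjection_inner_eq_zero (K := cspan a) f (a i) (mem_cspan a i)
  rw [inner_sub_left] at this
  linarith

theorem inner_finsupp_linearCombination (a b : ι → E) (c d : ι →₀ ℝ) :
    inner ℝ (Finsupp.linearCombination ℝ a c) (Finsupp.linearCombination ℝ b d) =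
      c.sum fun i r => d.sum fun j s => r * (s * inner ℝ (a i) (b j)) := by
  simp only [Finsupp.linearCombination_apply, Finsupp.sum, sum_inner, inner_sum,
    real_inner_smul_left, real_inner_smul_right]
  rw [Finset.sum_comm]
  exact Finset.sum_congr rfl fun i _ => Finset.sum_congr rfl fun j _ => by ring

/-- If the Gram matrix of `b` agrees with that of `a` in the rows selected by `Q` and `b` vanishes
elsewhere, then `a i ↦ b i` extends to a contraction. -/
theorem norm_linearCombination_le {a b : ι → E} (Q : ι → Prop)
    (hQ : ∀ i, Q i → ∀ j, inner ℝ (b i) (b j) = inner ℝ (a i) (a j))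
    (h0 : ∀ i, ¬ Q i → b i = 0) (c : ι →₀ ℝ) :
    ‖Finsupp.linearCombination ℝ b c‖ ≤ ‖Finsupp.linearCombination ℝ a c‖ := by
  classical
  -- With `a'` the truncation of `a` to `Q`, the Gram hypotheses give `‖b c‖² = ⟪a' c, a c⟫` and `‖b
  -- c‖ = ‖a' c‖`; Cauchy–Schwarz then yields the bound.
  set a' : ι → E := fun i => if Q i then a i else 0 with ha'
  have h1 : inner ℝ (Finsupp.linearCombination ℝ b c) (Finsupp.linearCombination ℝ b c) =
      inner ℝ (Finsupp.linearCombination ℝ a' c) (Finsupp.linearCombination ℝ a c) := by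
    rw [inner_finsupp_linearCombination, inner_finsupp_linearCombination]
    refine Finsupp.sum_congr fun i _ => Finsupp.sum_congr fun j _ => ?_
    by_cases hi : Q i
    · simp [ha', hi, hQ i hi]
    · simp [ha', hi, h0 i hi]
  have h2 : inner ℝ (Finsupp.linearCombination ℝ b c) (Finsupp.linearCombination ℝ b c) =
      inner ℝ (Finsupp.linearCombination ℝ a' c) (Finsupp.linearCombination ℝ a' c) := by
    rw [inner_finsupp_linearCombination, inner_finsupp_linearCombination]
    refine Finsupp.sum_congr fun i _ => Finsupp.sum_congr fun j _ => ?_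
    by_cases hi : Q i
    · by_cases hj : Q j
      · simp [ha', hi, hj, hQ i hi]
      · simp [ha', hj, h0 j hj]
    · simp [ha', hi, h0 i hi]
  have h3 : ‖Finsupp.linearCombination ℝ b c‖ = ‖Finsupp.linearCombination ℝ a' c‖ := by
    rw [real_inner_self_eq_norm_sq, real_inner_self_eq_norm_sq] at h2
    exact (sq_eq_sq₀ (norm_nonneg _) (norm_nonneg _)).1 h2
  have h4 := real_inner_le_norm (Finsupp.linearCombination ℝ a' c)
    (Finsupp.linearCombination ℝ a c)
  rw [← h1, real_inner_self_eq_norm_sq, ← h3, sq] at h4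
  rcases (norm_nonneg (Finsupp.linearCombination ℝ b c)).eq_or_lt with h | h
  · rw [← h]; exact norm_nonneg _
  · exact le_of_mul_le_mul_left h4 h

/-- The norm bound on finite combinations extends by density. The last clause is an induction
principle: a closed linear relation containing all pairs `(a i, b i)` contains the graph of `T`. It
is applied to multiplication graphs, products of closed spans and inner product identities. -/
theorem exists_contraction [CompleteSpace E] {a b : ι → E} (Q : ι → Prop)
    (hQ : ∀ i, Q i → ∀ j, inner ℝ (b i) (b j) = inner ℝ (a i) (a j))
    (h0 : ∀ i, ¬ Q i → b i = 0) :
    ∃ T : cspan a →L[ℝ] E, (∀ i, T ⟨a i, mem_cspan a i⟩ = b i) ∧ (∀ h, ‖T h‖ ≤ ‖h‖) ∧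
      ∀ S : Submodule ℝ (E × E), IsClosed (S : Set (E × E)) → (∀ i, (a i, b i) ∈ S) →
        ∀ h : cspan a, ((h : E), T h) ∈ S := by
  have hmem : ∀ c, Finsupp.linearCombination ℝ a c ∈ cspan a := fun c =>
    Submodule.le_topologicalClosure _ (by
      rw [← Finsupp.range_linearCombination]; exact ⟨c, rfl⟩)
  let e : (ι →₀ ℝ) →ₗ[ℝ] cspan a := (Finsupp.linearCombination ℝ a).codRestrict _ hmem
  have hd : DenseRange e := by
    intro h
    rw [closure_subtype]
    have h1 : (h : E) ∈ closure
        (LinearMap.range (Finsupp.linearCombination ℝ a) : Set E) := by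
      rw [Finsupp.range_linearCombination]
      exact h.2
    convert h1 using 2
    ext f
    constructor
    · rintro ⟨_, ⟨c, rfl⟩, rfl⟩
      exact ⟨c, rfl⟩
    · rintro ⟨c, rfl⟩
      exact ⟨_, ⟨c, rfl⟩, rfl⟩
  have hn : ∀ c, ‖Finsupp.linearCombination ℝ b c‖ ≤ 1 * ‖e c‖ := fun c => by
    rw [one_mul]
    exact norm_linearCombination_le Q hQ h0 c
  have hT : ∀ c, (Finsupp.linearCombination ℝ b).extendOfNorm e (e c) =
    Finsupp.linearCombination ℝ b c := LinearMap.extendOfNorm_eq hd ⟨1, hn⟩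
  refine ⟨(Finsupp.linearCombination ℝ b).extendOfNorm e, fun i => ?_, fun h => ?_,
    fun S hS hg h => ?_⟩
  · have := hT (Finsupp.single i 1)
    rw [Finsupp.linearCombination_single, one_smul] at this
    rw [← this]
    congr 1
    ext
    simp [e]
  · simpa using LinearMap.norm_extendOfNorm_apply_le hd 1 hn h
  · refine hd.induction_on (p := fun h : cspan a =>
      ((h : E), (Finsupp.linearCombination ℝ b).extendOfNorm e h) ∈ S) h ?_ fun c => ?_
    · exact hS.preimage (by fun_prop)
    · rw [hT]
      have h1 : ((e c : E), Finsupp.linearCombination ℝ b c) =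
          Finsupp.linearCombination ℝ (fun i => (a i, b i)) c := by
        ext
        · simp [e, Finsupp.linearCombination_apply, Finsupp.sum, Prod.fst_sum]
        · simp [Finsupp.linearCombination_apply, Finsupp.sum, Prod.snd_sum]
      rw [h1, Finsupp.linearCombination_apply]
      exact Submodule.sum_mem _ fun i _ => S.smul_mem _ (hg i)

/-- The pairs `(h, g)` with `⟪f', g⟫ = ⟪f, h⟫`. -/
noncomputable def innerPairs (f f' : E) : Submodule ℝ (E × E) :=
  LinearMap.ker (((innerSL ℝ f').comp (ContinuousLinearMap.snd ℝ E E) -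
    (innerSL ℝ f).comp (ContinuousLinearMap.fst ℝ E E)).toLinearMap)

theorem mem_innerPairs {f f' h g : E} :
    (h, g) ∈ innerPairs f f' ↔ inner ℝ g f' = inner ℝ h f := by
  simp [innerPairs, sub_eq_zero, real_inner_comm]

theorem isClosed_innerPairs (f f' : E) : IsClosed (innerPairs f f' : Set (E × E)) :=
  ContinuousLinearMap.isClosed_ker _

theorem isClosed_prod_cspan {κ : Type*} (a : ι → E) (b : κ → E) :
    IsClosed (((cspan a).prod (cspan b) : Submodule ℝ (E × E)) : Set (E × E)) := by
  rw [Submodule.prod_coe]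
  exact (isClosed_cspan a).prod (isClosed_cspan b)

/-- Inner products of elements of a closed span are determined by the Gram matrix of the family
and by the inner products with its members. -/
theorem inner_eq_of_gram_eq [CompleteSpace E] {a a' : ι → E}
    (hG : ∀ i j, inner ℝ (a i) (a j) = inner ℝ (a' i) (a' j)) {h g h' g' : E}
    (hh : h ∈ cspan a) (hg : g ∈ cspan a) (hh' : h' ∈ cspan a') (hg' : g' ∈ cspan a')
    (hi : ∀ i, inner ℝ h (a i) = inner ℝ h' (a' i))
    (gi : ∀ i, inner ℝ g (a i) = inner ℝ g' (a' i)) :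
    inner ℝ h g = inner ℝ h' g' := by
  obtain ⟨T, -, -, hTS⟩ := exists_contraction (a := a) (b := a') (fun _ => True)
    (fun i _ j => (hG i j).symm) (fun i hi => (hi trivial).elim)
  -- The isometry `a i ↦ a' i` sends `k` to the only element of the second span having the
  -- prescribed inner products.
  have key : ∀ k (hk : k ∈ cspan a), ∀ k' ∈ cspan a',
      (∀ i, inner ℝ k (a i) = inner ℝ k' (a' i)) → T ⟨k, hk⟩ = k' := by
    intro k hk k' hk' ki
    refine eq_of_mem_cspan_of_inner_eq (a := a') ?_ hk' fun i => ?_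
    · exact (hTS _ (isClosed_prod_cspan a a')
        (fun i => ⟨mem_cspan a i, mem_cspan a' i⟩) ⟨k, hk⟩).2
    · rw [← ki i]
      exact mem_innerPairs.1 (hTS (innerPairs (a i) (a' i)) (isClosed_innerPairs _ _)
        (fun j => mem_innerPairs.2 (hG j i).symm) ⟨k, hk⟩)
  have h1 := key h hh h' hh' hi
  have h2 := key g hg g' hg' gi
  have h3 := mem_innerPairs.1 (hTS (innerPairs g (T ⟨g, hg⟩)) (isClosed_innerPairs _ _)
    (fun j => mem_innerPairs.2 (by rw [h2, real_inner_comm, ← gi, real_inner_comm])) ⟨h, hh⟩)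
  rw [h1, h2] at h3
  exact h3.symm

/-- The adjoint of the contraction `a i ↦ b i`. -/
theorem exists_adjoint [CompleteSpace E] {a b : ι → E} (Q : ι → Prop)
    (hQ : ∀ i, Q i → ∀ j, inner ℝ (b i) (b j) = inner ℝ (a i) (a j))
    (h0 : ∀ i, ¬ Q i → b i = 0) (f : E) :
    ∃ h ∈ cspan a, ∀ i, inner ℝ h (a i) = inner ℝ f (b i) := by
  obtain ⟨T, hTa, -, -⟩ := exists_contraction Q hQ h0
  have : CompleteSpace (cspan a) := (isClosed_cspan a).completeSpace_coe
  refine ⟨((InnerProductSpace.toDual ℝ (cspan a)).symm ((innerSL ℝ f).comp T) : cspan a),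
    Subtype.coe_prop _, fun i => ?_⟩
  have := InnerProductSpace.toDual_symm_apply (𝕜 := ℝ) (E := cspan a)
    (x := ⟨a i, mem_cspan a i⟩) (y := (innerSL ℝ f).comp T)
  rw [Submodule.coe_inner] at this
  rw [this]
  simp [hTa]

end HilbertSpace

/-! ### The shift of the past by one letter. -/

section PastProducts

variable {E : Type*} [NormedAddCommGroup E] [InnerProductSpace ℝ E] {α : Type*}

/-- Closed graphs of (partially defined, single-valued) linear operators. -/
structure IsShiftGraph (G : α → ℤ → Submodule ℝ (E × E)) : Prop where
  isClosed : ∀ σ t, IsClosed (G σ t : Set (E × E))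
  functional : ∀ σ t f, (0, f) ∈ G σ t → f = 0

/-- Membership in `L` of a word of length at least two is decided by its last two letters and the
word without its last letter. -/
def IsSnocAdmissible (L : Set (List α)) : Prop :=
  ∀ (w : List α) (τ σ : α), (w ++ [τ]) ++ [σ] ∈ L ↔ w ++ [τ] ∈ L ∧ [τ, σ] ∈ L

/-- The covariance properties of the products of a process with past inputs, as properties of
vectors in a Hilbert space. -/
structure PastProducts (L : Set (List α)) (G : α → ℤ → Submodule ℝ (E × E)) {k : ℕ}
    (z : List α → ℤ → Fin k → E) : Prop where
  step : ∀ w t i σ, (z w t i, z (w ++ [σ]) (t + 1) i) ∈ G σ t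
  zero : ∀ w, w ≠ [] → w ∉ L → ∀ t i, z w t i = 0
  stationary : ∀ w v, v ≠ [] → ∀ t s i j,
    inner ℝ (z w t i) (z v t j) = inner ℝ (z w s i) (z v s j)
  orth : ∀ w v σ σ', σ ≠ σ' → ∀ t i j,
    inner ℝ (z (w ++ [σ]) t i) (z (v ++ [σ']) t j) = 0
  iso : ∀ w v σ, w ≠ [] → w ++ [σ] ∈ L → ∀ t i j,
    inner ℝ (z (w ++ [σ]) (t + 1) i) (z (v ++ [σ]) (t + 1) j) = inner ℝ (z w t i) (z v t j)

/-- The members of a family of vectors with index words in `W`. -/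
def restrWords {k : ℕ} (z : List α → ℤ → Fin k → E) (W : Set (List α)) (t : ℤ) :
    {w // w ∈ W} × Fin k → E :=
  fun a => z a.1.1 t a.2

/-- The closed span of the vectors with index words in `W`. -/
def wordSpan {k : ℕ} (z : List α → ℤ → Fin k → E) (W : Set (List α)) (t : ℤ) :
    Submodule ℝ E :=
  cspan (restrWords z W t)

/-- The non-empty words. -/
def nonemptyWords (α : Type*) : Set (List α) := {w | w ≠ []}

/-- The words with last letter `σ`. -/
def endingWords (σ : α) : Set (List α) := {w | ∃ v, w = v ++ [σ]}

theorem endingWords_subset (σ : α) : endingWords σ ⊆ nonemptyWords α := by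
  rintro _ ⟨v, rfl⟩
  simp [nonemptyWords]

section Basic

variable {k : ℕ} {z : List α → ℤ → Fin k → E} {W W' : Set (List α)} {t : ℤ}

theorem mem_wordSpan {w : List α} (hw : w ∈ W) (i : Fin k) : z w t i ∈ wordSpan z W t :=
  mem_cspan (restrWords z W t) (⟨w, hw⟩, i)

theorem wordSpan_le {S : Submodule ℝ E} (hS : IsClosed (S : Set E))
    (h : ∀ w ∈ W, ∀ i, z w t i ∈ S) : wordSpan z W t ≤ S :=
  cspan_le hS fun a => h _ a.1.2 a.2

theorem isClosed_wordSpan : IsClosed (wordSpan z W t : Set E) := isClosed_cspan _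

theorem wordSpan_mono (h : W ⊆ W') : wordSpan z W t ≤ wordSpan z W' t :=
  wordSpan_le isClosed_wordSpan fun _ hw i => mem_wordSpan (h hw) i

theorem endingSpan_le {σ : α} {h : E} (hh : h ∈ wordSpan z (endingWords σ) t) :
    h ∈ wordSpan z (nonemptyWords α) t :=
  wordSpan_mono (endingWords_subset σ) hh

theorem inner_eq_zero_of_mem_wordSpan {h f : E} (hh : h ∈ wordSpan z W t)
    (hf : ∀ w ∈ W, ∀ i, inner ℝ (z w t i) f = 0) : inner ℝ h f = 0 :=
  inner_eq_zero_of_mem_cspan (a := restrWords z W t) (f := f)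
    (fun a => hf a.1.1 a.1.2 a.2) hh

end Basic

namespace IsShiftGraph

variable {G : α → ℤ → Submodule ℝ (E × E)}

theorem unique (hG : IsShiftGraph G) {σ : α} {t : ℤ} {f g g' : E} (h : (f, g) ∈ G σ t)
    (h' : (f, g') ∈ G σ t) : g = g' := by
  have := (G σ t).sub_mem h h'
  simp only [Prod.mk_sub_mk, sub_self] at this
  exact sub_eq_zero.1 (hG.functional _ _ _ this)

theorem sum_smul_mem {ι : Type*} (s : Finset ι) (c : ι → ℝ) {σ : α} {t : ℤ} {f g : ι → E}
    (h : ∀ i ∈ s, (f i, g i) ∈ G σ t) : (∑ i ∈ s, c i • f i, ∑ i ∈ s, c i • g i) ∈ G σ t := by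
  have : (∑ i ∈ s, c i • f i, ∑ i ∈ s, c i • g i) = ∑ i ∈ s, c i • (f i, g i) := by
    ext <;> simp [Prod.fst_sum, Prod.snd_sum]
  rw [this]
  exact Submodule.sum_mem _ fun i hi => Submodule.smul_mem _ _ (h i hi)

end IsShiftGraph

namespace PastProducts

variable {L : Set (List α)} {G : α → ℤ → Submodule ℝ (E × E)} {k : ℕ}
  {z : List α → ℤ → Fin k → E} {W : Set (List α)} {t : ℤ} {σ : α}

theorem inner_ending_eq_zero (hz : PastProducts L G z) {σ σ' : α} (hne : σ ≠ σ') {g g' : E}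
    (hg : g ∈ wordSpan z (endingWords σ) t) (hg' : g' ∈ wordSpan z (endingWords σ') t) :
    inner ℝ g g' = 0 := by
  refine inner_eq_zero_of_mem_wordSpan hg ?_
  rintro _ ⟨w, rfl⟩ i
  rw [real_inner_comm]
  refine inner_eq_zero_of_mem_wordSpan hg' ?_
  rintro _ ⟨v, rfl⟩ j
  exact hz.orth _ _ _ _ hne.symm _ _ _

variable [CompleteSpace E]

/-- The rows with `wσ ∈ L` of the Gram matrix are preserved and the other products vanish, so
`z_w(t) ↦ z_{wσ}(t+1)` extends to a contraction. Closedness of `G σ t` guarantees that its values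
are still products with the input. -/
theorem exists_shift (hz : PastProducts L G z) (hG : IsShiftGraph G) (hW : W ⊆ nonemptyWords α)
    (σ : α) {h : E} (hh : h ∈ wordSpan z W t) :
    ∃ g, (h, g) ∈ G σ t ∧ ‖g‖ ≤ ‖h‖ ∧
      ∀ S : Submodule ℝ (E × E), IsClosed (S : Set (E × E)) →
        (∀ w ∈ W, ∀ i, (z w t i, z (w ++ [σ]) (t + 1) i) ∈ S) → (h, g) ∈ S := by
  obtain ⟨T, -, hT, hS⟩ := exists_contraction (a := restrWords z W t)
    (b := fun a => z (a.1.1 ++ [σ]) (t + 1) a.2) (fun a => a.1.1 ++ [σ] ∈ L)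
    (fun a ha b => hz.iso _ _ _ (hW a.1.2) ha _ _ _)
    (fun a ha => hz.zero _ (by simp) ha _ _)
  exact ⟨T ⟨h, hh⟩, hS _ (hG.isClosed σ t) (fun a => hz.step _ _ _ _) ⟨h, hh⟩, hT ⟨h, hh⟩,
    fun S hSc hSg => hS S hSc (fun a => hSg _ a.1.2 a.2) ⟨h, hh⟩⟩

theorem shift_induction (hz : PastProducts L G z) (hG : IsShiftGraph G)
    (hW : W ⊆ nonemptyWords α) {h g : E} (hh : h ∈ wordSpan z W t) (hg : (h, g) ∈ G σ t)
    {S : Submodule ℝ (E × E)} (hS : IsClosed (S : Set (E × E)))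
    (hSg : ∀ w ∈ W, ∀ i, (z w t i, z (w ++ [σ]) (t + 1) i) ∈ S) : (h, g) ∈ S := by
  obtain ⟨g', hg', -, h3⟩ := hz.exists_shift hG hW σ hh
  rw [hG.unique hg hg']
  exact h3 S hS hSg

theorem norm_shift_le (hz : PastProducts L G z) (hG : IsShiftGraph G) {h g : E}
    (hh : h ∈ wordSpan z (nonemptyWords α) t) (hg : (h, g) ∈ G σ t) : ‖g‖ ≤ ‖h‖ := by
  obtain ⟨g', hg', h2, -⟩ := hz.exists_shift hG subset_rfl σ hh
  rwa [hG.unique hg hg']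

theorem shift_mem (hz : PastProducts L G z) (hG : IsShiftGraph G) {h g : E}
    (hh : h ∈ wordSpan z (nonemptyWords α) t) (hg : (h, g) ∈ G σ t) :
    g ∈ wordSpan z (endingWords σ) (t + 1) :=
  (hz.shift_induction hG subset_rfl hh hg (isClosed_prod_cspan (restrWords z (nonemptyWords α) t)
    (restrWords z (endingWords σ) (t + 1))) fun w hw i =>
      ⟨mem_wordSpan hw i, mem_wordSpan (W := endingWords σ) ⟨w, rfl⟩ i⟩).2

/-- When `τσ` is admissible, `wτσ ∈ L` if and only if `wτ ∈ L`. The shift thus kills only generators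
that are already zero, and the contraction is isometric on this span. -/
theorem inner_shift_product (hz : PastProducts L G z) (hG : IsShiftGraph G)
    (hL : IsSnocAdmissible L) {τ : α} (hτ : [τ, σ] ∈ L) {h g : E}
    (hh : h ∈ wordSpan z (endingWords τ) t) (hg : (h, g) ∈ G σ t) (v : List α) (j : Fin k) :
    inner ℝ g (z (v ++ [σ]) (t + 1) j) = inner ℝ h (z v t j) := by
  refine mem_innerPairs.1 (hz.shift_induction hG (endingWords_subset τ) hh hg
    (isClosed_innerPairs _ _) ?_)
  rintro _ ⟨w, rfl⟩ i
  rw [mem_innerPairs]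
  by_cases hw : (w ++ [τ]) ++ [σ] ∈ L
  · exact hz.iso _ _ _ (by simp) hw _ _ _
  · have hw' : w ++ [τ] ∉ L := fun h' => hw ((hL _ _ _).2 ⟨h', hτ⟩)
    rw [hz.zero _ (by simp) hw, hz.zero _ (by simp) hw', inner_zero_left, inner_zero_left]

theorem inner_shift (hz : PastProducts L G z) (hG : IsShiftGraph G)
    (hL : IsSnocAdmissible L) {τ : α} (hτ : [τ, σ] ∈ L) {h g f f' : E}
    (hh : h ∈ wordSpan z (endingWords τ) t) (hg : (h, g) ∈ G σ t)
    (hf : f ∈ wordSpan z (nonemptyWords α) t) (hf' : (f, f') ∈ G σ t) :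
    inner ℝ g f' = inner ℝ h f := by
  rw [real_inner_comm, real_inner_comm f]
  refine mem_innerPairs.1 (hz.shift_induction hG subset_rfl hf hf'
    (isClosed_innerPairs _ _) fun w _ i => mem_innerPairs.2 ?_)
  rw [real_inner_comm, real_inner_comm h]
  exact hz.inner_shift_product hG hL hτ hh hg w i

theorem shift_eq_zero (hz : PastProducts L G z) (hG : IsShiftGraph G)
    (hL : IsSnocAdmissible L) {τ : α} (hτ : [τ, σ] ∉ L) {h g : E}
    (hh : h ∈ wordSpan z (endingWords τ) t) (hg : (h, g) ∈ G σ t) : g = 0 := by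
  have h0 : IsClosed (((⊤ : Submodule ℝ E).prod (⊥ : Submodule ℝ E) : Submodule ℝ (E × E)) :
      Set (E × E)) := by
    rw [Submodule.prod_coe, Submodule.top_coe, Submodule.bot_coe]
    exact isClosed_univ.prod isClosed_singleton
  refine (hz.shift_induction hG (endingWords_subset τ) hh hg h0 ?_).2
  rintro _ ⟨w, rfl⟩ i
  exact ⟨trivial, hz.zero _ (by simp) (fun h' => hτ ((hL _ _ _).1 h').2) _ _⟩

theorem inner_product_shift (hz : PastProducts L G z) (hG : IsShiftGraph G) {f f' : E}
    (hf : f ∈ wordSpan z (nonemptyWords α) t) (hf' : (f, f') ∈ G σ t) {w : List α}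
    (hw : w ≠ []) (hwL : w ++ [σ] ∈ L) (j : Fin k) :
    inner ℝ f' (z (w ++ [σ]) (t + 1) j) = inner ℝ f (z w t j) := by
  refine mem_innerPairs.1 (hz.shift_induction hG subset_rfl hf hf'
    (isClosed_innerPairs _ _) fun v _ i => mem_innerPairs.2 ?_)
  rw [real_inner_comm, real_inner_comm (z w t j)]
  exact hz.iso _ _ _ hw hwL _ _ _

/-- With `f` an entry of `y(t+|w|)`, `q` plays the role of the projection of its product with the
inputs along `w`, a product that need not be square integrable. Project `f` on the past at time
`t+|w|`, then apply the adjoints of the shifts, the last letter of `w` first. -/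
theorem exists_inner_append (hz : PastProducts L G z) (w : List α) (f : E) (t : ℤ) :
    ∃ q ∈ wordSpan z (nonemptyWords α) t, ∀ v, v ≠ [] → ∀ j,
      inner ℝ q (z v t j) = inner ℝ f (z (v ++ w) (t + w.length) j) := by
  induction w generalizing t with
  | nil =>
    obtain ⟨q, hq, hq'⟩ := exists_mem_cspan_inner_eq (restrWords z (nonemptyWords α) t) f
    exact ⟨q, hq, fun v hv j => by simpa [restrWords] using hq' (⟨v, hv⟩, j)⟩
  | cons σ w ih =>
    obtain ⟨q', -, hq'⟩ := ih (t + 1)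
    obtain ⟨q, hq, hq2⟩ := exists_adjoint (a := restrWords z (nonemptyWords α) t)
      (b := fun a => z (a.1.1 ++ [σ]) (t + 1) a.2) (fun a => a.1.1 ++ [σ] ∈ L)
      (fun a ha b => hz.iso _ _ _ a.1.2 ha _ _ _)
      (fun a ha => hz.zero _ (by simp) ha _ _) q'
    refine ⟨q, hq, fun v hv j => ?_⟩
    have h1 := hq2 (⟨v, hv⟩, j)
    have h2 := hq' (v ++ [σ]) (by simp) j
    simp only [restrWords] at h1
    rw [h1, h2]
    congr 2
    · simp
    · push_cast [List.length_cons]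
      ring

end PastProducts

end PastProducts

/-! ### Covariances of the state, the gain equation and the state equation. -/

section State

variable {E : Type*} [NormedAddCommGroup E] [InnerProductSpace ℝ E] {α : Type*}

/-- The Gram matrix of two vectors with entries in a Hilbert space. -/
def gram {k l : ℕ} (f : Fin k → E) (g : Fin l → E) : Matrix (Fin k) (Fin l) ℝ :=
  Matrix.of fun i j => inner ℝ (f i) (g j)

/-- The product of a matrix with a vector with entries in a Hilbert space. -/
def vact {k l : ℕ} (M : Matrix (Fin k) (Fin l) ℝ) (f : Fin l → E) : Fin k → E :=
  fun i => ∑ j, M i j • f j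

theorem gram_apply {k l : ℕ} (f : Fin k → E) (g : Fin l → E) (i : Fin k) (j : Fin l) :
    gram f g i j = inner ℝ (f i) (g j) := rfl

theorem inner_vact_left {k l : ℕ} (M : Matrix (Fin k) (Fin l) ℝ) (f : Fin l → E) (i : Fin k)
    (g : E) : inner ℝ (vact M f i) g = ∑ j, M i j * inner ℝ (f j) g := by
  simp [vact, sum_inner, real_inner_smul_left]

theorem inner_vact_right {k l : ℕ} (M : Matrix (Fin k) (Fin l) ℝ) (f : Fin l → E) (i : Fin k)
    (g : E) : inner ℝ g (vact M f i) = ∑ j, M i j * inner ℝ g (f j) := by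
  simp [vact, inner_sum, real_inner_smul_right]

theorem gram_vact_left {k l m : ℕ} (M : Matrix (Fin k) (Fin l) ℝ) (f : Fin l → E)
    (g : Fin m → E) : gram (vact M f) g = M * gram f g := by
  ext i j
  rw [gram_apply, inner_vact_left]
  rfl

theorem gram_transpose {k l : ℕ} (f : Fin k → E) (g : Fin l → E) : (gram f g)ᵀ = gram g f := by
  ext i j
  exact real_inner_comm _ _

theorem gram_vact_right {k l m : ℕ} (M : Matrix (Fin k) (Fin l) ℝ) (f : Fin l → E)
    (g : Fin m → E) : gram g (vact M f) = gram g f * Mᵀ := by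
  rw [← gram_transpose, gram_vact_left, Matrix.transpose_mul, gram_transpose]

theorem gram_add_left {k l : ℕ} (f f' : Fin k → E) (g : Fin l → E) :
    gram (f + f') g = gram f g + gram f' g := by
  ext i j
  exact inner_add_left _ _ _

theorem gram_sub_left {k l : ℕ} (f f' : Fin k → E) (g : Fin l → E) :
    gram (f - f') g = gram f g - gram f' g := by
  ext i j
  exact inner_sub_left _ _ _

theorem gram_sub_right {k l : ℕ} (f f' : Fin k → E) (g : Fin l → E) :
    gram g (f - f') = gram g f - gram g f' := by
  ext i j
  exact inner_sub_right _ _ _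

theorem vact_mem {k l : ℕ} (M : Matrix (Fin k) (Fin l) ℝ) {f : Fin l → E} {S : Submodule ℝ E}
    (hf : ∀ j, f j ∈ S) (i : Fin k) : vact M f i ∈ S :=
  Submodule.sum_mem _ fun j _ => Submodule.smul_mem _ _ (hf j)

variable {G : α → ℤ → Submodule ℝ (E × E)}

theorem IsShiftGraph.vact_mem {k l : ℕ} (M : Matrix (Fin k) (Fin l) ℝ) {f g : Fin l → E} {σ : α}
    {t : ℤ} (h : ∀ j, (f j, g j) ∈ G σ t) (i : Fin k) : (vact M f i, vact M g i) ∈ G σ t :=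
  IsShiftGraph.sum_smul_mem _ _ fun j _ => h j

variable {p n : ℕ} {L : Set (List α)}

/-- The data of the innovation representation in a Hilbert space: `x` is the state, `mx σ` its
shift by the letter `σ`; the process `z []` has covariances given by the minimal representation
`R`. -/
structure IsState (L : Set (List α)) (G : α → ℤ → Submodule ℝ (E × E))
    (z : List α → ℤ → Fin p → E) (Ψ : Fin p × α → List α → Fin p → ℝ)
    (R : SeriesRep α (Fin p × α) p n) (x : ℤ → Fin n → E) (mx : α → ℤ → Fin n → E) : Prop where
  past : PastProducts L G z
  graph : IsShiftGraph G
  snoc : IsSnocAdmissible L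
  minimal : R.IsMinimal Ψ
  cov : ∀ t σ v i j, inner ℝ (z [] t i) (z (σ :: v) t j) = Ψ (j, σ) v i
  mem : ∀ t i, x t i ∈ wordSpan z (nonemptyWords α) t
  inner_eq : ∀ t i σ v j,
    inner ℝ (x t i) (z (σ :: v) t j) = (wordProd R.A v *ᵥ R.B (j, σ)) i
  shift : ∀ σ t i, (x t i, mx σ t i) ∈ G σ t

/-- The innovation. -/
def innov (z : List α → ℤ → Fin p → E) (C : Matrix (Fin p) (Fin n) ℝ) (x : ℤ → Fin n → E)
    (t : ℤ) : Fin p → E := z [] t - vact C (x t)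

/-- The shift of the innovation. -/
def innovShift (z : List α → ℤ → Fin p → E) (C : Matrix (Fin p) (Fin n) ℝ)
    (mx : α → ℤ → Fin n → E) (σ : α) (t : ℤ) : Fin p → E := z [σ] (t + 1) - vact C (mx σ t)

namespace IsState

variable {z : List α → ℤ → Fin p → E} {Ψ : Fin p × α → List α → Fin p → ℝ}
  {R : SeriesRep α (Fin p × α) p n} {x : ℤ → Fin n → E} {mx : α → ℤ → Fin n → E}

theorem wordProd_mulVec_eq_zero (h : IsState L G z Ψ R x mx) {σ : α} {v : List α}
    (hv : σ :: v ∉ L) (j : Fin p) : wordProd R.A v *ᵥ R.B (j, σ) = 0 := by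
  ext i
  rw [← h.inner_eq 0 i, h.past.zero _ (by simp) hv, inner_zero_right, Pi.zero_apply]

theorem snoc_mulVec_eq_zero (h : IsState L G z Ψ R x mx) {σ₁ σ₂ : α} (h12 : [σ₁, σ₂] ∉ L)
    (j : Fin p) : R.A σ₂ *ᵥ R.B (j, σ₁) = 0 := by
  simpa [wordProd] using h.wordProd_mulVec_eq_zero (v := [σ₂]) h12 j

/-- Any word `τ w σ₁ σ₂` is inadmissible, so the corresponding product vanishes and `A_{σ₂} A_{σ₁}`
annihilates every reachable vector `A_w B_{(j,τ)}`. -/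
theorem mul_eq_zero (h : IsState L G z Ψ R x mx) {σ₁ σ₂ : α} (h12 : [σ₁, σ₂] ∉ L) :
    R.A σ₂ * R.A σ₁ = 0 := by
  refine SeriesRep.mulVec_eq_zero_of_reach h.minimal ?_
  rintro w ⟨j, τ⟩
  have h1 : τ :: ((w ++ [σ₁]) ++ [σ₂]) ∉ L := fun h' => by
    have := (h.snoc (τ :: w) σ₁ σ₂).1 (by simpa using h')
    exact h12 this.2
  have := h.wordProd_mulVec_eq_zero h1 j
  rw [wordProd_snoc, wordProd_snoc] at this
  simpa only [Matrix.mulVec_mulVec, Matrix.mul_assoc] using this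

theorem innov_shift (h : IsState L G z Ψ R x mx) (σ : α) (t : ℤ) (i : Fin p) :
    (innov z R.C x t i, innovShift z R.C mx σ t i) ∈ G σ t :=
  (G σ t).sub_mem (h.past.step [] t i σ) (IsShiftGraph.vact_mem R.C (h.shift σ t) i)

/-- `C x(t)` has covariance `C A_v B_{(j,σ)}` with the past products, which is that of `y(t)`
because `R` represents the family. -/
theorem product_inner_innov (h : IsState L G z Ψ R x mx) {w : List α} (hw : w ≠ []) (t : ℤ)
    (i j : Fin p) : inner ℝ (z w t j) (innov z R.C x t i) = 0 := by
  obtain ⟨σ, v, rfl⟩ := List.exists_cons_of_ne_nil hw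
  rw [innov, Pi.sub_apply, inner_sub_right, inner_vact_right, real_inner_comm, h.cov,
    h.minimal.1, ← Matrix.mulVec_mulVec, sub_eq_zero]
  change ∑ l, R.C i l * (wordProd R.A v *ᵥ R.B (j, σ)) l = _
  refine Finset.sum_congr rfl fun l _ => ?_
  rw [real_inner_comm, h.inner_eq]

theorem inner_innov (h : IsState L G z Ψ R x mx) {t : ℤ} {f : E}
    (hf : f ∈ wordSpan z (nonemptyWords α) t) (i : Fin p) :
    inner ℝ f (innov z R.C x t i) = 0 :=
  inner_eq_zero_of_mem_wordSpan hf fun _ hw j => h.product_inner_innov hw t i j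

theorem gram_x_letter (h : IsState L G z Ψ R x mx) (σ : α) (t : ℤ) :
    gram (x t) (z [σ] t) = R.BMat σ := by
  ext i j
  rw [gram_apply, h.inner_eq, wordProd, Matrix.one_mulVec]
  rfl

variable [CompleteSpace E]

theorem product_inner_innovShift (h : IsState L G z Ψ R x mx) {w : List α} (hw : w ≠ []) (σ : α)
    (t : ℤ) (i j : Fin p) :
    inner ℝ (z (w ++ [σ]) (t + 1) j) (innovShift z R.C mx σ t i) = 0 := by
  by_cases hL : w ++ [σ] ∈ L
  · have h1 := h.product_inner_innov hw t i j
    rw [innov, Pi.sub_apply, inner_sub_right, inner_vact_right] at h1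
    have h2 := h.past.iso w [] σ hw hL t j i
    rw [List.nil_append] at h2
    rw [innovShift, Pi.sub_apply, inner_sub_right, inner_vact_right, h2, ← h1]
    congr 1
    refine Finset.sum_congr rfl fun l _ => ?_
    rw [real_inner_comm, h.past.inner_product_shift h.graph (h.mem t l) (h.shift σ t l) hw hL,
      real_inner_comm]
  · rw [h.past.zero _ (by simp) hL, inner_zero_left]

theorem inner_innovShift (h : IsState L G z Ψ R x mx) {σ : α} {t : ℤ} {f g : E}
    (hf : f ∈ wordSpan z (nonemptyWords α) t) (hg : (f, g) ∈ G σ t) (i : Fin p) :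
    inner ℝ g (innovShift z R.C mx σ t i) = 0 := by
  -- With first vector `0`, the closed relation says that the second component is orthogonal to the
  -- shifted innovation.
  have := mem_innerPairs.1 (h.past.shift_induction h.graph subset_rfl hf hg
    (isClosed_innerPairs 0 (innovShift z R.C mx σ t i)) fun w hw j => mem_innerPairs.2 (by
      rw [inner_zero_right]; exact h.product_inner_innovShift hw σ t i j))
  rwa [inner_zero_right] at this

theorem gram_shift_innovShift (h : IsState L G z Ψ R x mx) (σ : α) (t : ℤ) :
    gram (mx σ t) (innovShift z R.C mx σ t) = 0 := by
  ext i j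
  exact h.inner_innovShift (h.mem t i) (h.shift σ t i) j

theorem mx_mem (h : IsState L G z Ψ R x mx) (σ : α) (t : ℤ) (i : Fin n) :
    mx σ t i ∈ wordSpan z (endingWords σ) (t + 1) :=
  h.past.shift_mem h.graph (h.mem t i) (h.shift σ t i)

theorem innovShift_mem (h : IsState L G z Ψ R x mx) (σ : α) (t : ℤ) (i : Fin p) :
    innovShift z R.C mx σ t i ∈ wordSpan z (endingWords σ) (t + 1) :=
  Submodule.sub_mem _ (mem_wordSpan (W := endingWords σ) ⟨[], rfl⟩ i)
    (StochReal.vact_mem _ (h.mx_mem σ t) i)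

theorem gram_x_const (h : IsState L G z Ψ R x mx) (t s : ℤ) :
    gram (x t) (x t) = gram (x s) (x s) := by
  ext i j
  have key : ∀ i, ∀ a : {w // w ∈ nonemptyWords α} × Fin p,
      inner ℝ (x t i) (restrWords z (nonemptyWords α) t a) =
        inner ℝ (x s i) (restrWords z (nonemptyWords α) s a) := by
    rintro i ⟨⟨w, hw⟩, l⟩
    obtain ⟨σ, v, rfl⟩ := List.exists_cons_of_ne_nil hw
    simp only [restrWords, h.inner_eq]
  exact inner_eq_of_gram_eq (fun a b => h.past.stationary _ _ b.1.2 t s _ _) (h.mem t i)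
    (h.mem t j) (h.mem s i) (h.mem s j) (key i) (key j)

/-- Up to the factor `ρ_σ` this is the time invariance of `P_σ`. Against the shifted generators, the
shifted state has either the covariances of `x` with the original ones or zero, neither depending on
time. -/
theorem gram_mx_const (h : IsState L G z Ψ R x mx) (σ : α) (t s : ℤ) :
    gram (mx σ t) (mx σ t) = gram (mx σ s) (mx σ s) := by
  ext i j
  let a : ℤ → {w // w ∈ nonemptyWords α} × Fin p → E :=
    fun t q => z (q.1.1 ++ [σ]) (t + 1) q.2
  have hmem : ∀ t i, mx σ t i ∈ cspan (a t) := fun t i =>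
    (h.past.shift_induction h.graph subset_rfl (h.mem t i) (h.shift σ t i)
      (isClosed_prod_cspan (restrWords z (nonemptyWords α) t) (a t)) fun w hw j =>
        ⟨mem_wordSpan hw j, mem_cspan (a t) (⟨w, hw⟩, j)⟩).2
  have key : ∀ i q, inner ℝ (mx σ t i) (a t q) = inner ℝ (mx σ s i) (a s q) := by
    rintro i ⟨⟨w, hw⟩, l⟩
    by_cases hL : w ++ [σ] ∈ L
    · have h1 : ∀ t, inner ℝ (mx σ t i) (z (w ++ [σ]) (t + 1) l) = inner ℝ (x t i) (z w t l) :=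
        fun t => h.past.inner_product_shift h.graph (h.mem t i) (h.shift σ t i) hw hL l
      simp only [a, h1]
      obtain ⟨σ, v, rfl⟩ := List.exists_cons_of_ne_nil hw
      simp only [h.inner_eq]
    · simp only [a, h.past.zero _ (by simp) hL, inner_zero_right]
  exact inner_eq_of_gram_eq (fun a b => h.past.stationary _ _ (by simp) _ _ _ _)
    (hmem t i) (hmem t j) (hmem s i) (hmem s j) (key i) (key j)

/-- Pythagoras: `z_σ(t+1)` is the sum of the shifted innovation and `C` times the shifted state,
which are orthogonal. -/
theorem gram_innovShift (h : IsState L G z Ψ R x mx) (σ : α) (t : ℤ) :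
    gram (innovShift z R.C mx σ t) (innovShift z R.C mx σ t) =
      gram (z [σ] (t + 1)) (z [σ] (t + 1)) - R.C * gram (mx σ t) (mx σ t) * R.Cᵀ := by
  have h0 := h.gram_shift_innovShift σ t
  have hz : z [σ] (t + 1) = innovShift z R.C mx σ t + vact R.C (mx σ t) := by simp [innovShift]
  have h0' : gram (innovShift z R.C mx σ t) (mx σ t) = 0 := by
    rw [← gram_transpose, h0, Matrix.transpose_zero]
  have h1 : gram (z [σ] (t + 1)) (vact R.C (mx σ t)) =
      R.C * gram (mx σ t) (mx σ t) * R.Cᵀ := by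
    rw [hz, gram_add_left, gram_vact_left, gram_vact_right, gram_vact_right, h0']
    simp [Matrix.mul_assoc]
  conv_lhs => enter [1]; rw [innovShift]
  rw [gram_sub_left, gram_vact_left, h0, Matrix.mul_zero, sub_zero, innovShift, gram_sub_right, h1]

theorem gram_mx_letter (h : IsState L G z Ψ R x mx) (σ : α) (t : ℤ) :
    gram (mx σ t) (z [σ] (t + 1)) = gram (mx σ t) (mx σ t) * R.Cᵀ := by
  have h0 := h.gram_shift_innovShift σ t
  rwa [innovShift, gram_sub_right, gram_vact_right, sub_eq_zero] at h0

theorem gram_innovShift_letter (h : IsState L G z Ψ R x mx) (σ : α) (t : ℤ) :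
    gram (innovShift z R.C mx σ t) (z [σ] (t + 1)) =
      gram (z [σ] (t + 1)) (z [σ] (t + 1)) - R.C * gram (mx σ t) (mx σ t) * R.Cᵀ := by
  rw [innovShift, gram_sub_left, gram_vact_left, h.gram_mx_letter, Matrix.mul_assoc]

theorem mx_inner_product (h : IsState L G z Ψ R x mx) {σ τ : α} {v : List α}
    (hL : (τ :: v) ++ [σ] ∈ L) (t : ℤ) (l : Fin n) (j : Fin p) :
    inner ℝ (mx σ t l) (z ((τ :: v) ++ [σ]) (t + 1) j) = (wordProd R.A v *ᵥ R.B (j, τ)) l := by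
  rw [h.past.inner_product_shift h.graph (h.mem t l) (h.shift σ t l) (by simp) hL, h.inner_eq]

/-- Against `z_{wσ}(t+1)` with `w ≠ []`, both sides have the same covariance because `A_{wσ} = A_σ
A_w`. Only the one-letter word is not covered; that is what the gain corrects. -/
theorem x_succ_inner_shift (h : IsState L G z Ψ R x mx) {σ : α} {t : ℤ} {f g : E}
    (hf : f ∈ wordSpan z (nonemptyWords α) t) (hg : (f, g) ∈ G σ t) (i : Fin n) :
    inner ℝ g (x (t + 1) i) = inner ℝ g (vact (R.A σ) (mx σ t) i) := by
  have := mem_innerPairs.1 (h.past.shift_induction h.graph subset_rfl hf hg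
    (isClosed_innerPairs 0 (x (t + 1) i - vact (R.A σ) (mx σ t) i)) fun w hw j =>
      mem_innerPairs.2 ?_)
  · rwa [inner_zero_right, inner_sub_right, sub_eq_zero] at this
  rw [inner_zero_right]
  by_cases hL : w ++ [σ] ∈ L
  · obtain ⟨τ, v, rfl⟩ := List.exists_cons_of_ne_nil hw
    rw [real_inner_comm, inner_sub_left, inner_vact_left]
    simp only [h.mx_inner_product hL]
    rw [List.cons_append, h.inner_eq, wordProd_snoc, ← Matrix.mulVec_mulVec, sub_eq_zero]
    rfl
  · rw [h.past.zero _ (by simp) hL, inner_zero_left]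

/-- The kernel of the innovation covariance is contained in the kernel of the right hand side of
the gain equation. -/
theorem gain_ker (h : IsState L G z Ψ R x mx) (σ : α) (t : ℤ) {q : Fin p → ℝ}
    (hq : gram (innovShift z R.C mx σ t) (innovShift z R.C mx σ t) *ᵥ q = 0) :
    (R.BMat σ - R.A σ * gram (mx σ t) (mx σ t) * R.Cᵀ) *ᵥ q = 0 := by
  -- A kernel vector of a Gram matrix is a linear relation among the vectors themselves.
  have h1 : ∑ j, q j • innovShift z R.C mx σ t j = 0 := by
    rw [← inner_self_eq_zero (𝕜 := ℝ), sum_inner]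
    refine Finset.sum_eq_zero fun i _ => ?_
    have := congrFun hq i
    simp only [Matrix.mulVec, dotProduct, gram_apply, Pi.zero_apply] at this
    rw [real_inner_smul_left, inner_sum]
    simp only [real_inner_smul_right]
    rw [Finset.sum_congr rfl fun j _ => mul_comm (q j) _, this, mul_zero]
  -- The right-hand side of the gain equation is a covariance with the shifted innovation, so it
  -- inherits every such relation.
  have h2 : gram (x (t + 1)) (innovShift z R.C mx σ t) =
      R.BMat σ - R.A σ * gram (mx σ t) (mx σ t) * R.Cᵀ := by
    rw [innovShift, gram_sub_right, h.gram_x_letter, gram_vact_right]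
    have h3 : gram (x (t + 1)) (mx σ t) = R.A σ * gram (mx σ t) (mx σ t) := by
      rw [← gram_vact_left]
      ext i j
      rw [gram_apply, gram_apply, real_inner_comm,
        h.x_succ_inner_shift (h.mem t j) (h.shift σ t j), real_inner_comm]
    rw [h3]
  rw [← h2]
  ext i
  have h3 : inner ℝ (x (t + 1) i) (∑ j, q j • innovShift z R.C mx σ t j) = 0 := by
    rw [h1, inner_zero_right]
  rw [inner_sum] at h3
  simp only [real_inner_smul_right] at h3
  rw [Finset.sum_congr rfl fun j _ => mul_comm (q j) _] at h3
  exact h3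

/-- Both sides lie in the past space at `t+1`, so testing against `z_{wσ}(t+1)` suffices, and only
the summand for `σ` is not orthogonal to it. For `w = []` the identity is the gain equation; for `w
≠ []` the noise term drops out and the recursion `A_{wσ} = A_σ A_w` remains. -/
theorem state_eq [Fintype α] (h : IsState L G z Ψ R x mx) (K : α → Matrix (Fin n) (Fin p) ℝ)
    (t : ℤ)
    (hK : ∀ σ, K σ * (gram (z [σ] (t + 1)) (z [σ] (t + 1)) -
      R.C * gram (mx σ t) (mx σ t) * R.Cᵀ) =
        R.BMat σ - R.A σ * gram (mx σ t) (mx σ t) * R.Cᵀ) (i : Fin n) :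
    x (t + 1) i =
      ∑ σ, (vact (R.A σ) (mx σ t) i + vact (K σ) (innovShift z R.C mx σ t) i) := by
  classical
  have hmem : ∀ σ, vact (R.A σ) (mx σ t) i + vact (K σ) (innovShift z R.C mx σ t) i ∈
      wordSpan z (endingWords σ) (t + 1) := fun σ =>
    Submodule.add_mem _ (StochReal.vact_mem _ (h.mx_mem σ t) i)
      (StochReal.vact_mem _ (h.innovShift_mem σ t) i)
  refine eq_of_mem_cspan_of_inner_eq (a := restrWords z (nonemptyWords α) (t + 1))
    (h.mem _ _) (Submodule.sum_mem _ fun σ _ => endingSpan_le (hmem σ)) ?_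
  rintro ⟨⟨w, hw⟩, j⟩
  simp only [restrWords]
  rcases List.eq_nil_or_concat w with rfl | ⟨w, σ, rfl⟩
  · exact absurd rfl hw
  rw [List.concat_eq_append] at hw ⊢
  rw [sum_inner, Finset.sum_eq_single σ]
  · rw [inner_add_left]
    cases w with
    | nil =>
      rw [List.nil_append, ← gram_apply, h.gram_x_letter, ← gram_apply, ← gram_apply,
        gram_vact_left, gram_vact_left, h.gram_mx_letter, h.gram_innovShift_letter, hK,
        ← Matrix.mul_assoc, ← Matrix.add_apply, add_sub_cancel]
    | cons τ v =>
      by_cases hL : (τ :: v) ++ [σ] ∈ L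
      · rw [inner_vact_left, inner_vact_left]
        have h0 : ∀ l, inner ℝ (innovShift z R.C mx σ t l) (z ((τ :: v) ++ [σ]) (t + 1) j) = 0 :=
          fun l => by
            rw [real_inner_comm]
            exact h.product_inner_innovShift (by simp) σ t l j
        simp only [h0, h.mx_inner_product hL, mul_zero, Finset.sum_const_zero, add_zero]
        rw [List.cons_append, h.inner_eq, wordProd_snoc, ← Matrix.mulVec_mulVec]
        rfl
      · simp only [h.past.zero _ hw hL, inner_zero_right, add_zero]
  · intro σ' _ hne
    exact h.past.inner_ending_eq_zero hne (hmem σ')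
      (mem_wordSpan (W := endingWords σ) ⟨w, rfl⟩ j)
  · simp

end IsState

end State

/-! ### The innovation as noise, and the state in its past. -/

section Noise

open Filter Topology

variable {E : Type*} [NormedAddCommGroup E] [InnerProductSpace ℝ E] {α : Type*}
  {G : α → ℤ → Submodule ℝ (E × E)} {p n : ℕ} {L : Set (List α)}

/-- The products `ζ w` of the innovation with past inputs. -/
structure IsNoise (L : Set (List α)) (G : α → ℤ → Submodule ℝ (E × E))
    (z : List α → ℤ → Fin p → E) (C : Matrix (Fin p) (Fin n) ℝ) (x : ℤ → Fin n → E)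
    (ζ : List α → ℤ → Fin p → E) : Prop where
  nil : ∀ t, ζ [] t = innov z C x t
  step : ∀ w t i σ, (ζ w t i, ζ (w ++ [σ]) (t + 1) i) ∈ G σ t
  zero : ∀ w, w ≠ [] → w ∉ L → ∀ t i, ζ w t i = 0

namespace IsNoise

variable {z : List α → ℤ → Fin p → E} {Ψ : Fin p × α → List α → Fin p → ℝ}
  {R : SeriesRep α (Fin p × α) p n} {x : ℤ → Fin n → E} {mx : α → ℤ → Fin n → E}
  {ζ : List α → ℤ → Fin p → E}

theorem letter (h : IsState L G z Ψ R x mx) (hζ : IsNoise L G z R.C x ζ) (σ : α) (t : ℤ) :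
    ζ [σ] (t + 1) = innovShift z R.C mx σ t := by
  ext i
  have h1 := hζ.step [] t i σ
  rw [hζ.nil] at h1
  exact h.graph.unique h1 (h.innov_shift σ t i)

variable [CompleteSpace E]

theorem mem_ending (h : IsState L G z Ψ R x mx) (hζ : IsNoise L G z R.C x ζ) (w : List α)
    (σ : α) (t : ℤ) (i : Fin p) : ζ (w ++ [σ]) t i ∈ wordSpan z (endingWords σ) t := by
  induction w using List.reverseRecOn generalizing σ t with
  | nil =>
    obtain ⟨s, rfl⟩ : ∃ s, t = s + 1 := ⟨t - 1, by ring⟩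
    rw [List.nil_append, hζ.letter h]
    exact h.innovShift_mem σ s i
  | append_singleton w τ ih =>
    obtain ⟨s, rfl⟩ : ∃ s, t = s + 1 := ⟨t - 1, by ring⟩
    exact h.past.shift_mem h.graph (endingSpan_le (ih τ s)) (hζ.step _ s i σ)

theorem mem_nonempty (h : IsState L G z Ψ R x mx) (hζ : IsNoise L G z R.C x ζ) {w : List α}
    (hw : w ≠ []) (t : ℤ) (i : Fin p) : ζ w t i ∈ wordSpan z (nonemptyWords α) t := by
  rcases List.eq_nil_or_concat w with rfl | ⟨w, σ, rfl⟩
  · exact absurd rfl hw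
  rw [List.concat_eq_append]
  exact endingSpan_le (hζ.mem_ending h w σ t i)

theorem inner_nil (h : IsState L G z Ψ R x mx) (hζ : IsNoise L G z R.C x ζ) {w : List α}
    (hw : w ≠ []) (t : ℤ) (i j : Fin p) : inner ℝ (ζ w t i) (ζ [] t j) = 0 := by
  rw [hζ.nil]
  exact h.inner_innov (hζ.mem_nonempty h hw t i) j

theorem inner_letter (h : IsState L G z Ψ R x mx) (hζ : IsNoise L G z R.C x ζ) {w : List α}
    (hw : w ≠ []) (σ : α) (t : ℤ) (i j : Fin p) :
    inner ℝ (ζ (w ++ [σ]) t i) (ζ [σ] t j) = 0 := by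
  obtain ⟨s, rfl⟩ : ∃ s, t = s + 1 := ⟨t - 1, by ring⟩
  rw [hζ.letter h]
  exact h.inner_innovShift (hζ.mem_nonempty h hw s i) (hζ.step _ s i σ) j

theorem inner_snoc (h : IsState L G z Ψ R x mx) (hζ : IsNoise L G z R.C x ζ) {w : List α}
    {τ σ : α} (hτ : [τ, σ] ∈ L) {v : List α} (hv : v ≠ []) (t : ℤ) (i j : Fin p) :
    inner ℝ (ζ ((w ++ [τ]) ++ [σ]) (t + 1) i) (ζ (v ++ [σ]) (t + 1) j) =
      inner ℝ (ζ (w ++ [τ]) t i) (ζ v t j) :=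
  h.past.inner_shift h.graph h.snoc hτ (hζ.mem_ending h w τ t i) (hζ.step _ t i σ)
    (hζ.mem_nonempty h hv t j) (hζ.step _ t j σ)

theorem snoc_eq_zero (h : IsState L G z Ψ R x mx) (hζ : IsNoise L G z R.C x ζ) {w : List α}
    {τ σ : α} (hτ : [τ, σ] ∉ L) (t : ℤ) (i : Fin p) : ζ ((w ++ [τ]) ++ [σ]) (t + 1) i = 0 :=
  h.past.shift_eq_zero h.graph h.snoc hτ (hζ.mem_ending h w τ t i) (hζ.step _ t i σ)

/-- Different last letters give orthogonal spaces. A common last letter is stripped by the isometry,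
unless the product is zero, until one word is exhausted; then the innovation is orthogonal to the
past. -/
theorem inner_eq_zero_of_ne (h : IsState L G z Ψ R x mx) (hζ : IsNoise L G z R.C x ζ)
    {w v : List α} (hwv : w ≠ v) (t : ℤ) (i j : Fin p) : inner ℝ (ζ w t i) (ζ v t j) = 0 := by
  induction w using List.reverseRecOn generalizing v t with
  | nil =>
    rw [real_inner_comm]
    exact hζ.inner_nil h hwv.symm t j i
  | append_singleton w σ ih =>
    rcases List.eq_nil_or_concat v with rfl | ⟨v, σ', rfl⟩
    · exact hζ.inner_nil h hwv t i j
    rw [List.concat_eq_append] at hwv ⊢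
    by_cases hσ : σ = σ'
    · subst hσ
      have hne : w ≠ v := fun h' => hwv (by rw [h'])
      by_cases hv : v = []
      · subst hv
        exact hζ.inner_letter h hne σ t i j
      rcases List.eq_nil_or_concat w with rfl | ⟨w, τ, rfl⟩
      · rw [real_inner_comm]
        exact hζ.inner_letter h hv σ t j i
      rw [List.concat_eq_append] at *
      obtain ⟨s, rfl⟩ : ∃ s, t = s + 1 := ⟨t - 1, by ring⟩
      by_cases hτ : [τ, σ] ∈ L
      · rw [hζ.inner_snoc h hτ hv]
        exact ih hne s
      · rw [hζ.snoc_eq_zero h hτ, inner_zero_left]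
    · exact h.past.inner_ending_eq_zero hσ (hζ.mem_ending h w σ t i) (hζ.mem_ending h v σ' t j)

/-- Stripping last letters reduces to a one-letter word, where the Pythagoras formula for the
shifted innovation involves only stationary quantities. -/
theorem stationary_self (h : IsState L G z Ψ R x mx) (hζ : IsNoise L G z R.C x ζ)
    {w : List α} (hw : w ≠ []) (t s : ℤ) (i j : Fin p) :
    inner ℝ (ζ w t i) (ζ w t j) = inner ℝ (ζ w s i) (ζ w s j) := by
  induction w using List.reverseRecOn generalizing t s with
  | nil => exact absurd rfl hw
  | append_singleton w σ ih =>
    obtain ⟨t, rfl⟩ : ∃ s, t = s + 1 := ⟨t - 1, by ring⟩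
    obtain ⟨s, rfl⟩ : ∃ t, s = t + 1 := ⟨s - 1, by ring⟩
    rcases List.eq_nil_or_concat w with rfl | ⟨w, τ, rfl⟩
    · rw [List.nil_append, hζ.letter h, hζ.letter h, ← gram_apply, ← gram_apply,
        h.gram_innovShift, h.gram_innovShift, h.gram_mx_const σ t s, Matrix.sub_apply,
        Matrix.sub_apply, gram_apply, gram_apply, h.past.stationary _ _ (by simp) (t + 1) (s + 1)]
    rw [List.concat_eq_append] at *
    by_cases hτ : [τ, σ] ∈ L
    · rw [hζ.inner_snoc h hτ (by simp), hζ.inner_snoc h hτ (by simp)]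
      exact ih (by simp) t s
    · rw [hζ.snoc_eq_zero h hτ t, hζ.snoc_eq_zero h hτ s, inner_zero_left, inner_zero_left]

theorem pastProducts (h : IsState L G z Ψ R x mx) (hζ : IsNoise L G z R.C x ζ) :
    PastProducts L G ζ where
  step := hζ.step
  zero := hζ.zero
  stationary w v hv t s i j := by
    by_cases hwv : w = v
    · subst hwv
      exact hζ.stationary_self h hv t s i j
    · rw [hζ.inner_eq_zero_of_ne h hwv, hζ.inner_eq_zero_of_ne h hwv]
  orth w v σ σ' hne t i j :=
    h.past.inner_ending_eq_zero hne (hζ.mem_ending h w σ t i) (hζ.mem_ending h v σ' t j)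
  iso w v σ hw hL t i j := by
    by_cases hv : v = []
    · subst hv
      rw [List.nil_append, hζ.inner_letter h hw, hζ.inner_nil h hw]
    · rcases List.eq_nil_or_concat w with rfl | ⟨w, τ, rfl⟩
      · exact absurd rfl hw
      rw [List.concat_eq_append] at *
      exact hζ.inner_snoc h ((h.snoc _ _ _).1 hL).2 hv t i j

theorem wordSpan_le_past (h : IsState L G z Ψ R x mx) (hζ : IsNoise L G z R.C x ζ) (t : ℤ) :
    wordSpan ζ (nonemptyWords α) t ≤ wordSpan z (nonemptyWords α) t :=
  wordSpan_le isClosed_wordSpan fun _ hw i => hζ.mem_nonempty h hw t i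

end IsNoise

/-- A linear combination of the entries of a vector. -/
def combo {k : ℕ} (v : Fin k → ℝ) (f : Fin k → E) : E := ∑ i, v i • f i

theorem combo_vact {k l : ℕ} (v : Fin k → ℝ) (M : Matrix (Fin k) (Fin l) ℝ) (f : Fin l → E) :
    combo v (vact M f) = combo (Mᵀ *ᵥ v) f := by
  simp only [combo, vact, Finset.smul_sum, Matrix.mulVec, dotProduct, Finset.sum_smul, smul_smul,
    Matrix.transpose_apply]
  rw [Finset.sum_comm]
  exact Finset.sum_congr rfl fun _ _ => Finset.sum_congr rfl fun _ _ => by rw [mul_comm]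

theorem combo_mem {k : ℕ} (v : Fin k → ℝ) {f : Fin k → E} {S : Submodule ℝ E}
    (hf : ∀ j, f j ∈ S) : combo v f ∈ S :=
  Submodule.sum_mem _ fun j _ => Submodule.smul_mem _ _ (hf j)

theorem combo_sub {k : ℕ} (v : Fin k → ℝ) (f g : Fin k → E) :
    combo v (f - g) = combo v f - combo v g := by
  simp [combo, smul_sub]

theorem norm_combo_sq_le {k : ℕ} (v : Fin k → ℝ) (f : Fin k → E) :
    ‖combo v f‖ ^ 2 ≤ (∑ i, v i ^ 2) * ∑ i, ‖f i‖ ^ 2 := by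
  have h1 : ‖combo v f‖ ≤ ∑ i, |v i| * ‖f i‖ :=
    (norm_sum_le _ _).trans (Finset.sum_le_sum fun i _ => by rw [norm_smul, Real.norm_eq_abs])
  calc ‖combo v f‖ ^ 2 ≤ (∑ i, |v i| * ‖f i‖) ^ 2 := by gcongr
    _ ≤ (∑ i, |v i| ^ 2) * ∑ i, ‖f i‖ ^ 2 := Finset.sum_mul_sq_le_sq_mul_sq _ _ _
    _ = _ := by simp only [sq_abs]

theorem norm_sum_sq_of_orthogonal {ι : Type*} (s : Finset ι) (f : ι → E)
    (h : ∀ i ∈ s, ∀ j ∈ s, i ≠ j → inner ℝ (f i) (f j) = 0) :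
    ‖∑ i ∈ s, f i‖ ^ 2 = ∑ i ∈ s, ‖f i‖ ^ 2 := by
  rw [← real_inner_self_eq_norm_sq, sum_inner]
  refine Finset.sum_congr rfl fun i hi => ?_
  rw [inner_sum, Finset.sum_eq_single_of_mem i hi fun j hj hji => h i hi j hj hji.symm,
    real_inner_self_eq_norm_sq]

variable [CompleteSpace E]
  {z : List α → ℤ → Fin p → E} {Ψ : Fin p × α → List α → Fin p → ℝ}
  {R : SeriesRep α (Fin p × α) p n} {x : ℤ → Fin n → E} {mx : α → ℤ → Fin n → E}
  {ζ : List α → ℤ → Fin p → E}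

/-- The residual of the state with respect to the past of the noise contracts along the words. -/
theorem IsNoise.residual_step [Fintype α] (h : IsState L G z Ψ R x mx)
    (hζ : IsNoise L G z R.C x ζ) (K : α → Matrix (Fin n) (Fin p) ℝ)
    (hx : ∀ t i, x (t + 1) i =
      ∑ σ, (vact (R.A σ) (mx σ t) i + vact (K σ) (innovShift z R.C mx σ t) i))
    {t : ℤ} {π π' : Fin n → E} (hπ : ∀ i, π i ∈ wordSpan ζ (nonemptyWords α) t)
    (hπ' : ∀ i, π' i ∈ wordSpan ζ (nonemptyWords α) (t + 1))
    (hd : ∀ i, ∀ f ∈ wordSpan ζ (nonemptyWords α) (t + 1), inner ℝ (x (t + 1) i - π' i) f = 0)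
    (v : Fin n → ℝ) :
    ‖combo v (x (t + 1) - π')‖ ^ 2 ≤ ∑ σ, ‖combo ((R.A σ)ᵀ *ᵥ v) (x t - π)‖ ^ 2 := by
  have hshift : ∀ σ i, ∃ m ∈ wordSpan ζ (nonemptyWords α) (t + 1), (π i, m) ∈ G σ t :=
    fun σ i => by
      obtain ⟨m, hm, -, -⟩ := (hζ.pastProducts h).exists_shift h.graph subset_rfl σ (hπ i)
      exact ⟨m, endingSpan_le ((hζ.pastProducts h).shift_mem h.graph (hπ i) hm), hm⟩
  choose m hm hmG using hshift
  -- `S` is the old residual propagated through the dynamics. It differs from the new residual by an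
  -- element of the noise past, to which the new residual is orthogonal, so the new residual is no
  -- longer than `S`.
  set S : E := ∑ σ, combo ((R.A σ)ᵀ *ᵥ v) (mx σ t - m σ) with hS
  have hxv : combo v (x (t + 1)) = ∑ σ, (combo ((R.A σ)ᵀ *ᵥ v) (mx σ t) +
      combo ((K σ)ᵀ *ᵥ v) (innovShift z R.C mx σ t)) := by
    simp only [combo, hx, Finset.smul_sum, smul_add]
    rw [Finset.sum_comm]
    refine Finset.sum_congr rfl fun σ _ => ?_
    rw [Finset.sum_add_distrib]
    have h1 := combo_vact v (R.A σ) (mx σ t)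
    have h2 := combo_vact v (K σ) (innovShift z R.C mx σ t)
    simp only [combo] at h1 h2
    rw [h1, h2]
  have hdiff : combo v (x (t + 1) - π') - S ∈ wordSpan ζ (nonemptyWords α) (t + 1) := by
    have h1 : combo v (x (t + 1) - π') - S =
        ∑ σ, (combo ((R.A σ)ᵀ *ᵥ v) (m σ) + combo ((K σ)ᵀ *ᵥ v) (ζ [σ] (t + 1))) -
          combo v π' := by
      simp only [hS, combo_sub, hxv, hζ.letter h, Finset.sum_add_distrib, Finset.sum_sub_distrib]
      abel
    rw [h1]
    exact Submodule.sub_mem _ (Submodule.sum_mem _ fun σ _ => Submodule.add_mem _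
      (combo_mem _ (hm σ)) (combo_mem _ fun j => mem_wordSpan (by simp [nonemptyWords]) j))
      (combo_mem _ hπ')
  have horth : ∀ f ∈ wordSpan ζ (nonemptyWords α) (t + 1),
      inner ℝ (combo v (x (t + 1) - π')) f = 0 := fun f hf => by
    rw [combo, sum_inner]
    refine Finset.sum_eq_zero fun i _ => ?_
    rw [real_inner_smul_left, Pi.sub_apply, hd i f hf, mul_zero]
  have hle : ‖combo v (x (t + 1) - π')‖ ^ 2 ≤ ‖S‖ ^ 2 := by
    have h1 : S = combo v (x (t + 1) - π') - (combo v (x (t + 1) - π') - S) := by abel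
    have h2 := horth _ hdiff
    conv_rhs => rw [h1, norm_sub_sq_real, h2]
    nlinarith [sq_nonneg ‖combo v (x (t + 1) - π') - S‖]
  have hpair : ∀ σ u, (combo u (x t - π), combo u (mx σ t - m σ)) ∈ G σ t := fun σ u =>
    IsShiftGraph.sum_smul_mem _ _ fun i _ => (G σ t).sub_mem (h.shift σ t i) (hmG σ i)
  have hpast : ∀ u, combo u (x t - π) ∈ wordSpan z (nonemptyWords α) t := fun u =>
    combo_mem _ fun i => Submodule.sub_mem _ (h.mem t i) (hζ.wordSpan_le_past h t (hπ i))
  refine hle.trans ?_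
  -- The summands of `S` are shifts by different letters, hence orthogonal, and no shift increases
  -- the norm.
  rw [hS, norm_sum_sq_of_orthogonal]
  · refine Finset.sum_le_sum fun σ _ => ?_
    gcongr
    exact h.past.norm_shift_le h.graph (hpast _) (hpair σ _)
  · intro σ _ σ' _ hne
    exact h.past.inner_ending_eq_zero hne (h.past.shift_mem h.graph (hpast _) (hpair σ _))
      (h.past.shift_mem h.graph (hpast _) (hpair σ' _))

/-- After `k` steps back, the residual of the projection on the noise past is bounded by a sum over
words of length `k`, with coefficients `A_wᵀ v` and uniformly bounded residuals. Square summability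
of `A_w` sends this to zero. -/
theorem IsNoise.state_mem [Fintype α] (h : IsState L G z Ψ R x mx)
    (hζ : IsNoise L G z R.C x ζ) (K : α → Matrix (Fin n) (Fin p) ℝ)
    (hx : ∀ t i, x (t + 1) i =
      ∑ σ, (vact (R.A σ) (mx σ t) i + vact (K σ) (innovShift z R.C mx σ t) i))
    (hA : ∀ i j, Summable fun w : List α => wordProd R.A w i j ^ 2) (t : ℤ) (i : Fin n) :
    x t i ∈ wordSpan ζ (nonemptyWords α) t := by
  have hcomplete : ∀ t, CompleteSpace (wordSpan ζ (nonemptyWords α) t) := fun t =>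
    isClosed_wordSpan.completeSpace_coe
  obtain ⟨π, hπ, hd⟩ : ∃ π : ℤ → Fin n → E,
      (∀ t i, π t i ∈ wordSpan ζ (nonemptyWords α) t) ∧
      ∀ t i, ∀ f ∈ wordSpan ζ (nonemptyWords α) t, inner ℝ (x t i - π t i) f = 0 :=
    ⟨fun t i => (wordSpan ζ (nonemptyWords α) t).starProjection (x t i),
      fun t i => Submodule.starProjection_apply_mem _ _,
      fun t i f hf => Submodule.starProjection_inner_eq_zero _ _ hf⟩
  have hiter : ∀ k t v, ‖combo v (x t - π t)‖ ^ 2 ≤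
      ∑ w ∈ wordsOfLength α k, ‖combo ((wordProd R.A w)ᵀ *ᵥ v) (x (t - k) - π (t - k))‖ ^ 2 := by
    intro k t v
    induction k with
    | zero => simp [sum_wordsOfLength_zero, wordProd]
    | succ k ih =>
      refine ih.trans ?_
      rw [sum_wordsOfLength_succ, Finset.sum_comm]
      refine Finset.sum_le_sum fun w _ => ?_
      obtain ⟨s, hs, hs'⟩ : ∃ s : ℤ, t - k = s + 1 ∧ t - (k + 1 : ℕ) = s :=
        ⟨t - k - 1, by ring, by push_cast; ring⟩
      rw [hs, hs']
      refine (hζ.residual_step h K hx (hπ s) (hπ (s + 1)) (hd (s + 1)) _).trans (le_of_eq ?_)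
      refine Finset.sum_congr rfl fun σ _ => ?_
      rw [Matrix.mulVec_mulVec, ← Matrix.transpose_mul]
      rfl
  have hres : ∀ s i, ‖x s i - π s i‖ ≤ ‖x 0 i‖ := by
    intro s i
    have h1 := congrFun (congrFun (h.gram_x_const s 0) i) i
    rw [gram_apply, gram_apply, real_inner_self_eq_norm_sq, real_inner_self_eq_norm_sq] at h1
    have h2 : ‖x s i‖ = ‖x 0 i‖ := (sq_eq_sq₀ (norm_nonneg _) (norm_nonneg _)).1 h1
    have h3 : ‖x s i‖ ^ 2 = ‖x s i - π s i‖ ^ 2 + ‖π s i‖ ^ 2 := by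
      have h4 := hd s i _ (hπ s i)
      conv_lhs => rw [show x s i = (x s i - π s i) + π s i by abel, norm_add_sq_real, h4]
      ring
    rw [← h2]
    refine abs_le_of_sq_le_sq' ?_ (norm_nonneg _) |>.2
    nlinarith [sq_nonneg ‖π s i‖]
  have hzero : ∀ v, combo v (x t - π t) = 0 := by
    intro v
    have hsum : Summable fun w : List α =>
        (∑ j, ((wordProd R.A w)ᵀ *ᵥ v) j ^ 2) * ∑ i, ‖x 0 i‖ ^ 2 := by
      refine Summable.mul_right _ (summable_sum fun j _ => ?_)
      have h1 : ∀ w, ((wordProd R.A w)ᵀ *ᵥ v) j = ∑ l, v l * wordProd R.A w l j := fun w => by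
        simp only [Matrix.mulVec, dotProduct, Matrix.transpose_apply, mul_comm]
      simp only [h1]
      exact summable_sq_sum _ fun l _ => summable_sq_const_mul (v l) (hA l j)
    have hlim := tendsto_sum_wordsOfLength hsum
    have hle : ‖combo v (x t - π t)‖ ^ 2 ≤ 0 := ge_of_tendsto' hlim fun k => by
      refine (hiter k t v).trans (Finset.sum_le_sum fun w _ => (norm_combo_sq_le _ _).trans ?_)
      exact mul_le_mul_of_nonneg_left
        (Finset.sum_le_sum fun i _ => pow_le_pow_left₀ (norm_nonneg _) (hres _ i) 2)
        (Finset.sum_nonneg fun _ _ => sq_nonneg _)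
    exact norm_eq_zero.1 (pow_eq_zero_iff two_ne_zero |>.1 (le_antisymm hle (sq_nonneg _)))
  classical
  have := hzero (Pi.single i 1)
  simp only [combo, Pi.single_apply, ite_smul, one_smul, zero_smul, Finset.sum_ite_eq',
    Finset.mem_univ, if_true, Pi.sub_apply, sub_eq_zero] at this
  rw [this]
  exact hπ t i

end Noise

/-! ### Products of processes along concatenated words. -/

section Words

variable {Ω α : Type*} {ρ : α → ℝ} {u : α → ℤ → Ω → ℝ} {k : ℕ}

theorem uWord_append (u : α → ℤ → Ω → ℝ) (v w : List α) (t : ℤ) (ω : Ω) :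
    uWord u (v ++ w) t ω = uWord u v (t - w.length) ω * uWord u w t ω := by
  induction v with
  | nil => simp [uWord]
  | cons σ v ih =>
    simp only [List.cons_append, uWord, ih, List.length_append]
    rw [mul_assoc]
    congr 2
    push_cast
    ring

theorem weight_append (ρ : α → ℝ) (v w : List α) :
    weight ρ (v ++ w) = weight ρ v * weight ρ w := by
  simp [weight]

theorem weight_singleton (ρ : α → ℝ) (σ : α) : weight ρ [σ] = ρ σ := by
  simp [weight]

theorem weight_pos (hρ : ∀ σ, 0 < ρ σ) (w : List α) : 0 < weight ρ w := by
  induction w with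
  | nil => simp [weight]
  | cons σ w ih => simpa [weight] using mul_pos (hρ σ) ih

theorem zPast_nil (r : ℤ → Ω → Fin k → ℝ) (t : ℤ) : zPast ρ u r [] t = r t := by
  ext ω i
  simp [zPast, uWord, weight]

/-- Moving the inputs from the future factor to the past one exhibits the product as one of two
functions that are square integrable under RC, though the future factor alone need not be. -/
theorem zFuture_mul_zPast (hρ : ∀ σ, 0 < ρ σ) (r : ℤ → Ω → Fin k → ℝ) (v w : List α) (t : ℤ)
    (ω : Ω) (i j : Fin k) :
    zFuture ρ u r w t ω i * zPast ρ u r v t ω j =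
      r (t + w.length) ω i * zPast ρ u r (v ++ w) (t + w.length) ω j := by
  simp only [zFuture, zPast, uWord_append, weight_append, List.length_append,
    Real.sqrt_mul (weight_pos hρ v).le]
  rw [show t + (w.length : ℤ) - ((v.length + w.length : ℕ) : ℤ) = t - v.length by
    push_cast; ring, show t + (w.length : ℤ) - 1 - w.length = t - 1 by ring]
  ring

theorem zPast_snoc (hρ : ∀ σ, 0 < ρ σ) (r : ℤ → Ω → Fin k → ℝ) (w : List α) (σ : α) (t : ℤ)
    (ω : Ω) (i : Fin k) :
    zPast ρ u r (w ++ [σ]) (t + 1) ω i = zPast ρ u r w t ω i * (u σ t ω * (1 / √(ρ σ))) := by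
  simp only [zPast, uWord_append, weight_append, List.length_append,
    Real.sqrt_mul (weight_pos hρ w).le, uWord, weight_singleton, List.length_cons,
    List.length_nil, mul_one]
  rw [show t + 1 - ((w.length + (0 + 1) : ℕ) : ℤ) = t - w.length by push_cast; ring,
    show t + 1 - 1 - ((0 + 1 : ℕ) : ℤ) = t - 1 by push_cast; ring,
    show t + 1 - 1 - ((0 : ℕ) : ℤ) = t by push_cast; ring]
  ring

end Words

/-! ### Transfer between random variables and `L²`. -/

section Probability

open Filter Topology

variable {Ω : Type*} [MeasurableSpace Ω] {P : Measure Ω} {α : Type*}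

open Classical in
/-- The class in `L²` of a square integrable function. -/
noncomputable def lp (P : Measure Ω) (f : Ω → ℝ) : Lp ℝ 2 P :=
  if h : MemLp f 2 P then h.toLp f else 0

theorem coeFn_lp {f : Ω → ℝ} (h : MemLp f 2 P) : (lp P f : Ω → ℝ) =ᵐ[P] f := by
  rw [lp, dif_pos h]
  exact h.coeFn_toLp

theorem lp_eq {f : Ω → ℝ} {g : Lp ℝ 2 P} (h : (g : Ω → ℝ) =ᵐ[P] f) : lp P f = g := by
  have hf : MemLp f 2 P := (memLp_congr_ae h).1 (Lp.memLp g)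
  exact Lp.ext ((coeFn_lp hf).trans h.symm)

theorem inner_lp {f g : Ω → ℝ} (hf : MemLp f 2 P) (hg : MemLp g 2 P) :
    inner ℝ (lp P f) (lp P g) = ∫ ω, f ω * g ω ∂P := by
  rw [L2.inner_def]
  refine integral_congr_ae ?_
  filter_upwards [coeFn_lp hf, coeFn_lp hg] with ω h1 h2
  rw [h1, h2]
  simp [mul_comm]

theorem memLp_of_ae_eq {f : Ω → ℝ} {g : Lp ℝ 2 P} (h : f =ᵐ[P] (g : Ω → ℝ)) : MemLp f 2 P :=
  (memLp_congr_ae h).2 (Lp.memLp g)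

/-- The graph of the multiplication by a function. -/
def mulGraph (P : Measure Ω) (m : Ω → ℝ) : Submodule ℝ (Lp ℝ 2 P × Lp ℝ 2 P) where
  carrier := {q | (q.2 : Ω → ℝ) =ᵐ[P] fun ω => (q.1 : Ω → ℝ) ω * m ω}
  add_mem' := by
    intro a b ha hb
    simp only [Set.mem_ofPred_eq, Prod.fst_add, Prod.snd_add] at *
    filter_upwards [ha, hb, Lp.coeFn_add a.1 b.1, Lp.coeFn_add a.2 b.2] with ω h1 h2 h3 h4
    rw [h3, h4, Pi.add_apply, Pi.add_apply, h1, h2]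
    ring
  zero_mem' := by
    simp only [Set.mem_ofPred_eq, Prod.fst_zero, Prod.snd_zero]
    filter_upwards [Lp.coeFn_zero ℝ 2 P] with ω h1
    rw [h1]
    simp
  smul_mem' := by
    intro c a ha
    simp only [Set.mem_ofPred_eq, Prod.smul_fst, Prod.smul_snd] at *
    filter_upwards [ha, Lp.coeFn_smul c a.1, Lp.coeFn_smul c a.2] with ω h1 h3 h4
    rw [h3, h4, Pi.smul_apply, Pi.smul_apply, h1]
    simp [mul_assoc]

theorem mem_mulGraph {m : Ω → ℝ} {f g : Lp ℝ 2 P} :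
    (f, g) ∈ mulGraph P m ↔ (g : Ω → ℝ) =ᵐ[P] fun ω => (f : Ω → ℝ) ω * m ω := Iff.rfl

theorem lp_mem_mulGraph {m f g : Ω → ℝ} (hf : MemLp f 2 P) (hg : MemLp g 2 P)
    (h : ∀ ω, g ω = f ω * m ω) : (lp P f, lp P g) ∈ mulGraph P m := by
  rw [mem_mulGraph]
  filter_upwards [coeFn_lp hf, coeFn_lp hg] with ω h1 h2
  rw [h1, h2, h]

theorem exists_subseq_ae_tendsto {f : ℕ → Lp ℝ 2 P} {g : Lp ℝ 2 P} (h : Tendsto f atTop (𝓝 g)) :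
    ∃ φ : ℕ → ℕ, StrictMono φ ∧
      ∀ᵐ ω ∂P, Tendsto (fun k => (f (φ k) : Ω → ℝ) ω) atTop (𝓝 ((g : Ω → ℝ) ω)) :=
  (tendstoInMeasure_of_tendsto_Lp h).exists_seq_tendsto_ae

/-- Convergence in `L²` gives almost sure convergence along a subsequence, and multiplication by `m
ω` is continuous at each point; no bound on `m` enters. -/
theorem isClosed_mulGraph (m : Ω → ℝ) :
    IsClosed (mulGraph P m : Set (Lp ℝ 2 P × Lp ℝ 2 P)) := by
  refine IsSeqClosed.isClosed fun s a hs ha => ?_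
  have h1 : Tendsto (fun k => (s k).1) atTop (𝓝 a.1) := (continuous_fst.tendsto a).comp ha
  have h2 : Tendsto (fun k => (s k).2) atTop (𝓝 a.2) := (continuous_snd.tendsto a).comp ha
  obtain ⟨φ, hφ, h3⟩ := exists_subseq_ae_tendsto h1
  obtain ⟨ψ, hψ, h4⟩ := exists_subseq_ae_tendsto (h2.comp hφ.tendsto_atTop)
  have h5 : ∀ᵐ ω ∂P, ∀ k, ((s k).2 : Ω → ℝ) ω = ((s k).1 : Ω → ℝ) ω * m ω :=
    ae_all_iff.2 fun k => hs k
  change (a.2 : Ω → ℝ) =ᵐ[P] fun ω => (a.1 : Ω → ℝ) ω * m ω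
  filter_upwards [h3, h4, h5] with ω h3 h4 h5
  refine tendsto_nhds_unique h4 ?_
  have := (h3.comp hψ.tendsto_atTop).mul_const (m ω)
  refine this.congr fun k => ?_
  exact (h5 _).symm

/-- The graphs of the multiplications by the normalized inputs. -/
noncomputable def inputGraph (P : Measure Ω) (ρ : α → ℝ) (u : α → ℤ → Ω → ℝ) (σ : α) (t : ℤ) :
    Submodule ℝ (Lp ℝ 2 P × Lp ℝ 2 P) :=
  mulGraph P fun ω => u σ t ω * (1 / √(ρ σ))

theorem isShiftGraph_inputGraph (ρ : α → ℝ) (u : α → ℤ → Ω → ℝ) :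
    IsShiftGraph (inputGraph P ρ u) where
  isClosed _ _ := isClosed_mulGraph _
  functional σ t f h := by
    refine Lp.ext ?_
    filter_upwards [mem_mulGraph.1 h, Lp.coeFn_zero ℝ 2 P] with ω h1 h2
    rw [h1, h2]
    simp

variable {ρ : α → ℝ} {u : α → ℤ → Ω → ℝ} {k : ℕ} {r : ℤ → Ω → Fin k → ℝ}

/-- The entries of the products of a process with past inputs, as elements of `L²`. -/
noncomputable def zlp (P : Measure Ω) (ρ : α → ℝ) (u : α → ℤ → Ω → ℝ) {k : ℕ}
    (r : ℤ → Ω → Fin k → ℝ) (w : List α) (t : ℤ) (i : Fin k) : Lp ℝ 2 P :=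
  lp P fun ω => zPast ρ u r w t ω i

theorem zlp_nil (r : ℤ → Ω → Fin k → ℝ) (t : ℤ) (i : Fin k) :
    zlp P ρ u r [] t i = lp P fun ω => r t ω i := by
  rw [zlp, zPast_nil]

/-- All products of the process with past inputs are square integrable. -/
def MemLpPast (P : Measure Ω) (ρ : α → ℝ) (u : α → ℤ → Ω → ℝ) {k : ℕ}
    (r : ℤ → Ω → Fin k → ℝ) : Prop :=
  ∀ w t i, MemLp (fun ω => zPast ρ u r w t ω i) 2 P

theorem inner_zlp (hr : MemLpPast P ρ u r) (w v : List α) (t s : ℤ) (i j : Fin k) :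
    inner ℝ (zlp P ρ u r w t i) (zlp P ρ u r v s j) =
      crossCov P (zPast ρ u r w t) (zPast ρ u r v s) i j :=
  inner_lp (hr w t i) (hr v s j)

theorem MemLpPast.step (hr : MemLpPast P ρ u r) (hρ : ∀ σ, 0 < ρ σ) (w : List α) (t : ℤ)
    (i : Fin k) (σ : α) :
    (zlp P ρ u r w t i, zlp P ρ u r (w ++ [σ]) (t + 1) i) ∈ inputGraph P ρ u σ t :=
  lp_mem_mulGraph (hr w t i) (hr _ _ i) fun ω => zPast_snoc hρ r w σ t ω i

theorem zlp_eq_zero {L : Set (List α)} (hL : IsAdmissible P u L) (r : ℤ → Ω → Fin k → ℝ)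
    {w : List α} (hw : w ≠ []) (hwL : w ∉ L) (t : ℤ) (i : Fin k) : zlp P ρ u r w t i = 0 := by
  refine lp_eq ?_
  filter_upwards [hL.ae_zero w hw hwL (t - 1), Lp.coeFn_zero ℝ 2 P] with ω h1 h2
  rw [h2, zPast, h1]
  simp

theorem IsAdmissible.isSnocAdmissible {L : Set (List α)} (hL : IsAdmissible P u L) :
    IsSnocAdmissible L := by
  intro w τ σ
  obtain ⟨S, hS⟩ := hL.exists_step
  have h2 : [τ, σ] ∈ L ↔ S τ σ := by rw [hS _ (by simp)]; simp
  rw [h2, hS _ (by simp)]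
  have h3 : ((w ++ [τ]) ++ [σ]).IsChain S ↔ (w ++ [τ]).IsChain S ∧ S τ σ := by
    rw [List.isChain_append]
    simp
  rw [h3]
  -- The chain criterion covers only words of length above one; a single letter is admissible by a
  -- separate axiom.
  rcases eq_or_ne w [] with rfl | hw
  · simp [hL.letter_mem]
  · rw [hS (w ++ [τ]) (by simp [List.length_pos_iff.2 hw])]

theorem IsRC.memLpPast {L : Set (List α)} (hr : IsRC P ρ u L r) : MemLpPast P ρ u r := by
  intro w t i
  by_cases hw : w = []
  · subst hw
    simpa only [zPast_nil] using hr.memLp t i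
  · exact hr.memLp_z w hw t i

theorem IsRC.crossCov_eq {L : Set (List α)} (hr : IsRC P ρ u L r) (w v : List α) (hv : v ≠ [])
    (t s : ℤ) : crossCov P (zPast ρ u r w t) (zPast ρ u r v t) =
      crossCov P (zPast ρ u r w s) (zPast ρ u r v s) := by
  have key : ∀ t, crossCov P (zPast ρ u r w t) (zPast ρ u r v t) =
      crossCov P (zPast ρ u r w 0) (zPast ρ u r v 0) := by
    intro t
    by_cases hw : w = []
    · subst hw
      simpa only [zPast_nil, zero_add] using hr.stationary v hv 0 t
    · simpa only [zero_add] using hr.stationary_z w v hw hv 0 t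
  rw [key t, key s]

theorem crossCov_apply_comm {l : ℕ} (f : Ω → Fin k → ℝ) (g : Ω → Fin l → ℝ) (i : Fin k)
    (j : Fin l) : crossCov P f g i j = crossCov P g f j i := by
  simp only [crossCov, Matrix.of_apply, mul_comm]

/-- Allowing the empty word, with `z_ε = r`, merges the conditions on one-letter words with those on
longer ones: the isometry for `v = []` is the relation between `T` and `Λ`. -/
theorem IsRC.pastProducts {L : Set (List α)} (hρ : ∀ σ, 0 < ρ σ) (hL : IsAdmissible P u L)
    (hr : IsRC P ρ u L r) : PastProducts L (inputGraph P ρ u) (zlp P ρ u r) where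
  step := hr.memLpPast.step hρ
  zero _ hw hwL t i := zlp_eq_zero hL r hw hwL t i
  stationary w v hv t s i j := by
    rw [inner_zlp hr.memLpPast, inner_zlp hr.memLpPast, hr.crossCov_eq w v hv t s]
  orth w v σ σ' hne t i j := by
    rw [inner_zlp hr.memLpPast, hr.crossCov_eq _ _ (by simp) t 0]
    by_cases hw : w = [] <;> by_cases hv : v = []
    · subst hw hv
      exact congrFun (congrFun (hr.letter_ne σ σ' hne) i) j
    · subst hw
      rw [crossCov_apply_comm]
      exact congrFun (congrFun (hr.snoc_letter_ne v hv σ' σ hne.symm) j) i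
    · subst hv
      exact congrFun (congrFun (hr.snoc_letter_ne w hw σ σ' hne) i) j
    · exact congrFun (congrFun (hr.snoc_ne w v hw hv σ σ' hne) i) j
  iso w v σ hw hwL t i j := by
    rw [inner_zlp hr.memLpPast, hr.crossCov_eq _ _ (by simp) (t + 1) 0]
    by_cases hv : v = []
    · subst hv
      rw [real_inner_comm, inner_zlp hr.memLpPast, hr.crossCov_eq _ _ hw t 0, zPast_nil]
      exact congrFun (congrFun (hr.snoc_letter_eq w hw σ hwL) i) j
    · rw [inner_zlp hr.memLpPast, hr.crossCov_eq _ _ hv t 0]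
      exact congrFun (congrFun (hr.snoc_eq w v hw hv σ (Or.inl hwL)) i) j

theorem isRC_of_pastProducts {L : Set (List α)} (hr : MemLpPast P ρ u r)
    (hmean : ∀ w t i, ∫ ω, zPast ρ u r w t ω i ∂P = 0)
    (hp : PastProducts L (inputGraph P ρ u) (zlp P ρ u r)) : IsRC P ρ u L r := by
  have hT : ∀ w v t i j, crossCov P (zPast ρ u r w t) (zPast ρ u r v t) i j =
      inner ℝ (zlp P ρ u r w t i) (zlp P ρ u r v t j) := fun w v t i j =>
    (inner_zlp hr w v t t i j).symm
  have hiso : ∀ w v : List α, w ≠ [] → v ≠ [] → ∀ σ, w ++ [σ] ∈ L → ∀ i j,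
      inner ℝ (zlp P ρ u r (w ++ [σ]) 0 i) (zlp P ρ u r (v ++ [σ]) 0 j) =
        inner ℝ (zlp P ρ u r w 0 i) (zlp P ρ u r v 0 j) := fun w v hw hv σ hL i j => by
    rw [hp.stationary _ _ (by simp) 0 (0 + 1), hp.iso w v σ hw hL]
  -- The covariance of `z_w` and `z_v` equals that of `z_{wσ}` and `z_{vσ}`, and the latter product
  -- is zero.
  have hmixed : ∀ w v : List α, w ≠ [] → v ≠ [] → ∀ σ : α, w ++ [σ] ∈ L → v ++ [σ] ∉ L →
      covT P ρ u r v w = 0 := fun w v hw hv σ hwL hvL => by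
    ext i j
    rw [covT, hT, real_inner_comm, ← hiso w v hw hv σ hwL, hp.zero _ (by simp) hvL,
      inner_zero_right, Matrix.zero_apply]
  refine ⟨fun t i => ?_, fun w _ t i => hr w t i, fun t i => ?_, fun w _ t i => hmean w t i,
    fun w hw t s => ?_, fun w v hw hv t s => ?_, fun σ σ' hne => ?_, fun w v hw hv σ hL => ?_,
    fun w v hw hv σ σ' hne => ?_, fun w hw σ hL => ?_, fun w hw σ σ' hne => ?_,
    fun w v hw hv hL => ?_, hmixed, fun w v hw hv σ h1 h2 => ?_⟩
  · simpa only [zPast_nil] using hr [] t i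
  · simpa only [zPast_nil] using hmean [] t i
  · ext i j
    have := hp.stationary [] w hw (t + s) t i j
    rw [← hT, ← hT] at this
    simpa only [zPast_nil] using this
  · ext i j
    rw [hT, hT]
    exact hp.stationary w v hv _ _ i j
  · ext i j
    rw [covT, hT]
    exact hp.orth [] [] σ σ' hne 0 i j
  · ext i j
    rw [covT, covT, hT, hT]
    rcases hL with hL | hL
    · exact hiso w v hw hv σ hL i j
    · rw [real_inner_comm, hiso v w hv hw σ hL, real_inner_comm]
  · ext i j
    rw [covT, hT]
    exact hp.orth w v σ σ' hne 0 i j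
  · ext i j
    have h1 := hT [] w 0 j i
    rw [zPast_nil] at h1
    rw [covT, hT, hp.stationary _ _ (by simp) 0 (0 + 1), Matrix.transpose_apply, covΛ, h1,
      real_inner_comm (zlp P ρ u r w 0 i)]
    exact hp.iso w [] σ hw hL 0 i j
  · ext i j
    rw [covT, hT]
    exact hp.orth w [] σ σ' hne 0 i j
  · ext i j
    rw [covT, hT]
    rcases hL with hL | hL
    · rw [hp.zero w hw hL, inner_zero_left, Matrix.zero_apply]
    · rw [hp.zero v hv hL, inner_zero_right, Matrix.zero_apply]
  · ext i j
    rw [covT, crossCov_apply_comm]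
    exact congrFun (congrFun (hmixed v w hv hw σ h1 h2) j) i

theorem hilbertSpan_pastFamily (hr : MemLpPast P ρ u r) (t : ℤ) :
    hilbertSpan P (pastFamily ρ u r t) = wordSpan (zlp P ρ u r) (nonemptyWords α) t := by
  have : {f : Lp ℝ 2 P | ∃ a i, (f : Ω → ℝ) =ᵐ[P] fun ω => pastFamily ρ u r t a ω i} =
      Set.range (restrWords (zlp P ρ u r) (nonemptyWords α) t) := by
    ext f
    constructor
    · rintro ⟨a, i, h⟩
      exact ⟨(a, i), lp_eq h⟩
    · rintro ⟨⟨a, i⟩, rfl⟩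
      exact ⟨a, i, coeFn_lp (hr a.1 t i)⟩
  rw [hilbertSpan, this]
  rfl

theorem inHilbertSpan_pastFamily (hr : MemLpPast P ρ u r) (t : ℤ) {l : ℕ}
    {x : Ω → Fin l → ℝ} : InHilbertSpan P (pastFamily ρ u r t) x ↔
      ∀ i, MemLp (fun ω => x ω i) 2 P ∧
        lp P (fun ω => x ω i) ∈ wordSpan (zlp P ρ u r) (nonemptyWords α) t := by
  rw [InHilbertSpan, hilbertSpan_pastFamily hr]
  refine forall_congr' fun i => ⟨?_, ?_⟩
  · rintro ⟨f, hf, hx⟩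
    rw [lp_eq hx.symm]
    exact ⟨memLp_of_ae_eq hx, hf⟩
  · rintro ⟨h1, h2⟩
    exact ⟨_, h2, (coeFn_lp h1).symm⟩

/-- Only the products of `f` with the past need be integrable; this is what lets it apply to the
future vector. -/
theorem isLinProj_pastFamily (hr : MemLpPast P ρ u r) (t : ℤ) {l : ℕ} {f x : Ω → Fin l → ℝ}
    (hf : ∀ w, w ≠ [] → ∀ i j, Integrable (fun ω => f ω i * zPast ρ u r w t ω j) P) :
    IsLinProj P (pastFamily ρ u r t) f x ↔
      ∀ i, MemLp (fun ω => x ω i) 2 P ∧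
        lp P (fun ω => x ω i) ∈ wordSpan (zlp P ρ u r) (nonemptyWords α) t ∧
        ∀ w, w ≠ [] → ∀ j, inner ℝ (lp P fun ω => x ω i) (zlp P ρ u r w t j) =
          ∫ ω, f ω i * zPast ρ u r w t ω j ∂P := by
  rw [IsLinProj, inHilbertSpan_pastFamily hr]
  have key : ∀ i, MemLp (fun ω => x ω i) 2 P → ∀ w, w ≠ [] → ∀ j,
      (Integrable (fun ω => (f ω i - x ω i) * zPast ρ u r w t ω j) P ∧
        ∫ ω, (f ω i - x ω i) * zPast ρ u r w t ω j ∂P = 0) ↔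
      inner ℝ (lp P fun ω => x ω i) (zlp P ρ u r w t j) =
          ∫ ω, f ω i * zPast ρ u r w t ω j ∂P := by
    intro i hx w hw j
    have h1 : Integrable (fun ω => x ω i * zPast ρ u r w t ω j) P :=
      hx.integrable_mul (hr w t j)
    rw [zlp, inner_lp hx (hr w t j)]
    simp only [sub_mul]
    rw [integral_sub (hf w hw i j) h1, sub_eq_zero]
    exact ⟨fun h => h.2.symm, fun h => ⟨(hf w hw i j).sub h1, h.symm⟩⟩
  constructor
  · rintro ⟨h1, h2⟩ i
    exact ⟨(h1 i).1, (h1 i).2, fun w hw j => (key i (h1 i).1 w hw j).1 (h2 ⟨w, hw⟩ i j)⟩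
  · intro h
    exact ⟨fun i => ⟨(h i).1, (h i).2.1⟩, fun a i j =>
      (key i (h i).1 a.1 a.2 j).2 ((h i).2.2 a.1 a.2 j)⟩

end Probability

section LpAlgebra

variable {Ω : Type*} [MeasurableSpace Ω] {P : Measure Ω}

theorem ae_eq_of_lp_eq {f g : Ω → ℝ} (hf : MemLp f 2 P) (hg : MemLp g 2 P)
    (h : lp P f = lp P g) : f =ᵐ[P] g :=
  (coeFn_lp hf).symm.trans (by rw [h]; exact coeFn_lp hg)

theorem lp_add {f g : Ω → ℝ} (hf : MemLp f 2 P) (hg : MemLp g 2 P) :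
    lp P (fun ω => f ω + g ω) = lp P f + lp P g := by
  refine lp_eq ?_
  filter_upwards [Lp.coeFn_add (lp P f) (lp P g), coeFn_lp hf, coeFn_lp hg] with ω h1 h2 h3
  rw [h1, Pi.add_apply, h2, h3]

theorem lp_sub {f g : Ω → ℝ} (hf : MemLp f 2 P) (hg : MemLp g 2 P) :
    lp P (fun ω => f ω - g ω) = lp P f - lp P g := by
  refine lp_eq ?_
  filter_upwards [Lp.coeFn_sub (lp P f) (lp P g), coeFn_lp hf, coeFn_lp hg] with ω h1 h2 h3
  rw [h1, Pi.sub_apply, h2, h3]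

theorem lp_const_mul {f : Ω → ℝ} (hf : MemLp f 2 P) (c : ℝ) :
    lp P (fun ω => c * f ω) = c • lp P f := by
  refine lp_eq ?_
  filter_upwards [Lp.coeFn_smul c (lp P f), coeFn_lp hf] with ω h1 h2
  rw [h1, Pi.smul_apply, h2, smul_eq_mul]

theorem lp_sum {ι : Type*} (s : Finset ι) {f : ι → Ω → ℝ} (hf : ∀ a ∈ s, MemLp (f a) 2 P) :
    lp P (fun ω => ∑ a ∈ s, f a ω) = ∑ a ∈ s, lp P (f a) := by
  classical
  induction s using Finset.induction_on with
  | empty =>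
    refine lp_eq ?_
    simp only [Finset.sum_empty]
    exact Lp.coeFn_zero ℝ 2 P
  | insert a s ha ih =>
    simp only [Finset.sum_insert ha]
    rw [lp_add (hf a (by simp)) (memLp_finsetSum s fun b hb => hf b (by simp [hb])),
      ih fun b hb => hf b (by simp [hb])]

theorem memLp_mulVec {k l : ℕ} (M : Matrix (Fin k) (Fin l) ℝ) {f : Ω → Fin l → ℝ}
    (hf : ∀ j, MemLp (fun ω => f ω j) 2 P) (i : Fin k) : MemLp (fun ω => (M *ᵥ f ω) i) 2 P := by
  simp only [Matrix.mulVec, dotProduct]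
  exact memLp_finsetSum _ fun j _ => (hf j).const_mul (M i j)

theorem lp_mulVec {k l : ℕ} (M : Matrix (Fin k) (Fin l) ℝ) {f : Ω → Fin l → ℝ}
    (hf : ∀ j, MemLp (fun ω => f ω j) 2 P) (i : Fin k) :
    lp P (fun ω => (M *ᵥ f ω) i) = vact M (fun j => lp P fun ω => f ω j) i := by
  simp only [Matrix.mulVec, dotProduct, vact]
  rw [lp_sum _ fun j _ => (hf j).const_mul (M i j)]
  exact Finset.sum_congr rfl fun j _ => lp_const_mul (hf j) _

theorem lp_mul_of_mem_mulGraph {m f : Ω → ℝ} {g : Lp ℝ 2 P} (hf : MemLp f 2 P)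
    (h : (lp P f, g) ∈ mulGraph P m) :
    MemLp (fun ω => f ω * m ω) 2 P ∧ lp P (fun ω => f ω * m ω) = g := by
  have : (g : Ω → ℝ) =ᵐ[P] fun ω => f ω * m ω := by
    filter_upwards [mem_mulGraph.1 h, coeFn_lp hf] with ω h1 h2
    rw [h1, h2]
  exact ⟨memLp_of_ae_eq this.symm, lp_eq this⟩

/-- The entries of a process, as elements of `L²`. -/
noncomputable def vlp (P : Measure Ω) {k : ℕ} (r : ℤ → Ω → Fin k → ℝ) (t : ℤ) (i : Fin k) :
    Lp ℝ 2 P :=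
  lp P fun ω => r t ω i

end LpAlgebra

/-! ### Existence and characterization of the projected state and of the innovation. -/

section Construction

variable {Ω : Type*} [MeasurableSpace Ω] {P : Measure Ω} {α : Type*} {ρ : α → ℝ}
  {u : α → ℤ → Ω → ℝ} {L : Set (List α)} {p n : ℕ} {y : ℤ → Ω → Fin p → ℝ}

theorem integral_zFuture_mul_zPast (hρ : ∀ σ, 0 < ρ σ) (hy : MemLpPast P ρ u y) (v w : List α)
    (t : ℤ) (i j : Fin p) :
    Integrable (fun ω => zFuture ρ u y w t ω i * zPast ρ u y v t ω j) P ∧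
      ∫ ω, zFuture ρ u y w t ω i * zPast ρ u y v t ω j ∂P =
        inner ℝ (zlp P ρ u y [] (t + w.length) i) (zlp P ρ u y (v ++ w) (t + w.length) j) := by
  have h0 := hy [] (t + w.length) i
  have h1 := hy (v ++ w) (t + w.length) j
  simp only [zFuture_mul_zPast hρ]
  rw [zlp, zlp, inner_lp h0 h1]
  simp only [zPast_nil] at h0 ⊢
  exact ⟨h0.integrable_mul h1, trivial⟩

theorem output_cov (hr : IsRC P ρ u L y) (t : ℤ) (σ : α) (v : List α) (i j : Fin p) :
    inner ℝ (zlp P ρ u y [] t i) (zlp P ρ u y (σ :: v) t j) =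
      outputFamily P ρ u y (j, σ) v i := by
  rw [inner_zlp hr.memLpPast, hr.crossCov_eq _ _ (by simp) t 0, zPast_nil]
  rfl

/-- The block `w` of the future vector has covariance `C A_w A_v B_{(j,σ)}` with `z_{σv}`, so the
stacked covariance is the observability matrix applied to `A_v B_{(j,σ)}`, and any left inverse
removes it. -/
theorem integral_futureVector_mul_zPast [Finite α] (hρ : ∀ σ, 0 < ρ σ) (hr : IsRC P ρ u L y)
    {R : SeriesRep α (Fin p × α) p n} (hR : R.Represents (outputFamily P ρ u y))
    {Oinv : Matrix (Fin n) (ShortWord α n × Fin p) ℝ} (hO : Oinv * R.obsMatrix = 1) (t : ℤ)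
    (σ : α) (v : List α) (i : Fin n) (j : Fin p) :
    Integrable (fun ω => (Oinv *ᵥ futureVector ρ u y n t ω) i * zPast ρ u y (σ :: v) t ω j) P ∧
      ∫ ω, (Oinv *ᵥ futureVector ρ u y n t ω) i * zPast ρ u y (σ :: v) t ω j ∂P =
        (wordProd R.A v *ᵥ R.B (j, σ)) i := by
  have key := fun a : ShortWord α n × Fin p =>
    integral_zFuture_mul_zPast hρ hr.memLpPast (σ :: v) a.1.1 t a.2 j
  have h1 : ∀ ω, (Oinv *ᵥ futureVector ρ u y n t ω) i * zPast ρ u y (σ :: v) t ω j =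
      ∑ a, Oinv i a * (zFuture ρ u y a.1.1 t ω a.2 * zPast ρ u y (σ :: v) t ω j) := fun ω => by
    simp only [Matrix.mulVec, dotProduct, Finset.sum_mul, mul_assoc, futureVector]
  simp only [h1]
  refine ⟨integrable_finsetSum _ fun a _ => (key a).1.const_mul _, ?_⟩
  rw [integral_finsetSum _ fun a _ => (key a).1.const_mul _]
  simp only [integral_const_mul, (key _).2, List.cons_append, output_cov hr]
  have h2 : wordProd R.A v *ᵥ R.B (j, σ) =
      Oinv *ᵥ (R.obsMatrix *ᵥ (wordProd R.A v *ᵥ R.B (j, σ))) := by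
    rw [Matrix.mulVec_mulVec _ Oinv, hO, Matrix.one_mulVec]
  rw [h2]
  refine Finset.sum_congr rfl fun a _ => ?_
  rw [SeriesRep.obsMatrix_mulVec, hR, wordProd_append, Matrix.mulVec_mulVec, Matrix.mul_assoc]

theorem isProjectedState_iff [Finite α] (hρ : ∀ σ, 0 < ρ σ) (hr : IsRC P ρ u L y)
    {R : SeriesRep α (Fin p × α) p n} (hR : R.Represents (outputFamily P ρ u y))
    {Oinv : Matrix (Fin n) (ShortWord α n × Fin p) ℝ} (hO : Oinv * R.obsMatrix = 1)
    (x : ℤ → Ω → Fin n → ℝ) :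
    IsProjectedState P ρ u y Oinv x ↔ ∀ t i, MemLp (fun ω => x t ω i) 2 P ∧
      vlp P x t i ∈ wordSpan (zlp P ρ u y) (nonemptyWords α) t ∧
      ∀ σ v j, inner ℝ (vlp P x t i) (zlp P ρ u y (σ :: v) t j) =
        (wordProd R.A v *ᵥ R.B (j, σ)) i := by
  refine forall_congr' fun t => ?_
  rw [isLinProj_pastFamily hr.memLpPast t]
  · refine forall_congr' fun i => and_congr_right fun _ => and_congr_right fun _ => ⟨?_, ?_⟩
    · intro h σ v j
      rw [← (integral_futureVector_mul_zPast hρ hr hR hO t σ v i j).2]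
      exact h (σ :: v) (by simp) j
    · intro h w hw j
      obtain ⟨σ, v, rfl⟩ := List.exists_cons_of_ne_nil hw
      rw [(integral_futureVector_mul_zPast hρ hr hR hO t σ v i j).2]
      exact h σ v j
  · intro w hw i j
    obtain ⟨σ, v, rfl⟩ := List.exists_cons_of_ne_nil hw
    exact (integral_futureVector_mul_zPast hρ hr hR hO t σ v i j).1

theorem exists_isProjectedState [Finite α] (hρ : ∀ σ, 0 < ρ σ) (hL : IsAdmissible P u L)
    (hr : IsRC P ρ u L y)
    {R : SeriesRep α (Fin p × α) p n} (hR : R.Represents (outputFamily P ρ u y))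
    {Oinv : Matrix (Fin n) (ShortWord α n × Fin p) ℝ} (hO : Oinv * R.obsMatrix = 1) :
    ∃ x, IsProjectedState P ρ u y Oinv x := by
  have hq := fun (t : ℤ) (a : ShortWord α n × Fin p) =>
    (hr.pastProducts hρ hL).exists_inner_append a.1.1 (zlp P ρ u y [] (t + a.1.1.length) a.2) t
  choose q hqmem hq using hq
  let X : ℤ → Fin n → Lp ℝ 2 P := fun t i => ∑ a, Oinv i a • q t a
  refine ⟨fun t ω i => (X t i : Ω → ℝ) ω, (isProjectedState_iff hρ hr hR hO _).2 fun t i => ?_⟩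
  have hX : vlp P (fun t ω i => (X t i : Ω → ℝ) ω) t i = X t i := lp_eq (Filter.EventuallyEq.refl _ _)
  rw [hX]
  refine ⟨Lp.memLp _, Submodule.sum_mem _ fun a _ => Submodule.smul_mem _ _ (hqmem t a),
    fun σ v j => ?_⟩
  have h2 : wordProd R.A v *ᵥ R.B (j, σ) =
      Oinv *ᵥ (R.obsMatrix *ᵥ (wordProd R.A v *ᵥ R.B (j, σ))) := by
    rw [Matrix.mulVec_mulVec _ Oinv, hO, Matrix.one_mulVec]
  rw [h2, sum_inner]
  refine Finset.sum_congr rfl fun a _ => ?_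
  rw [real_inner_smul_left, hq t a _ (by simp), List.cons_append, output_cov hr,
    SeriesRep.obsMatrix_mulVec, hR, wordProd_append, Matrix.mulVec_mulVec, Matrix.mul_assoc]

theorem isForwardInnovation_iff (hr : MemLpPast P ρ u y) (e : ℤ → Ω → Fin p → ℝ) :
    IsForwardInnovation P ρ u y e ↔ ∀ t i, MemLp (fun ω => y t ω i - e t ω i) 2 P ∧
      lp P (fun ω => y t ω i - e t ω i) ∈ wordSpan (zlp P ρ u y) (nonemptyWords α) t ∧
      ∀ w, w ≠ [] → ∀ j, inner ℝ (lp P fun ω => y t ω i - e t ω i) (zlp P ρ u y w t j) =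
        inner ℝ (zlp P ρ u y [] t i) (zlp P ρ u y w t j) := by
  have hyt : ∀ t i, MemLp (fun ω => y t ω i) 2 P := fun t i => by
    simpa only [zPast_nil] using hr [] t i
  refine forall_congr' fun t => ?_
  rw [isLinProj_pastFamily hr t fun w _ i j => (hyt t i).integrable_mul (hr w t j)]
  have h1 : ∀ w i j, ∫ ω, y t ω i * zPast ρ u y w t ω j ∂P =
      inner ℝ (zlp P ρ u y [] t i) (zlp P ρ u y w t j) := fun w i j => by
    rw [zlp_nil, zlp, inner_lp (hyt t i) (hr w t j)]
  simp only [h1]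

theorem exists_isForwardInnovation (hr : MemLpPast P ρ u y) :
    ∃ e, IsForwardInnovation P ρ u y e := by
  have hq := fun (t : ℤ) (i : Fin p) => exists_mem_cspan_inner_eq
    (restrWords (zlp P ρ u y) (nonemptyWords α) t) (zlp P ρ u y [] t i)
  choose q hqmem hq using hq
  refine ⟨fun t ω i => y t ω i - (q t i : Ω → ℝ) ω, (isForwardInnovation_iff hr _).2
    fun t i => ?_⟩
  simp only [sub_sub_cancel]
  have hX : lp P (fun ω => (q t i : Ω → ℝ) ω) = q t i := lp_eq (Filter.EventuallyEq.refl _ _)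
  rw [hX]
  exact ⟨Lp.memLp _, hqmem t i, fun w hw j => hq t i (⟨w, hw⟩, j)⟩

/-- The products of the entries of a process with a normalized input. -/
noncomputable def shiftLp (P : Measure Ω) (ρ : α → ℝ) (u : α → ℤ → Ω → ℝ) {k : ℕ}
    (r : ℤ → Ω → Fin k → ℝ) (σ : α) (t : ℤ) (i : Fin k) : Lp ℝ 2 P :=
  lp P fun ω => r t ω i * (u σ t ω * (1 / √(ρ σ)))

theorem inputCov_eq (hρ : ∀ σ, 0 < ρ σ) {k : ℕ} {r : ℤ → Ω → Fin k → ℝ} {σ : α} {t : ℤ}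
    (hr : ∀ i, MemLp (fun ω => r t ω i * (u σ t ω * (1 / √(ρ σ)))) 2 P) :
    (∀ i j, Integrable (fun ω => r t ω i * r t ω j * (u σ t ω * u σ t ω)) P) ∧
      inputCov P u r σ t = ρ σ • gram (shiftLp P ρ u r σ t) (shiftLp P ρ u r σ t) := by
  have hs : √(ρ σ) * √(ρ σ) = ρ σ := Real.mul_self_sqrt (hρ σ).le
  have hne : √(ρ σ) ≠ 0 := (Real.sqrt_pos.2 (hρ σ)).ne'
  have h1 : ∀ i j ω, r t ω i * r t ω j * (u σ t ω * u σ t ω) =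
      ρ σ * ((r t ω i * (u σ t ω * (1 / √(ρ σ)))) * (r t ω j * (u σ t ω * (1 / √(ρ σ))))) := by
    intro i j ω
    nth_rw 1 [← hs]
    field_simp
  constructor
  · intro i j
    simp only [h1]
    exact ((hr i).integrable_mul (hr j)).const_mul _
  · ext i j
    simp only [inputCov, Matrix.of_apply, h1]
    rw [integral_const_mul, Matrix.smul_apply, gram_apply, shiftLp, shiftLp,
      inner_lp (hr i) (hr j), smul_eq_mul]

end Construction

/-! ### The innovation representation as a system of random processes. -/

section Realization

variable {Ω : Type*} [MeasurableSpace Ω] {P : Measure Ω} {α : Type*} {ρ : α → ℝ}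
  {u : α → ℤ → Ω → ℝ} {L : Set (List α)} {p n : ℕ} {y : ℤ → Ω → Fin p → ℝ}

theorem isUnit_of_rank_eq {M : Matrix (Fin p) (Fin p) ℝ} (hM : M.rank = p) : IsUnit M := by
  rw [← Matrix.mulVec_surjective_iff_isUnit]
  have : LinearMap.range M.mulVecLin = ⊤ :=
    Submodule.eq_top_of_finrank_eq (by simpa [Matrix.rank] using hM)
  exact LinearMap.range_eq_top.1 this

theorem zlp_letter (hρ : ∀ σ, 0 < ρ σ) {k : ℕ} (r : ℤ → Ω → Fin k → ℝ) (σ : α) (t : ℤ) :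
    zlp P ρ u r [σ] (t + 1) = shiftLp P ρ u r σ t := by
  ext1 i
  have h1 : ∀ ω, zPast ρ u r [σ] (t + 1) ω i = r t ω i * (u σ t ω * (1 / √(ρ σ))) := fun ω => by
    have := zPast_snoc (u := u) hρ r [] σ t ω i
    rwa [zPast_nil] at this
  simp only [zlp, shiftLp, h1]

/-- The standing situation: `x` is the projected state of a minimal representation `R` and `e` the
innovation process. -/
structure IsInnovationSetting (P : Measure Ω) (ρ : α → ℝ) (u : α → ℤ → Ω → ℝ)
    (L : Set (List α)) (y : ℤ → Ω → Fin p → ℝ) (R : SeriesRep α (Fin p × α) p n)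
    (x : ℤ → Ω → Fin n → ℝ) (e : ℤ → Ω → Fin p → ℝ) : Prop where
  pos : ∀ σ, 0 < ρ σ
  admissible : IsAdmissible P u L
  output : OutputAssumption P ρ u L y
  minimal : R.IsMinimal (outputFamily P ρ u y)
  state : ∀ t i, MemLp (fun ω => x t ω i) 2 P ∧
      vlp P x t i ∈ wordSpan (zlp P ρ u y) (nonemptyWords α) t ∧
      ∀ σ v j, inner ℝ (vlp P x t i) (zlp P ρ u y (σ :: v) t j) =
        (wordProd R.A v *ᵥ R.B (j, σ)) i
  innovation : IsForwardInnovation P ρ u y e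

namespace IsInnovationSetting

variable {R : SeriesRep α (Fin p × α) p n} {x : ℤ → Ω → Fin n → ℝ} {e : ℤ → Ω → Fin p → ℝ}

theorem memLp_shift_state (h : IsInnovationSetting P ρ u L y R x e) (σ : α) (t : ℤ) (i : Fin n) :
    MemLp (fun ω => x t ω i * (u σ t ω * (1 / √(ρ σ)))) 2 P ∧
      (vlp P x t i, shiftLp P ρ u x σ t i) ∈ inputGraph P ρ u σ t := by
  obtain ⟨g, hg, -, -⟩ := (h.output.rc.pastProducts h.pos h.admissible).exists_shift
    (isShiftGraph_inputGraph ρ u) subset_rfl σ (h.state t i).2.1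
  obtain ⟨h1, h2⟩ := lp_mul_of_mem_mulGraph (h.state t i).1 hg
  refine ⟨h1, ?_⟩
  rw [shiftLp, h2]
  exact hg

theorem isState (h : IsInnovationSetting P ρ u L y R x e) :
    IsState L (inputGraph P ρ u) (zlp P ρ u y) (outputFamily P ρ u y) R (vlp P x)
      (shiftLp P ρ u x) where
  past := h.output.rc.pastProducts h.pos h.admissible
  graph := isShiftGraph_inputGraph ρ u
  snoc := h.admissible.isSnocAdmissible
  minimal := h.minimal
  cov := output_cov h.output.rc
  mem t i := (h.state t i).2.1
  inner_eq t i := (h.state t i).2.2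
  shift σ t i := (h.memLp_shift_state σ t i).2

theorem memLp_output (h : IsInnovationSetting P ρ u L y R x e) (t : ℤ) (i : Fin p) :
    MemLp (fun ω => y t ω i) 2 P := h.output.rc.memLp t i

theorem memLp_innovation (h : IsInnovationSetting P ρ u L y R x e) (t : ℤ) (i : Fin p) :
    MemLp (fun ω => e t ω i) 2 P := by
  have h1 := ((isForwardInnovation_iff h.output.rc.memLpPast e).1 h.innovation t i).1
  convert (h.memLp_output t i).sub h1 using 1
  ext ω
  simp

/-- `C x(t)` lies in the past space and leaves a residual orthogonal to it, so it is the projection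
of `y(t)`. -/
theorem innovation_eq (h : IsInnovationSetting P ρ u L y R x e) (t : ℤ) :
    vlp P e t = innov (zlp P ρ u y) R.C (vlp P x) t := by
  ext1 i
  obtain ⟨h1, h2, h3⟩ :=
    (isForwardInnovation_iff h.output.rc.memLpPast e).1 h.innovation t i
  have h4 : lp P (fun ω => y t ω i - e t ω i) = vact R.C (vlp P x t) i := by
    refine eq_of_mem_cspan_of_inner_eq h2 (vact_mem R.C (h.isState.mem t) i) ?_
    rintro ⟨⟨w, hw⟩, j⟩
    simp only [restrWords]
    have h5 := h.isState.product_inner_innov hw t i j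
    rw [innov, Pi.sub_apply, inner_sub_right, sub_eq_zero] at h5
    rw [h3 w hw j, real_inner_comm, h5, real_inner_comm]
  rw [lp_sub (h.memLp_output t i) (h.memLp_innovation t i)] at h4
  rw [innov, Pi.sub_apply, ← h4, zlp_nil]
  exact (sub_sub_cancel _ _).symm

/-- The first letter takes `e` to `z_σ` minus `C` times the shifted state, which lies in the past
space; from then on each further letter acts as a contraction there. -/
theorem memLpPast_innovation (h : IsInnovationSetting P ρ u L y R x e) : MemLpPast P ρ u e := by
  have key : ∀ (w : List α) (σ : α) t i,
      MemLp (fun ω => zPast ρ u e (w ++ [σ]) (t + 1) ω i) 2 P ∧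
      zlp P ρ u e (w ++ [σ]) (t + 1) i ∈
        wordSpan (zlp P ρ u y) (nonemptyWords α) (t + 1) := by
    intro w
    induction w using List.reverseRecOn with
    | nil =>
      intro σ t i
      have h1 := h.isState.innov_shift σ t i
      rw [← h.innovation_eq] at h1
      obtain ⟨h2, h3⟩ := lp_mul_of_mem_mulGraph (h.memLp_innovation t i) h1
      simp only [zlp, zPast_snoc h.pos, zPast_nil]
      rw [h3]
      exact ⟨h2, endingSpan_le (h.isState.innovShift_mem σ t i)⟩
    | append_singleton w τ ih =>
      intro σ t i
      obtain ⟨h0, h1⟩ := ih τ (t - 1) i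
      rw [sub_add_cancel] at h0 h1
      obtain ⟨g, hg, -, -⟩ := h.isState.past.exists_shift h.isState.graph subset_rfl σ h1
      obtain ⟨h2, h3⟩ := lp_mul_of_mem_mulGraph h0 hg
      have h4 : ∀ ω, zPast ρ u e ((w ++ [τ]) ++ [σ]) (t + 1) ω i =
        zPast ρ u e (w ++ [τ]) t ω i * (u σ t ω * (1 / √(ρ σ))) :=
        fun ω => zPast_snoc h.pos e _ σ t ω i
      simp only [zlp, h4]
      rw [h3]
      exact ⟨h2, endingSpan_le (h.isState.past.shift_mem h.isState.graph h1 hg)⟩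
  intro w t i
  rcases List.eq_nil_or_concat w with rfl | ⟨w, σ, rfl⟩
  · simpa only [zPast_nil] using h.memLp_innovation t i
  · rw [List.concat_eq_append]
    have := (key w σ (t - 1) i).1
    rwa [sub_add_cancel] at this

theorem isNoise (h : IsInnovationSetting P ρ u L y R x e) :
    IsNoise L (inputGraph P ρ u) (zlp P ρ u y) R.C (vlp P x) (zlp P ρ u e) where
  nil t := by
    rw [← h.innovation_eq]
    ext1 i
    exact zlp_nil e t i
  step := h.memLpPast_innovation.step h.pos
  zero _ hw hwL t i := zlp_eq_zero h.admissible e hw hwL t i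

theorem shiftLp_innovation (h : IsInnovationSetting P ρ u L y R x e) (σ : α) (t : ℤ) :
    shiftLp P ρ u e σ t = innovShift (zlp P ρ u y) R.C (shiftLp P ρ u x) σ t := by
  rw [← zlp_letter h.pos, h.isNoise.letter h.isState]

theorem memLp_shift_innovation (h : IsInnovationSetting P ρ u L y R x e) (σ : α) (t : ℤ)
    (i : Fin p) : MemLp (fun ω => e t ω i * (u σ t ω * (1 / √(ρ σ)))) 2 P := by
  have h1 := h.isState.innov_shift σ t i
  rw [← h.innovation_eq] at h1
  exact (lp_mul_of_mem_mulGraph (h.memLp_innovation t i) h1).1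

theorem inputCov_state (h : IsInnovationSetting P ρ u L y R x e) (σ : α) (t : ℤ) :
    inputCov P u x σ t =
      ρ σ • gram (shiftLp P ρ u x σ 0) (shiftLp P ρ u x σ 0) := by
  rw [(inputCov_eq h.pos fun i => (h.memLp_shift_state σ t i).1).2, h.isState.gram_mx_const σ t 0]

theorem covT_output (h : IsInnovationSetting P ρ u L y R x e) (σ : α) (t : ℤ) :
    covT P ρ u y [σ] [σ] = gram (zlp P ρ u y [σ] (t + 1)) (zlp P ρ u y [σ] (t + 1)) := by
  ext i j
  rw [gram_apply, inner_zlp h.output.rc.memLpPast,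
    h.output.rc.crossCov_eq _ _ (by simp) (t + 1) 0]
  rfl

theorem gainCov_eq (h : IsInnovationSetting P ρ u L y R x e) (σ : α) (t : ℤ)
    {Pst : α → Matrix (Fin n) (Fin n) ℝ}
    (hP : ∀ σ, Pst σ = ρ σ • gram (shiftLp P ρ u x σ 0) (shiftLp P ρ u x σ 0)) :
    gainCov P ρ u y R Pst σ =
      ρ σ • (gram (zlp P ρ u y [σ] (t + 1)) (zlp P ρ u y [σ] (t + 1)) -
        R.C * gram (shiftLp P ρ u x σ t) (shiftLp P ρ u x σ t) * R.Cᵀ) := by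
  rw [gainCov, hP, h.covT_output σ t, h.isState.gram_mx_const σ 0 t, smul_sub, Matrix.mul_smul,
    Matrix.smul_mul]

theorem gainCov_eq_innovShift (h : IsInnovationSetting P ρ u L y R x e) (σ : α) (t : ℤ)
    {Pst : α → Matrix (Fin n) (Fin n) ℝ}
    (hP : ∀ σ, Pst σ = ρ σ • gram (shiftLp P ρ u x σ 0) (shiftLp P ρ u x σ 0)) :
    gainCov P ρ u y R Pst σ =
      ρ σ • gram (innovShift (zlp P ρ u y) R.C (shiftLp P ρ u x) σ t)
        (innovShift (zlp P ρ u y) R.C (shiftLp P ρ u x) σ t) := by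
  rw [h.gainCov_eq σ t hP, h.isState.gram_innovShift]

theorem gainRhs_eq (h : IsInnovationSetting P ρ u L y R x e) (σ : α) (t : ℤ)
    {Pst : α → Matrix (Fin n) (Fin n) ℝ}
    (hP : ∀ σ, Pst σ = ρ σ • gram (shiftLp P ρ u x σ 0) (shiftLp P ρ u x σ 0)) :
    gainRhs ρ R Pst σ = √(ρ σ) • (R.BMat σ -
        R.A σ * gram (shiftLp P ρ u x σ t) (shiftLp P ρ u x σ t) * R.Cᵀ) := by
  have hs : 1 / √(ρ σ) * ρ σ = √(ρ σ) := by
    rw [one_div, inv_mul_eq_div, Real.div_sqrt]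
  rw [gainRhs, hP, h.isState.gram_mx_const σ 0 t, smul_sub, Matrix.mul_smul, Matrix.smul_mul,
    smul_smul, hs]

/-- This identifies the matrix of the gain equation as a noise covariance, so the full rank
condition is its invertibility. -/
theorem inputCov_innovation (h : IsInnovationSetting P ρ u L y R x e) (σ : α) (t : ℤ)
    {Pst : α → Matrix (Fin n) (Fin n) ℝ}
    (hP : ∀ σ, Pst σ = ρ σ • gram (shiftLp P ρ u x σ 0) (shiftLp P ρ u x σ 0)) :
    inputCov P u e σ t = gainCov P ρ u y R Pst σ := by
  rw [(inputCov_eq h.pos fun i => h.memLp_shift_innovation σ t i).2, h.shiftLp_innovation,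
    h.gainCov_eq_innovShift σ t hP]

theorem exists_gain (h : IsInnovationSetting P ρ u L y R x e) (σ : α)
    {Pst : α → Matrix (Fin n) (Fin n) ℝ}
    (hP : ∀ σ, Pst σ = ρ σ • gram (shiftLp P ρ u x σ 0) (shiftLp P ρ u x σ 0)) :
    ∃ K : Matrix (Fin n) (Fin p) ℝ, K * gainCov P ρ u y R Pst σ = gainRhs ρ R Pst σ := by
  refine exists_mul_eq_of_ker_le _ _ fun q hq => ?_
  rw [h.gainCov_eq_innovShift σ 0 hP, Matrix.smul_mulVec,
    smul_eq_zero_iff_right (h.pos σ).ne'] at hq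
  rw [h.gainRhs_eq σ 0 hP, Matrix.smul_mulVec, h.isState.gain_ker σ 0 hq, smul_zero]

/-- The Hilbert space argument uses inputs divided by `√ρ_σ`, so the gain there is `√ρ_σ K_σ`. -/
theorem gain_normalized (h : IsInnovationSetting P ρ u L y R x e) (σ : α) (t : ℤ)
    {Pst : α → Matrix (Fin n) (Fin n) ℝ}
    (hP : ∀ σ, Pst σ = ρ σ • gram (shiftLp P ρ u x σ 0) (shiftLp P ρ u x σ 0))
    {K : Matrix (Fin n) (Fin p) ℝ} (hK : K * gainCov P ρ u y R Pst σ = gainRhs ρ R Pst σ) :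
    (√(ρ σ) • K) * (gram (zlp P ρ u y [σ] (t + 1)) (zlp P ρ u y [σ] (t + 1)) -
        R.C * gram (shiftLp P ρ u x σ t) (shiftLp P ρ u x σ t) * R.Cᵀ) =
      R.BMat σ - R.A σ * gram (shiftLp P ρ u x σ t) (shiftLp P ρ u x σ t) * R.Cᵀ := by
  have hne : √(ρ σ) ≠ 0 := (Real.sqrt_pos.2 (h.pos σ)).ne'
  have hs : √(ρ σ) * √(ρ σ) = ρ σ := Real.mul_self_sqrt (h.pos σ).le
  rw [h.gainCov_eq σ t hP, h.gainRhs_eq σ t hP, Matrix.mul_smul] at hK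
  apply smul_right_injective _ hne
  simp only
  rw [← hK, Matrix.smul_mul, smul_smul, hs]

theorem output_eq (h : IsInnovationSetting P ρ u L y R x e) (t : ℤ) :
    ∀ᵐ ω ∂P, y t ω = R.C *ᵥ x t ω + (1 : Matrix (Fin p) (Fin p) ℝ) *ᵥ e t ω := by
  have h1 : ∀ i, ∀ᵐ ω ∂P, e t ω i = y t ω i - (R.C *ᵥ x t ω) i := fun i => by
    have hx := fun j => (h.state t j).1
    refine ae_eq_of_lp_eq (h.memLp_innovation t i)
      ((h.memLp_output t i).sub (memLp_mulVec R.C hx i)) ?_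
    have h2 := congrFun (h.innovation_eq t) i
    rw [innov, Pi.sub_apply, zlp_nil] at h2
    refine h2.trans ?_
    rw [lp_sub (h.memLp_output t i) (memLp_mulVec R.C hx i), lp_mulVec R.C hx]
    rfl
  filter_upwards [ae_all_iff.2 h1] with ω hω
  ext i
  simp [hω i]

theorem state_eq [Fintype α] (h : IsInnovationSetting P ρ u L y R x e)
    {Pst : α → Matrix (Fin n) (Fin n) ℝ}
    (hP : ∀ σ, Pst σ = ρ σ • gram (shiftLp P ρ u x σ 0) (shiftLp P ρ u x σ 0))
    {K : α → Matrix (Fin n) (Fin p) ℝ}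
    (hK : ∀ σ, K σ * gainCov P ρ u y R Pst σ = gainRhs ρ R Pst σ) (t : ℤ) (i : Fin n) :
    vlp P x (t + 1) i = ∑ σ, (vact (R.A σ) (shiftLp P ρ u x σ t) i +
      vact (√(ρ σ) • K σ) (innovShift (zlp P ρ u y) R.C (shiftLp P ρ u x) σ t) i) :=
  h.isState.state_eq (fun σ => √(ρ σ) • K σ) t (fun σ => h.gain_normalized σ t hP (hK σ)) i

theorem ae_state_eq [Fintype α] (h : IsInnovationSetting P ρ u L y R x e)
    {Pst : α → Matrix (Fin n) (Fin n) ℝ}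
    (hP : ∀ σ, Pst σ = ρ σ • gram (shiftLp P ρ u x σ 0) (shiftLp P ρ u x σ 0))
    {K : α → Matrix (Fin n) (Fin p) ℝ}
    (hK : ∀ σ, K σ * gainCov P ρ u y R Pst σ = gainRhs ρ R Pst σ) (t : ℤ) :
    ∀ᵐ ω ∂P, x (t + 1) ω =
      ∑ σ, u σ t ω • (((1 / √(ρ σ)) • R.A σ) *ᵥ x t ω + K σ *ᵥ e t ω) := by
  let X : α → Ω → Fin n → ℝ := fun σ ω j => x t ω j * (u σ t ω * (1 / √(ρ σ)))
  let Y : α → Ω → Fin p → ℝ := fun σ ω j => e t ω j * (u σ t ω * (1 / √(ρ σ)))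
  have hX : ∀ σ j, MemLp (fun ω => X σ ω j) 2 P := fun σ j => (h.memLp_shift_state σ t j).1
  have hY : ∀ σ j, MemLp (fun ω => Y σ ω j) 2 P := fun σ j => h.memLp_shift_innovation σ t j
  have h1 : ∀ i, ∀ᵐ ω ∂P, x (t + 1) ω i =
      ∑ σ, ((R.A σ *ᵥ X σ ω) i + ((√(ρ σ) • K σ) *ᵥ Y σ ω) i) := fun i => by
    have hXY : ∀ σ ∈ Finset.univ,
        MemLp (fun ω => (R.A σ *ᵥ X σ ω) i + ((√(ρ σ) • K σ) *ᵥ Y σ ω) i) 2 P := fun σ _ =>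
      (memLp_mulVec _ (hX σ) i).add (memLp_mulVec _ (hY σ) i)
    refine ae_eq_of_lp_eq (h.state (t + 1) i).1 (memLp_finsetSum _ hXY) ?_
    refine (h.state_eq hP hK t i).trans ?_
    rw [lp_sum Finset.univ hXY]
    refine Finset.sum_congr rfl fun σ _ => ?_
    rw [lp_add (memLp_mulVec _ (hX σ) i) (memLp_mulVec _ (hY σ) i), lp_mulVec _ (hX σ),
      lp_mulVec _ (hY σ), ← h.shiftLp_innovation]
    rfl
  filter_upwards [ae_all_iff.2 h1] with ω hω
  ext i
  rw [hω i, Finset.sum_apply]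
  refine Finset.sum_congr rfl fun σ _ => ?_
  have hX' : X σ ω = (u σ t ω * (1 / √(ρ σ))) • x t ω := by
    ext j
    simp [X, mul_comm]
  have hY' : Y σ ω = (u σ t ω * (1 / √(ρ σ))) • e t ω := by
    ext j
    simp [Y, mul_comm]
  have hne : √(ρ σ) ≠ 0 := (Real.sqrt_pos.2 (h.pos σ)).ne'
  rw [hX', hY', Matrix.mulVec_smul, Matrix.mulVec_smul, Matrix.smul_mulVec, Matrix.smul_mulVec]
  simp only [Pi.smul_apply, Pi.add_apply, smul_eq_mul]
  field_simp

theorem isRealization [Fintype α] (h : IsInnovationSetting P ρ u L y R x e)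
    {Pst : α → Matrix (Fin n) (Fin n) ℝ}
    (hP : ∀ σ, Pst σ = ρ σ • gram (shiftLp P ρ u x σ 0) (shiftLp P ρ u x σ 0))
    {K : α → Matrix (Fin n) (Fin p) ℝ}
    (hK : ∀ σ, K σ * gainCov P ρ u y R Pst σ = gainRhs ρ R Pst σ) :
    (innovationGBS ρ R K x e).IsRealization P u y :=
  ⟨h.ae_state_eq hP hK, h.output_eq⟩

/-- The mean is the inner product with the constant `1`, which is orthogonal to `y` and to its past
space. -/
theorem integral_zPast_innovation [IsProbabilityMeasure P]
    (h : IsInnovationSetting P ρ u L y R x e) (w : List α) (t : ℤ) (i : Fin p) :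
    ∫ ω, zPast ρ u e w t ω i ∂P = 0 := by
  have h1 : ∀ f : Ω → ℝ, MemLp f 2 P →
      ∫ ω, f ω ∂P = inner ℝ (lp P f) (lp P fun _ => (1 : ℝ)) := fun f hf => by
    rw [inner_lp hf (memLp_const 1)]
    simp
  have hpast : ∀ f ∈ wordSpan (zlp P ρ u y) (nonemptyWords α) t,
      inner ℝ f (lp P fun _ => (1 : ℝ)) = 0 := fun f hf =>
    inner_eq_zero_of_mem_wordSpan hf fun w hw i => by
      rw [zlp, ← h1 _ (h.output.rc.memLpPast w t i)]
      exact h.output.rc.mean_zero_z w hw t i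
  rw [h1 _ (h.memLpPast_innovation w t i)]
  by_cases hw : w = []
  · subst hw
    have h2 := congrFun (h.isNoise.nil t) i
    rw [zlp] at h2
    rw [h2, innov, Pi.sub_apply, inner_sub_left,
      hpast _ (vact_mem R.C (h.isState.mem t) i), sub_zero, zlp_nil,
      ← h1 _ (h.memLp_output t i)]
    exact h.output.rc.mean_zero t i
  · exact hpast _ (h.isNoise.mem_nonempty h.isState hw t i)

theorem covT_innovation (h : IsInnovationSetting P ρ u L y R x e) (σ : α) :
    covT P ρ u e [σ] [σ] = gram (zlp P ρ u y [σ] (-1 + 1)) (zlp P ρ u y [σ] (-1 + 1)) -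
      R.C * gram (shiftLp P ρ u x σ (-1)) (shiftLp P ρ u x σ (-1)) * R.Cᵀ := by
  rw [← h.isState.gram_innovShift, ← h.shiftLp_innovation, ← zlp_letter h.pos]
  ext i j
  rw [gram_apply, inner_zlp h.memLpPast_innovation]
  rfl

theorem isStableMatrix [Fintype α] (h : IsInnovationSetting P ρ u L y R x e) :
    IsStableMatrix (∑ σ, ρ σ • (((1 / √(ρ σ)) • R.A σ)ᵀ ⊗ₖ ((1 / √(ρ σ)) • R.A σ)ᵀ)) := by
  have h1 : ∀ σ, ρ σ • (((1 / √(ρ σ)) • R.A σ)ᵀ ⊗ₖ ((1 / √(ρ σ)) • R.A σ)ᵀ) =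
      (R.A σ)ᵀ ⊗ₖ (R.A σ)ᵀ := fun σ => by
    have hne : √(ρ σ) ≠ 0 := (Real.sqrt_pos.2 (h.pos σ)).ne'
    have hs : ρ σ = √(ρ σ) * √(ρ σ) := (Real.mul_self_sqrt (h.pos σ).le).symm
    rw [Matrix.transpose_smul, Matrix.smul_kronecker, Matrix.kronecker_smul, smul_smul, smul_smul]
    have : ρ σ * (1 / √(ρ σ) * (1 / √(ρ σ))) = 1 := by
      nth_rw 1 [hs]
      field_simp
    rw [← mul_assoc] at this
    rw [this, one_smul]
  simp only [h1]
  exact isStableMatrix_kronecker_sum _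
    (SeriesRep.summable_wordProd_sq h.minimal h.output.squareSummable)

theorem isForwardInnovationForm [Fintype α] [IsProbabilityMeasure P]
    (h : IsInnovationSetting P ρ u L y R x e)
    {Pst : α → Matrix (Fin n) (Fin n) ℝ}
    (hP : ∀ σ, Pst σ = ρ σ • gram (shiftLp P ρ u x σ 0) (shiftLp P ρ u x σ 0))
    {K : α → Matrix (Fin n) (Fin p) ℝ}
    (hK : ∀ σ, K σ * gainCov P ρ u y R Pst σ = gainRhs ρ R Pst σ) :
    (innovationGBS ρ R K x e).IsForwardInnovationForm P ρ u L y where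
  D_eq_one := rfl
  innovation := h.innovation
  regular :=
    { noise_rc := isRC_of_pastProducts h.memLpPast_innovation h.integral_zPast_innovation
        (h.isNoise.pastProducts h.isState)
      noise_orthogonal := fun w w' _ _ hne t => by
        ext i j
        rw [Matrix.zero_apply, ← h.isNoise.inner_eq_zero_of_ne h.isState hne t i j,
          inner_zlp h.memLpPast_innovation]
        rfl
      state_mem := fun t => (inHilbertSpan_pastFamily h.memLpPast_innovation t).2 fun i =>
        ⟨(h.state t i).1, h.isNoise.state_mem h.isState (fun σ => √(ρ σ) • K σ)
          (h.state_eq hP hK)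
          (SeriesRep.summable_wordProd_sq h.minimal h.output.squareSummable) t i⟩
      stable := h.isStableMatrix
      admissible := fun σ₁ σ₂ h12 => by
        have hA := h.isState.mul_eq_zero h12
        have hB : R.A σ₂ * R.BMat σ₁ = 0 := by
          ext i j
          exact congrFun (h.isState.snoc_mulVec_eq_zero h12 j) i
        have hne : √(ρ σ₁) ≠ 0 := (Real.sqrt_pos.2 (h.pos σ₁)).ne'
        change ((1 / √(ρ σ₂)) • R.A σ₂) * ((1 / √(ρ σ₁)) • R.A σ₁) = 0 ∧
          ((1 / √(ρ σ₂)) • R.A σ₂) * K σ₁ * covT P ρ u e [σ₁] [σ₁] = 0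
        refine ⟨by rw [Matrix.smul_mul, Matrix.mul_smul, hA, smul_zero, smul_zero], ?_⟩
        -- Time `-1` makes the shifted innovation live at time `0`, where `covT` is evaluated. The
        -- gain equation then rewrites `K_{σ₁} T^e` through `B_{σ₁}` and `A_{σ₁}`, both killed by
        -- `A_{σ₂}`.
        have hg := h.gain_normalized σ₁ (-1) hP (hK σ₁)
        rw [← h.covT_innovation] at hg
        have h3 : √(ρ σ₁) • (R.A σ₂ * (K σ₁ * covT P ρ u e [σ₁] [σ₁])) = 0 := by
          rw [← Matrix.mul_smul, ← Matrix.smul_mul, hg, Matrix.mul_sub, hB, ← Matrix.mul_assoc,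
            ← Matrix.mul_assoc, hA]
          simp
        rw [smul_eq_zero_iff_right hne] at h3
        rw [Matrix.smul_mul, Matrix.smul_mul, Matrix.mul_assoc, h3, smul_zero] }

end IsInnovationSetting

end Realization

end StochReal

theorem mainTheorem4 {Ω : Type*} [MeasurableSpace Ω] (P : Measure Ω) [IsProbabilityMeasure P]
    {α : Type*} [Fintype α]
    (ρ : α → ℝ) (hρ : ∀ σ, 0 < ρ σ)
    (u : α → ℤ → Ω → ℝ) (hu : InputAssumption P u)
    (L : Set (List α)) (hL : IsAdmissible P u L)
    {p : ℕ} (y : ℤ → Ω → Fin p → ℝ) (hy : OutputAssumption P ρ u L y) :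
    -- a realization in forward innovation form exists
    (∃ (n : ℕ) (B : GBS Ω α n p p),
      B.IsRealization P u y ∧ B.IsForwardInnovationForm P ρ u L y) ∧
    -- the ingredients of the construction exist
    (∃ (n : ℕ) (R : SeriesRep α (Fin p × α) p n), R.IsMinimal (outputFamily P ρ u y)) ∧
    (∃ e, IsForwardInnovation P ρ u y e) ∧
    -- the construction, from an arbitrary minimal representation
    ∀ (n : ℕ) (R : SeriesRep α (Fin p × α) p n), R.IsMinimal (outputFamily P ρ u y) →
      (∃ Oinv : Matrix (Fin n) (ShortWord α n × Fin p) ℝ, Oinv * R.obsMatrix = 1) ∧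
      ∀ Oinv : Matrix (Fin n) (ShortWord α n × Fin p) ℝ, Oinv * R.obsMatrix = 1 →
        (∃ x, IsProjectedState P ρ u y Oinv x) ∧
        ∀ x e, IsProjectedState P ρ u y Oinv x → IsForwardInnovation P ρ u y e →
          ∃ Pst : α → Matrix (Fin n) (Fin n) ℝ,
            -- `Pst σ = E[x(t) x(t)ᵀ u_σ(t)²]`, for all `t`
            (∀ σ t i j, Integrable (fun ω => x t ω i * x t ω j * (u σ t ω * u σ t ω)) P) ∧
            (∀ σ t, inputCov P u x σ t = Pst σ) ∧
            -- the gain equation is solvable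
            (∃ K : α → Matrix (Fin n) (Fin p) ℝ,
              ∀ σ, K σ * gainCov P ρ u y R Pst σ = gainRhs ρ R Pst σ) ∧
            -- every solution gives a realization in forward innovation form
            (∀ K : α → Matrix (Fin n) (Fin p) ℝ,
              (∀ σ, K σ * gainCov P ρ u y R Pst σ = gainRhs ρ R Pst σ) →
                (innovationGBS ρ R K x e).IsRealization P u y ∧
                (innovationGBS ρ R K x e).IsForwardInnovationForm P ρ u L y) ∧
            -- the full rank case
            (IsFullRank P ρ u y →
              (∀ σ, IsUnit (gainCov P ρ u y R Pst σ)) ∧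
              ∀ K : α → Matrix (Fin n) (Fin p) ℝ,
                (∀ σ, K σ * gainCov P ρ u y R Pst σ = gainRhs ρ R Pst σ) →
                ∀ σ, K σ = gainRhs ρ R Pst σ * (gainCov P ρ u y R Pst σ)⁻¹) := by
  have construction : ∀ (n : ℕ) (R : SeriesRep α (Fin p × α) p n),
      R.IsMinimal (outputFamily P ρ u y) →
      ∀ Oinv : Matrix (Fin n) (ShortWord α n × Fin p) ℝ, Oinv * R.obsMatrix = 1 →
      ∀ x e, IsProjectedState P ρ u y Oinv x → IsForwardInnovation P ρ u y e →
        IsInnovationSetting P ρ u L y R x e := fun n R hR Oinv hO x e hx he =>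
    ⟨hρ, hL, hy, hR, (isProjectedState_iff hρ hy.rc hR.1 hO x).1 hx, he⟩
  obtain ⟨e₀, he₀⟩ := exists_isForwardInnovation hy.rc.memLpPast
  obtain ⟨n₀, R₀, hR₀⟩ := SeriesRep.exists_isMinimal hy.rational
  refine ⟨?_, ⟨n₀, R₀, hR₀⟩, ⟨e₀, he₀⟩, fun n R hR =>
    ⟨SeriesRep.exists_obsMatrix_leftInverse hR, fun Oinv hO =>
      ⟨exists_isProjectedState hρ hL hy.rc hR.1 hO, fun x e hx he => ?_⟩⟩⟩
  · obtain ⟨Oinv, hO⟩ := SeriesRep.exists_obsMatrix_leftInverse hR₀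
    obtain ⟨x, hx⟩ := exists_isProjectedState hρ hL hy.rc hR₀.1 hO
    have h := construction n₀ R₀ hR₀ Oinv hO x e₀ hx he₀
    have hK := fun σ => h.exists_gain σ (fun _ => rfl)
    choose K hK using hK
    exact ⟨n₀, innovationGBS ρ R₀ K x e₀, h.isRealization (fun _ => rfl) hK,
      h.isForwardInnovationForm (fun _ => rfl) hK⟩
  · have h := construction n R hR Oinv hO x e hx he
    -- `P_σ` is taken at time `0`; the factor `ρ_σ` undoes the normalization of the two inputs.
    refine ⟨fun σ => ρ σ • gram (shiftLp P ρ u x σ 0) (shiftLp P ρ u x σ 0),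
      fun σ t => (inputCov_eq hρ fun i => (h.memLp_shift_state σ t i).1).1, h.inputCov_state, ?_,
      fun K hK => ⟨h.isRealization (fun _ => rfl) hK, h.isForwardInnovationForm (fun _ => rfl) hK⟩,
      fun hfull => ?_⟩
    · have hK := fun σ => h.exists_gain σ (fun _ => rfl)
      choose K hK using hK
      exact ⟨K, hK⟩
    · have hU : ∀ σ, IsUnit (gainCov P ρ u y R
          (fun σ => ρ σ • gram (shiftLp P ρ u x σ 0) (shiftLp P ρ u x σ 0)) σ) := fun σ => by
        rw [← h.inputCov_innovation σ 0 (fun _ => rfl)]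
        exact isUnit_of_rank_eq (hfull e he σ 0)
      refine ⟨hU, fun K hK σ => ?_⟩
      rw [← hK σ, Matrix.mul_assoc,
        Matrix.mul_nonsing_inv _ ((Matrix.isUnit_iff_isUnit_det _).1 (hU σ)), Matrix.mul_one]
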